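/- **Setting (qCCS).** Fix sets of classical variables $x$ (ranging over $\mathbb R$), quantum variables $q$ (names of qubits; an infinite set), classical channels $c$ and quantum channels $\mathsf c$. *Process expressions* $E$ and their sets $qv(E)$ of free quantum variables are generated by $$\mathbf{nil},\; c?x.E,\; c!e.E,\; (\mathbf{qbit}\,q).E,\; \mathsf c?q.E,\; \mathsf c!q.E,\; U[\bar q].E,\; M[\bar q;x].E,\; E+F,\; E\|F,\; E[f],\; E\backslash L,\; \mathbf{if}\ b\ \mathbf{then}\ E,$$ where $e$ and $b$ are real- and boolean-valued expressions in the classical variables, $\bar q$ is a tuple of distinct quantum variables, $U$ is unitary and $M$ Hermitian on the qubits $\bar q$, $f$ is a relabeling function (classical channels to classical channels, quantum to quantum) and $L$ is a set of channels. Formation requires $q\notin qv(E)$ in $\mathsf c!q.E$ and $qv(E)\cap qv(F)=\emptyset$ in $E\|F$; $(\mathbf{qbit}\,q)$ and $\mathsf c?q$ bind $q$, while $c?x$ and $M[\bar q;x]$ bind $x$. An expression is *classical* if it is built without $(\mathbf{qbit}\,q)$, $\mathsf c?q$, $U[\bar q]$ and $M[\bar q;x]$. A *configuration* $\langle E;\bar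 q=\rho\rangle$ consists of an expression $E$, a finite set $\bar q\supseteq qv(E)$ and a density matrix $\rho$ of the qubits $\bar q$; $\bar q=\rho$ is its context, and contexts that differ only in the order of the variables are equal. *Transitions* $\mathcal C\xrightarrow{\alpha}\mu$, with $\alpha\in\{c?v,c!v,\mathsf c?r,\mathsf c!r,\tau\}$ and $\mu$ a finite-support probability distribution on configurations, are given by the usual rules of value-passing CCS for $c?x$, $c!e$, $+$, $[f]$, $\backslash L$, $\mathbf{if}$, interleaving and synchronization (the latter with the same context in both premises and in the conclusion), where in $E_1\|E_2$ one component can perform $\mathsf c?r$ by interleaving only if $r$ is not a free quantum variable of the other, together with: - $\langle(\mathbf{qbit}\,q).E;\bar q=\rho\rangle\xrightarrow{\tau}\langle E[r/q];r,\bar q=|0\rangle\langle0|\otimes\rho\rangle$ for $r\notin\bar q$; - $\langle\mathsf c?q.E;\bar q=\rho\rangle\xrightarrow{\mathsf c?r}\langle E[r/q];r,\bar q=\sigma\rangle$ for $r\notin\bar q$ and $\mathrm{Tr}_r\sigma=\rho$, and $\langle\mathsf c?q.E;\bar q=\rho\rangle\xrightarrow{\mathsf c?r}\langle E[r/q];\bar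 q=\rho\rangle$ for $r\in\bar q\setminus(qv(E)\setminus\{q\})$; - $\langle\mathsf c!q.E;C\rangle\xrightarrow{\mathsf c!q}\langle E;C\rangle$; - $\langle U[\bar r].E;\bar q=\rho\rangle\xrightarrow{\tau}\langle E;\bar q=U_{\bar r}\rho U_{\bar r}^\dagger\rangle$; - if $M=\sum_i\lambda_iP_i$ is the spectral decomposition, $\langle M[\bar r;x].E;\bar q=\rho\rangle\xrightarrow{\tau}\mu$, where $\mu$ gives probability $p_i=\mathrm{Tr}(P_{i,\bar r}\rho)$ to $\langle E[\lambda_i/x];\bar q=P_{i,\bar r}\rho P_{i,\bar r}/p_i\rangle$. A *combined* $\alpha$-transition is a finite convex combination of $\alpha$-transitions of the same configuration. An *adversary* chooses, depending on the finite history (the alternating sequence of configurations and actions so far), according to a finite-support distribution, either to halt or one of finitely many combined transitions, with distinct actions, of the current configuration. For a string $s=\alpha_1\cdots\alpha_n$ of actions and a finite-support distribution $\mu$, $\mathcal C\Rightarrow^{s}\mu$ means that some adversary, started at $\mathcal C$, halts in each $\mathcal D$ with probability exactly $\mu(\mathcal D)$, and that every history at which it halts with positive probability has an action string of the form $\tau^*\alpha_1\tau^*\cdots\tau^*\alpha_n\tau^*$.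 Let $\hat\tau$ be the empty string and $\hat\alpha=\alpha$ for $\alpha\neq\tau$. For an equivalence relation $R$, $\mu\equiv_R\nu$ means that $\mu$ and $\nu$ give the same mass to every $R$-class. An equivalence relation $R$ on configurations is a *weak probabilistic bisimulation* if $\mathcal C\,R\,\mathcal D$ implies: (a) whenever $\mathcal C\xrightarrow{\alpha}\mu$, there is $\nu$ with $\mathcal D\Rightarrow^{\hat\alpha}\nu$ and $\mu\equiv_R\nu$; (b) if neither $\mathcal C$ nor $\mathcal D$ has a transition, their contexts are equal. Write $\mathcal C\approx\mathcal D$ if some weak probabilistic bisimulation relates them. Configurations are *equal*, $\mathcal C\simeq\mathcal D$, if whenever $\mathcal C\xrightarrow{\alpha}\mu$ there is $\nu$ with $\mathcal D\Rightarrow^{\alpha}\nu$ and $\mu\equiv_\approx\nu$, symmetrically with $\mathcal C$ and $\mathcal D$ exchanged, and (b) holds. For expressions without free classical variables, $P\simeq Q$ means $\langle P;C\rangle\simeq\langle Q;C\rangle$ for every context $C$ whose variables include $qv(P)\cup qv(Q)$. For arbitrary expressions, $E\simeq F$ means $E[\bar v/\bar x]\simeq F[\bar v/\bar x]$ for all real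 values $\bar v$ of the free classical variables $\bar x$. **Theorem.** Let $E\simeq F$. Then 1. $a.E\simeq a.F$ for every prefix $a\in\{c?x,\;c!e,\;\mathsf c?q,\;\mathsf c!q,\;U[\bar q],\;M[\bar q;x]\}$, where for $a=\mathsf c!q$ it is assumed that $q\notin qv(E)\cup qv(F)$ (so that $a.E$ and $a.F$ are expressions), and for $a=\mathsf c?q$ that $qv(E)\setminus\{q\}=qv(F)\setminus\{q\}$; 2. $E+G\simeq F+G$ for every expression $G$; 3. $E\|G\simeq F\|G$ for every classical $G$ with $qv(G)\cap(qv(E)\cup qv(F))=\emptyset$ (so that both sides are expressions); 4. $E[f]\simeq F[f]$ for every relabeling function $f$. -/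

import Mathlib

universe u v w z

namespace QCCS

noncomputable section

open scoped ENNReal Matrix Kronecker ComplexOrder

/-! ### Classical data expressions -/

/-- Expressions with values in the real numbers: classical variables, constants, and arbitrary
real-valued operations of any finite arity. -/
inductive Exp (CV : Type u) : Type u
  | var (x : CV)
  | const (a : ℝ)
  | app {n : ℕ} (g : (Fin n → ℝ) → ℝ) (args : Fin n → Exp CV)

namespace Exp

variable {CV : Type u}

/-- The variables occurring in an expression. -/
def fv : Exp CV → Set CV
  | var x => {x}
  | const _ => ∅
  | app _ args => ⋃ i, (args i).fv

/-- The value under an assignment of reals to the variables. -/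
def eval (V : CV → ℝ) : Exp CV → ℝ
  | var x => V x
  | const a => a
  | app g args => g fun i => (args i).eval V

/-- Substitution of reals for those variables on which `s` is defined. -/
def subst (s : CV → Option ℝ) : Exp CV → Exp CV
  | var x => (s x).elim (var x) const
  | const a => const a
  | app g args => app g fun i => (args i).subst s

/-- `e` is closed and its value is `a`. An open expression has no value. -/
def HasValue (e : Exp CV) (a : ℝ) : Prop := e.fv = ∅ ∧ ∀ V, e.eval V = a

end Exp

/-- Boolean-valued expressions: an arbitrary predicate applied to real-valued expressions. -/
structure BExp (CV : Type u) : Type u where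
  arity : ℕ
  pred : (Fin arity → ℝ) → Prop
  args : Fin arity → Exp CV

namespace BExp

variable {CV : Type u}

def subst (s : CV → Option ℝ) (b : BExp CV) : BExp CV :=
  ⟨b.arity, b.pred, fun i => (b.args i).subst s⟩

/-- `b` is closed and its value is `true`. -/
def IsTrue (b : BExp CV) : Prop :=
  (∀ i, (b.args i).fv = ∅) ∧ ∀ V, b.pred fun i => (b.args i).eval V

end BExp

/-! ### Syntax -/

/-- A relabeling function sends classical channels to classical channels and quantum channels to
quantum channels. -/
structure Relabeling (CC : Type w) (QC : Type z) : Type (max w z) where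
  onC : CC → CC
  onQ : QC → QC

/-- Raw process expressions. `CV`, `QV`, `CC`, `QC` are the sets of classical variables, quantum
variables, classical channels and quantum channels. A tuple of `k` distinct quantum variables is an
embedding of `Fin k`, and the space of `k` qubits has the basis `Fin k → Fin 2`. -/
inductive Proc (CV : Type u) (QV : Type v) (CC : Type w) (QC : Type z) : Type (max u v w z)
  /-- the inactive process -/
  | nil
  /-- `c?x.E` -/
  | inC (c : CC) (x : CV) (E : Proc CV QV CC QC)
  /-- `c!e.E` -/
  | outC (c : CC) (e : Exp CV) (E : Proc CV QV CC QC)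
  /-- `(qbit q).E` -/
  | new (q : QV) (E : Proc CV QV CC QC)
  /-- quantum input of `q` -/
  | inQ (c : QC) (q : QV) (E : Proc CV QV CC QC)
  /-- quantum output of `q` -/
  | outQ (c : QC) (q : QV) (E : Proc CV QV CC QC)
  /-- `U[q₁,…,q_k].E` -/
  | unit {k : ℕ} (U : Matrix.unitaryGroup (Fin k → Fin 2) ℂ) (q : Fin k ↪ QV)
      (E : Proc CV QV CC QC)
  /-- `M[q₁,…,q_k;x].E` -/
  | meas {k : ℕ} (M : Matrix (Fin k → Fin 2) (Fin k → Fin 2) ℂ) (hM : M.IsHermitian)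
      (q : Fin k ↪ QV) (x : CV) (E : Proc CV QV CC QC)
  | sum (E F : Proc CV QV CC QC)
  | par (E F : Proc CV QV CC QC)
  | rel (E : Proc CV QV CC QC) (f : Relabeling CC QC)
  | res (E : Proc CV QV CC QC) (L : Set (CC ⊕ QC))
  | cond (b : BExp CV) (E : Proc CV QV CC QC)

namespace Proc

variable {CV : Type u} {QV : Type v} {CC : Type w} {QC : Type z} [DecidableEq CV] [DecidableEq QV]

/-- Free quantum variables. -/
def qv : Proc CV QV CC QC → Finset QV
  | nil => ∅
  | inC _ _ E => E.qv
  | outC _ _ E => E.qv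
  | new q E => E.qv.erase q
  | inQ _ q E => E.qv.erase q
  | outQ _ q E => insert q E.qv
  | unit _ q E => E.qv ∪ Finset.univ.map q
  | meas _ _ q _ E => E.qv ∪ Finset.univ.map q
  | sum E F => E.qv ∪ F.qv
  | par E F => E.qv ∪ F.qv
  | rel E _ => E.qv
  | res E _ => E.qv
  | cond _ E => E.qv

/-- The formation conditions: the raw expressions satisfying `WF` are the quantum process
expressions. -/
def WF : Proc CV QV CC QC → Prop
  | nil => True
  | inC _ _ E => E.WF
  | outC _ _ E => E.WF
  | new _ E => E.WF
  | inQ _ _ E => E.WF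
  | outQ _ q E => q ∉ E.qv ∧ E.WF
  | unit _ _ E => E.WF
  | meas _ _ _ _ E => E.WF
  | sum E F => E.WF ∧ F.WF
  | par E F => Disjoint E.qv F.qv ∧ E.WF ∧ F.WF
  | rel E _ => E.WF
  | res E _ => E.WF
  | cond _ E => E.WF

/-- Classical expressions: those built without qubit creation, quantum input, unitary
transformation and measurement. -/
def Classical : Proc CV QV CC QC → Prop
  | nil => True
  | inC _ _ E => E.Classical
  | outC _ _ E => E.Classical
  | new _ _ => False
  | inQ _ _ _ => False
  | outQ _ _ E => E.Classical
  | unit _ _ _ => False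
  | meas _ _ _ _ _ => False
  | sum E F => E.Classical ∧ F.Classical
  | par E F => E.Classical ∧ F.Classical
  | rel E _ => E.Classical
  | res E _ => E.Classical
  | cond _ E => E.Classical

/-- Substitution of reals for the free occurrences of the classical variables on which `s` is
defined; `c?x` and `M[q;x]` bind `x`. -/
def subst (s : CV → Option ℝ) : Proc CV QV CC QC → Proc CV QV CC QC
  | nil => nil
  | inC c x E => inC c x (E.subst (Function.update s x none))
  | outC c e E => outC c (e.subst s) (E.subst s)
  | new q E => new q (E.subst s)
  | inQ c q E => inQ c q (E.subst s)
  | outQ c q E => outQ c q (E.subst s)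
  | unit U q E => unit U q (E.subst s)
  | meas M hM q x E => meas M hM q x (E.subst (Function.update s x none))
  | sum E F => sum (E.subst s) (F.subst s)
  | par E F => par (E.subst s) (F.subst s)
  | rel E f => rel (E.subst s) f
  | res E L => res (E.subst s) L
  | cond b E => cond (b.subst s) (E.subst s)

/-- `E[a/x]`. -/
def subst₁ (E : Proc CV QV CC QC) (x : CV) (a : ℝ) : Proc CV QV CC QC :=
  E.subst (Function.update (fun _ => none) x (some a))

/-- `E[V]`: every free classical variable `x` is replaced by the real `V x`. -/
def inst (E : Proc CV QV CC QC) (V : CV → ℝ) : Proc CV QV CC QC :=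
  E.subst fun x => some (V x)

/-- Apply a permutation of the quantum variables to all (free and bound) quantum variables. -/
def perm (π : Equiv.Perm QV) : Proc CV QV CC QC → Proc CV QV CC QC
  | nil => nil
  | inC c x E => inC c x (E.perm π)
  | outC c e E => outC c e (E.perm π)
  | new q E => new (π q) (E.perm π)
  | inQ c q E => inQ c (π q) (E.perm π)
  | outQ c q E => outQ c (π q) (E.perm π)
  | unit U q E => unit U (q.trans π.toEmbedding) (E.perm π)
  | meas M hM q x E => meas M hM (q.trans π.toEmbedding) x (E.perm π)
  | sum E F => sum (E.perm π) (F.perm π)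
  | par E F => par (E.perm π) (F.perm π)
  | rel E f => rel (E.perm π) f
  | res E L => res (E.perm π) L
  | cond b E => cond b (E.perm π)

/-- `E[r/q]`, used only when `r ∉ qv(E) - {q}`. In that case exchanging `q` and `r` everywhere is,
up to the names of bound quantum variables, the capture-avoiding substitution of `r` for the free
occurrences of `q`: bound occurrences of `r`, which would capture, are renamed to `q`. -/
def qsubst (E : Proc CV QV CC QC) (q r : QV) : Proc CV QV CC QC := E.perm (Equiv.swap q r)

end Proc

/-! ### Quantum contexts -/

/-- Density matrices of the qubits in `S`. The qubits are indexed by their names, so a state does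
not depend on an order of listing the variables. -/
structure Density {QV : Type v} [DecidableEq QV] (S : Finset QV) : Type v where
  mat : Matrix (S → Fin 2) (S → Fin 2) ℂ
  posSemidef : mat.PosSemidef
  trace_eq : mat.trace = 1

/-- A quantum context `q̄ = ρ`. -/
structure Context (QV : Type v) [DecidableEq QV] : Type v where
  vars : Finset QV
  state : Density vars

section Operators

variable {QV : Type v} [DecidableEq QV]

/-- The operator `A` on `k` qubits, applied to the qubits `r₁,…,r_k` of `S` and tensored with the
identity on the remaining qubits of `S`. -/
def embed {S : Finset QV} {k : ℕ} (r : Fin k ↪ QV) (h : ∀ i, r i ∈ S)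
    (A : Matrix (Fin k → Fin 2) (Fin k → Fin 2) ℂ) : Matrix (S → Fin 2) (S → Fin 2) ℂ :=
  Matrix.of fun x y =>
    if ∀ s : S, (∀ i, r i ≠ s.1) → x s = y s then
      A (fun i => x ⟨r i, h i⟩) (fun i => y ⟨r i, h i⟩)
    else 0

/-- Separating the qubits `r₁,…,r_k` from the rest. -/
def splitEquiv {S : Finset QV} {k : ℕ} (r : Fin k ↪ QV) (h : ∀ i, r i ∈ S) :
    (S → Fin 2) ≃ (Fin k → Fin 2) × ({s : S // ∀ i, r i ≠ s.1} → Fin 2) :=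
  (Equiv.piEquivPiSubtypeProd (fun s : S => ∀ i, r i ≠ s.1) fun _ => Fin 2).trans <|
    (Equiv.prodComm _ _).trans <|
      Equiv.prodCongr
        (Equiv.arrowCongr
          (Equiv.ofBijective
            (fun i => (⟨⟨r i, h i⟩, fun hh => hh i rfl⟩ : {s : S // ¬ ∀ i, r i ≠ s.1}))
            ⟨fun i j hij => r.injective (by simpa using hij), fun s => by
              obtain ⟨s, hs⟩ := s
              push Not at hs
              obtain ⟨i, hi⟩ := hs
              exact ⟨i, by ext; exact hi⟩⟩).symm
          (Equiv.refl _))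
        (Equiv.refl _)

theorem embed_eq {S : Finset QV} {k : ℕ} (r : Fin k ↪ QV) (h : ∀ i, r i ∈ S)
    (A : Matrix (Fin k → Fin 2) (Fin k → Fin 2) ℂ) :
    embed r h A = (A ⊗ₖ (1 : Matrix ({s : S // ∀ i, r i ≠ s.1} → Fin 2) _ ℂ)).submatrix
      (splitEquiv r h) (splitEquiv r h) := by
  ext x y
  have h1 : ∀ x : S → Fin 2, (splitEquiv r h x).1 = fun i => x ⟨r i, h i⟩ := fun x => rfl
  have h2 : ∀ x : S → Fin 2, (splitEquiv r h x).2 = fun s => x s.1 := fun x => rfl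
  rw [Matrix.submatrix_apply, Matrix.kroneckerMap_apply, Matrix.one_apply, h1, h1, h2, h2]
  simp only [embed, Matrix.of_apply, funext_iff, Subtype.forall]
  split_ifs <;> simp_all

theorem embed_mul {S : Finset QV} {k : ℕ} (r : Fin k ↪ QV) (h : ∀ i, r i ∈ S)
    (A B : Matrix (Fin k → Fin 2) (Fin k → Fin 2) ℂ) :
    embed r h (A * B) = embed r h A * embed r h B := by
  simp only [embed_eq, Matrix.submatrix_mul_equiv, ← Matrix.mul_kronecker_mul, one_mul]

theorem embed_one {S : Finset QV} {k : ℕ} (r : Fin k ↪ QV) (h : ∀ i, r i ∈ S) :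
    embed r h 1 = 1 := by
  simp [embed_eq]

theorem embed_conjTranspose {S : Finset QV} {k : ℕ} (r : Fin k ↪ QV) (h : ∀ i, r i ∈ S)
    (A : Matrix (Fin k → Fin 2) (Fin k → Fin 2) ℂ) :
    (embed r h A)ᴴ = embed r h Aᴴ := by
  simp [embed_eq, Matrix.conjTranspose_submatrix, Matrix.conjTranspose_kronecker]

theorem embed_sum {S : Finset QV} {k : ℕ} (r : Fin k ↪ QV) (h : ∀ i, r i ∈ S) {ι : Type*}
    (s : Finset ι) (A : ι → Matrix (Fin k → Fin 2) (Fin k → Fin 2) ℂ) :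
    embed r h (∑ i ∈ s, A i) = ∑ i ∈ s, embed r h (A i) := by
  ext x y
  simp only [embed, Matrix.of_apply, Matrix.sum_apply]
  split_ifs <;> simp

/-- Separating a fresh qubit `r` from the qubits of `S`. -/
def consEquiv {S : Finset QV} {r : QV} (hr : r ∉ S) :
    ({s : QV // s ∈ insert r S} → Fin 2) ≃ Fin 2 × (S → Fin 2) where
  toFun x := (x ⟨r, Finset.mem_insert_self r S⟩,
    fun s => x ⟨s.1, Finset.mem_insert_of_mem s.2⟩)
  invFun p s := if hs : s.1 ∈ S then p.2 ⟨s.1, hs⟩ else p.1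
  left_inv x := by
    funext s
    by_cases hs : s.1 ∈ S
    · simp [hs]
    · have : s.1 = r := (Finset.mem_insert.1 s.2).resolve_right hs
      simp only [hs, dite_false]
      congr 1
      exact Subtype.ext this.symm
  right_inv p := by
    ext : 1
    · simp [hr]
    · funext s
      simp

/-- The partial trace over the qubit `r`. -/
def ptrace {S : Finset QV} {r : QV} (hr : r ∉ S)
    (σ : Matrix ({s : QV // s ∈ insert r S} → Fin 2) ({s : QV // s ∈ insert r S} → Fin 2) ℂ) :
    Matrix (S → Fin 2) (S → Fin 2) ℂ :=
  Matrix.of fun x y => ∑ b : Fin 2, σ ((consEquiv hr).symm (b, x)) ((consEquiv hr).symm (b, y))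

/-- The projector onto the eigenspace of `M` for the eigenvalue `l`. -/
def specProj {n : Type*} [Fintype n] [DecidableEq n] {M : Matrix n n ℂ} (hM : M.IsHermitian)
    (l : ℝ) : Matrix n n ℂ :=
  (hM.eigenvectorUnitary : Matrix n n ℂ) *
    Matrix.diagonal (fun i => if hM.eigenvalues i = l then 1 else 0) *
    (hM.eigenvectorUnitary : Matrix n n ℂ)ᴴ

theorem specProj_conjTranspose {n : Type*} [Fintype n] [DecidableEq n] {M : Matrix n n ℂ}
    (hM : M.IsHermitian) (l : ℝ) : (specProj hM l)ᴴ = specProj hM l := by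
  simp only [specProj, Matrix.conjTranspose_mul, Matrix.conjTranspose_conjTranspose,
    Matrix.diagonal_conjTranspose, Matrix.mul_assoc]
  congr 3
  funext i
  simp [apply_ite]

theorem specProj_mul_self {n : Type*} [Fintype n] [DecidableEq n] {M : Matrix n n ℂ}
    (hM : M.IsHermitian) (l : ℝ) : specProj hM l * specProj hM l = specProj hM l := by
  have hU : (hM.eigenvectorUnitary : Matrix n n ℂ)ᴴ * (hM.eigenvectorUnitary : Matrix n n ℂ) = 1 :=
    Matrix.mem_unitaryGroup_iff'.1 hM.eigenvectorUnitary.2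
  simp only [specProj, Matrix.mul_assoc]
  rw [← Matrix.mul_assoc _ᴴ, hU, Matrix.one_mul, ← Matrix.mul_assoc (Matrix.diagonal _),
    Matrix.diagonal_mul_diagonal]
  congr 3
  funext i
  simp

/-- The possible outcomes of measuring `M`: its distinct eigenvalues. -/
abbrev Outcome {n : Type*} [Fintype n] [DecidableEq n] {M : Matrix n n ℂ} (hM : M.IsHermitian) :
    Type :=
  {l : ℝ // l ∈ Finset.univ.image hM.eigenvalues}

theorem sum_specProj {n : Type*} [Fintype n] [DecidableEq n] {M : Matrix n n ℂ}
    (hM : M.IsHermitian) : ∑ l : Outcome hM, specProj hM l.1 = 1 := by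
  have hU : (hM.eigenvectorUnitary : Matrix n n ℂ) * (hM.eigenvectorUnitary : Matrix n n ℂ)ᴴ = 1 :=
    Matrix.mem_unitaryGroup_iff.1 hM.eigenvectorUnitary.2
  simp only [specProj]
  rw [← Finset.sum_mul, ← Finset.mul_sum]
  have : ∑ l : Outcome hM,
      Matrix.diagonal (fun i => if hM.eigenvalues i = l.1 then (1 : ℂ) else 0) = 1 := by
    ext i j
    rw [Matrix.sum_apply, Matrix.one_apply]
    by_cases hij : i = j
    · subst hij
      rw [Finset.sum_eq_single ⟨hM.eigenvalues i, Finset.mem_image_of_mem _ (Finset.mem_univ i)⟩]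
      · simp
      · intro l _ hl
        rw [Matrix.diagonal_apply_eq, if_neg]
        intro h
        exact hl (Subtype.ext h.symm)
      · simp
    · simp [hij]
  rw [this, Matrix.mul_one, hU]

end Operators

namespace Context

variable {QV : Type v} [DecidableEq QV]

/-- `r, q̄ = |0⟩⟨0| ⊗ ρ` for a fresh `r`. -/
def addZero (C : Context QV) (r : QV) (hr : r ∉ C.vars) : Context QV where
  vars := insert r C.vars
  state := by
    refine ⟨((Matrix.single 0 0 1 : Matrix (Fin 2) (Fin 2) ℂ) ⊗ₖ C.state.mat).submatrix
      (consEquiv hr) (consEquiv hr), ?_, ?_⟩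
    · rw [Matrix.posSemidef_submatrix_equiv]
      refine Matrix.PosSemidef.kronecker ?_ C.state.posSemidef
      have : (Matrix.single 0 0 1 : Matrix (Fin 2) (Fin 2) ℂ) =
          Matrix.diagonal (fun i => if i = 0 then 1 else 0) := by
        ext i j
        fin_cases i <;> fin_cases j <;> simp
      rw [this]
      refine Matrix.PosSemidef.diagonal fun i => ?_
      by_cases hi : i = 0 <;> simp [hi]
    · have h1 := Matrix.trace_kronecker (Matrix.single 0 0 1 : Matrix (Fin 2) (Fin 2) ℂ) C.state.mat
      rw [C.state.trace_eq, Matrix.trace_single_eq_same, one_mul] at h1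
      refine Eq.trans ?_ h1
      simp only [Matrix.trace, Matrix.diag, Matrix.submatrix_apply]
      exact Equiv.sum_comp (consEquiv hr) fun p =>
        ((Matrix.single 0 0 1 : Matrix (Fin 2) (Fin 2) ℂ) ⊗ₖ C.state.mat) p p

/-- `q̄ = U_r ρ U_r†`. -/
def applyUnitary (C : Context QV) {k : ℕ} (U : Matrix.unitaryGroup (Fin k → Fin 2) ℂ)
    (r : Fin k ↪ QV) (h : ∀ i, r i ∈ C.vars) : Context QV where
  vars := C.vars
  state := by
    refine ⟨embed r h U.1 * C.state.mat * (embed r h U.1)ᴴ,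
      C.state.posSemidef.mul_mul_conjTranspose_same _, ?_⟩
    have hU : U.1ᴴ * U.1 = 1 := Matrix.mem_unitaryGroup_iff'.1 U.2
    rw [Matrix.trace_mul_cycle, embed_conjTranspose, ← embed_mul, hU, embed_one, Matrix.one_mul]
    exact C.state.trace_eq

/-- `Tr(P_{l,r} ρ)`, the probability of the outcome `l`. -/
def outcomeProb (C : Context QV) {k : ℕ} {M : Matrix (Fin k → Fin 2) (Fin k → Fin 2) ℂ}
    (hM : M.IsHermitian) (r : Fin k ↪ QV) (h : ∀ i, r i ∈ C.vars) (l : ℝ) : ℝ :=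
  (embed r h (specProj hM l) * C.state.mat).trace.re

/-- `P_{l,r} ρ P_{l,r}`. -/
def collapse (C : Context QV) {k : ℕ} {M : Matrix (Fin k → Fin 2) (Fin k → Fin 2) ℂ}
    (hM : M.IsHermitian) (r : Fin k ↪ QV) (h : ∀ i, r i ∈ C.vars) (l : ℝ) :
    Matrix (C.vars → Fin 2) (C.vars → Fin 2) ℂ :=
  embed r h (specProj hM l) * C.state.mat * embed r h (specProj hM l)

theorem collapse_posSemidef (C : Context QV) {k : ℕ}
    {M : Matrix (Fin k → Fin 2) (Fin k → Fin 2) ℂ}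
    (hM : M.IsHermitian) (r : Fin k ↪ QV) (h : ∀ i, r i ∈ C.vars) (l : ℝ) :
    (C.collapse hM r h l).PosSemidef := by
  have := C.state.posSemidef.mul_mul_conjTranspose_same (embed r h (specProj hM l))
  rwa [embed_conjTranspose, specProj_conjTranspose] at this

theorem trace_collapse (C : Context QV) {k : ℕ} {M : Matrix (Fin k → Fin 2) (Fin k → Fin 2) ℂ}
    (hM : M.IsHermitian) (r : Fin k ↪ QV) (h : ∀ i, r i ∈ C.vars) (l : ℝ) :
    (C.collapse hM r h l).trace = (C.outcomeProb hM r h l : ℂ) := by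
  have h1 : (C.collapse hM r h l).trace = (embed r h (specProj hM l) * C.state.mat).trace := by
    rw [collapse, Matrix.trace_mul_cycle, ← embed_mul, specProj_mul_self]
  have h2 := (C.collapse_posSemidef hM r h l).trace_nonneg
  rw [h1] at h2 ⊢
  exact Complex.ext (by simp [outcomeProb]) (by simpa using (Complex.le_def.1 h2).2.symm)

theorem outcomeProb_nonneg (C : Context QV) {k : ℕ}
    {M : Matrix (Fin k → Fin 2) (Fin k → Fin 2) ℂ}
    (hM : M.IsHermitian) (r : Fin k ↪ QV) (h : ∀ i, r i ∈ C.vars) (l : ℝ) :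
    0 ≤ C.outcomeProb hM r h l := by
  have h2 := (C.collapse_posSemidef hM r h l).trace_nonneg
  rw [trace_collapse] at h2
  exact_mod_cast h2

theorem sum_outcomeProb (C : Context QV) {k : ℕ} {M : Matrix (Fin k → Fin 2) (Fin k → Fin 2) ℂ}
    (hM : M.IsHermitian) (r : Fin k ↪ QV) (h : ∀ i, r i ∈ C.vars) :
    ∑ l : Outcome hM, ENNReal.ofReal (C.outcomeProb hM r h l.1) = 1 := by
  rw [← ENNReal.ofReal_sum_of_nonneg fun l _ => C.outcomeProb_nonneg hM r h l.1]
  have : ∑ l : Outcome hM, C.outcomeProb hM r h l.1 = 1 := by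
    simp only [outcomeProb]
    rw [← Complex.re_sum, ← Matrix.trace_sum, ← Finset.sum_mul, ← embed_sum, sum_specProj,
      embed_one, Matrix.one_mul, C.state.trace_eq, Complex.one_re]
  rw [this, ENNReal.ofReal_one]

/-- The distribution of the measurement outcome. -/
def outcomeDist (C : Context QV) {k : ℕ} {M : Matrix (Fin k → Fin 2) (Fin k → Fin 2) ℂ}
    (hM : M.IsHermitian) (r : Fin k ↪ QV) (h : ∀ i, r i ∈ C.vars) : PMF (Outcome hM) :=
  PMF.ofFintype (fun l => ENNReal.ofReal (C.outcomeProb hM r h l.1)) (C.sum_outcomeProb hM r h)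

/-- `q̄ = P_{l,r} ρ P_{l,r} / p_l`, the context after the outcome `l`. Outcomes of probability zero
do not occur; for them the value is irrelevant. -/
def afterOutcome (C : Context QV) {k : ℕ} {M : Matrix (Fin k → Fin 2) (Fin k → Fin 2) ℂ}
    (hM : M.IsHermitian) (r : Fin k ↪ QV) (h : ∀ i, r i ∈ C.vars) (l : ℝ) : Context QV where
  vars := C.vars
  state :=
    if hp : C.outcomeProb hM r h l = 0 then C.state
    else ⟨((C.outcomeProb hM r h l)⁻¹ : ℝ) • C.collapse hM r h l,
      (C.collapse_posSemidef hM r h l).smul (inv_nonneg.2 (C.outcomeProb_nonneg hM r h l)), by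
      rw [Matrix.trace_smul, trace_collapse, Complex.real_smul, ← Complex.ofReal_mul,
        inv_mul_cancel₀ hp, Complex.ofReal_one]⟩

end Context

/-! ### Operational semantics -/

/-- Actions. -/
inductive Act (QV : Type v) (CC : Type w) (QC : Type z) : Type (max v w z)
  | inC (c : CC) (a : ℝ)
  | outC (c : CC) (a : ℝ)
  | inQ (c : QC) (r : QV)
  | outQ (c : QC) (r : QV)
  | tau

namespace Act

variable {QV : Type v} {CC : Type w} {QC : Type z}

def relabel (f : Relabeling CC QC) : Act QV CC QC → Act QV CC QC
  | inC c a => inC (f.onC c) a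
  | outC c a => outC (f.onC c) a
  | inQ c r => inQ (f.onQ c) r
  | outQ c r => outQ (f.onQ c) r
  | tau => tau

/-- The channel of the action is in `L`; `τ` uses no channel. -/
def UsesChannelIn (L : Set (CC ⊕ QC)) : Act QV CC QC → Prop
  | inC c _ => Sum.inl c ∈ L
  | outC c _ => Sum.inl c ∈ L
  | inQ c _ => Sum.inr c ∈ L
  | outQ c _ => Sum.inr c ∈ L
  | tau => False

def IsQInput : Act QV CC QC → Prop
  | inQ _ _ => True
  | _ => False

/-- `α̂`: the empty string if `α = τ`, and `α` otherwise. -/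
def hat : Act QV CC QC → List (Act QV CC QC)
  | tau => []
  | inC c a => [inC c a]
  | outC c a => [outC c a]
  | inQ c r => [inQ c r]
  | outQ c r => [outQ c r]

end Act

/-- A pair of a raw process expression and a context. -/
structure RawConf (CV : Type u) (QV : Type v) (CC : Type w) (QC : Type z) [DecidableEq QV] :
    Type (max u v w z) where
  proc : Proc CV QV CC QC
  ctx : Context QV

variable {CV : Type u} {QV : Type v} {CC : Type w} {QC : Type z} [DecidableEq CV] [DecidableEq QV]

/-- Transition rules. -/
inductive Step : RawConf CV QV CC QC → Act QV CC QC → PMF (RawConf CV QV CC QC) → Prop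
  | c_inp (c x E C) (a : ℝ) :
      Step ⟨.inC c x E, C⟩ (.inC c a) (PMF.pure ⟨E.subst₁ x a, C⟩)
  | c_outp (c e E C) (a : ℝ) (h : e.HasValue a) :
      Step ⟨.outC c e E, C⟩ (.outC c a) (PMF.pure ⟨E, C⟩)
  | c_com_left (E₁ E₁' E₂ E₂' C c a)
      (h₁ : Step ⟨E₁, C⟩ (.inC c a) (PMF.pure ⟨E₁', C⟩))
      (h₂ : Step ⟨E₂, C⟩ (.outC c a) (PMF.pure ⟨E₂', C⟩)) :
      Step ⟨.par E₁ E₂, C⟩ .tau (PMF.pure ⟨.par E₁' E₂', C⟩)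
  | c_com_right (E₁ E₁' E₂ E₂' C c a)
      (h₁ : Step ⟨E₁, C⟩ (.outC c a) (PMF.pure ⟨E₁', C⟩))
      (h₂ : Step ⟨E₂, C⟩ (.inC c a) (PMF.pure ⟨E₂', C⟩)) :
      Step ⟨.par E₁ E₂, C⟩ .tau (PMF.pure ⟨.par E₁' E₂', C⟩)
  | q_new (q E) (C : Context QV) (r) (hr : r ∉ C.vars) :
      Step ⟨.new q E, C⟩ .tau (PMF.pure ⟨E.qsubst q r, C.addZero r hr⟩)
  | q_inp_fresh (c q E) (C : Context QV) (r) (hr : r ∉ C.vars)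
      (σ : Density (insert r C.vars)) (hσ : ptrace hr σ.mat = C.state.mat) :
      Step ⟨.inQ c q E, C⟩ (.inQ c r) (PMF.pure ⟨E.qsubst q r, ⟨insert r C.vars, σ⟩⟩)
  | q_inp_known (c q E) (C : Context QV) (r) (hr : r ∈ C.vars) (hr' : r ∉ E.qv.erase q) :
      Step ⟨.inQ c q E, C⟩ (.inQ c r) (PMF.pure ⟨E.qsubst q r, C⟩)
  | q_outp (c q E C) :
      Step ⟨.outQ c q E, C⟩ (.outQ c q) (PMF.pure ⟨E, C⟩)
  | unit {k : ℕ} (U : Matrix.unitaryGroup (Fin k → Fin 2) ℂ) (r : Fin k ↪ QV) (E)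
      (C : Context QV) (h : ∀ i, r i ∈ C.vars) :
      Step ⟨.unit U r E, C⟩ .tau (PMF.pure ⟨E, C.applyUnitary U r h⟩)
  | meas {k : ℕ} (M : Matrix (Fin k → Fin 2) (Fin k → Fin 2) ℂ) (hM : M.IsHermitian)
      (r : Fin k ↪ QV) (x E) (C : Context QV) (h : ∀ i, r i ∈ C.vars) :
      Step ⟨.meas M hM r x E, C⟩ .tau
        ((C.outcomeDist hM r h).map fun l => ⟨E.subst₁ x l.1, C.afterOutcome hM r h l.1⟩)
  | q_com_left (E₁ E₁' E₂ E₂' C c r)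
      (h₁ : Step ⟨E₁, C⟩ (.inQ c r) (PMF.pure ⟨E₁', C⟩))
      (h₂ : Step ⟨E₂, C⟩ (.outQ c r) (PMF.pure ⟨E₂', C⟩)) :
      Step ⟨.par E₁ E₂, C⟩ .tau (PMF.pure ⟨.par E₁' E₂', C⟩)
  | q_com_right (E₁ E₁' E₂ E₂' C c r)
      (h₁ : Step ⟨E₁, C⟩ (.outQ c r) (PMF.pure ⟨E₁', C⟩))
      (h₂ : Step ⟨E₂, C⟩ (.inQ c r) (PMF.pure ⟨E₂', C⟩)) :
      Step ⟨.par E₁ E₂, C⟩ .tau (PMF.pure ⟨.par E₁' E₂', C⟩)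
  | inp_int_left (E₁ E₁') (E₂ : Proc CV QV CC QC) (C C' c r) (hr : r ∉ E₂.qv)
      (h : Step ⟨E₁, C⟩ (.inQ c r) (PMF.pure ⟨E₁', C'⟩)) :
      Step ⟨.par E₁ E₂, C⟩ (.inQ c r) (PMF.pure ⟨.par E₁' E₂, C'⟩)
  | inp_int_right (E₁ : Proc CV QV CC QC) (E₂ E₂' C C' c r) (hr : r ∉ E₁.qv)
      (h : Step ⟨E₂, C⟩ (.inQ c r) (PMF.pure ⟨E₂', C'⟩)) :
      Step ⟨.par E₁ E₂, C⟩ (.inQ c r) (PMF.pure ⟨.par E₁ E₂', C'⟩)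
  | oth_int_left (E₁ E₂ C) (α : Act QV CC QC) (μ) (hα : ¬ α.IsQInput) (h : Step ⟨E₁, C⟩ α μ) :
      Step ⟨.par E₁ E₂, C⟩ α (μ.map fun D => ⟨.par D.proc E₂, D.ctx⟩)
  | oth_int_right (E₁ E₂ C) (α : Act QV CC QC) (μ) (hα : ¬ α.IsQInput) (h : Step ⟨E₂, C⟩ α μ) :
      Step ⟨.par E₁ E₂, C⟩ α (μ.map fun D => ⟨.par E₁ D.proc, D.ctx⟩)
  | sum_left (E F C α μ) (h : Step ⟨E, C⟩ α μ) : Step ⟨.sum E F, C⟩ α μ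
  | sum_right (E F C α μ) (h : Step ⟨F, C⟩ α μ) : Step ⟨.sum E F, C⟩ α μ
  | rel (E f C α μ) (h : Step ⟨E, C⟩ α μ) :
      Step ⟨.rel E f, C⟩ (α.relabel f) (μ.map fun D => ⟨.rel D.proc f, D.ctx⟩)
  | res (E L C) (α : Act QV CC QC) (μ) (hα : ¬ α.UsesChannelIn L) (h : Step ⟨E, C⟩ α μ) :
      Step ⟨.res E L, C⟩ α (μ.map fun D => ⟨.res D.proc L, D.ctx⟩)
  | cho (b : BExp CV) (E C α μ) (hb : b.IsTrue) (h : Step ⟨E, C⟩ α μ) :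
      Step ⟨.cond b E, C⟩ α μ

/-- `⟨E; q̄ = ρ⟩` is a configuration if `E` is a process expression with `qv(E) ⊆ q̄`. -/
def RawConf.IsConf (X : RawConf CV QV CC QC) : Prop := X.proc.WF ∧ X.proc.qv ⊆ X.ctx.vars

variable (CV QV CC QC) in
/-- Configurations. -/
abbrev Con : Type (max u v w z) := {X : RawConf CV QV CC QC // X.IsConf}

/-- The transition relation between configurations and distributions over configurations. -/
def PTrans (C : Con CV QV CC QC) (α : Act QV CC QC) (μ : PMF (Con CV QV CC QC)) : Prop :=
  Step C.1 α (μ.map Subtype.val)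

/-- No transition is possible. -/
def Stuck (C : Con CV QV CC QC) : Prop := ∀ α μ, ¬ PTrans C α μ

/-- Combined transitions: finite convex combinations of transitions with the same action. -/
def CTrans (C : Con CV QV CC QC) (α : Act QV CC QC) (μ : PMF (Con CV QV CC QC)) : Prop :=
  ∃ (n : ℕ) (p : PMF (Fin n)) (ν : Fin n → PMF (Con CV QV CC QC)),
    (∀ i, p i ≠ 0) ∧ (∀ i, PTrans C α (ν i)) ∧ μ = p.bind ν

/-! ### Weak transitions -/

variable (CV QV CC QC) in
/-- Finite alternating sequences `C₀ α₁ C₁ … α_n C_n` of configurations and actions. -/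
inductive Frag : Type (max u v w z)
  | start (C : Con CV QV CC QC)
  | snoc (f : Frag) (α : Act QV CC QC) (D : Con CV QV CC QC)

namespace Frag

def head : Frag CV QV CC QC → Con CV QV CC QC
  | start C => C
  | snoc f _ _ => f.head

def tail : Frag CV QV CC QC → Con CV QV CC QC
  | start C => C
  | snoc _ _ D => D

/-- The sequence of actions. -/
def trace : Frag CV QV CC QC → List (Act QV CC QC)
  | start _ => []
  | snoc f α _ => f.trace ++ [α]

end Frag

variable (CV QV CC QC) in
/-- An adversary. After the history `f` it halts or chooses, according to a finite-support
distribution, a combined transition `(tail f, α, μ)`; the chosen transitions have distinct actions,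
so the choice amounts to a distribution over `none` (halt) and the actions `some α`, together with
the target distribution of each action of positive probability. -/
structure Adversary where
  choice : Frag CV QV CC QC → PMF (Option (Act QV CC QC))
  target : Frag CV QV CC QC → Act QV CC QC → PMF (Con CV QV CC QC)
  finite : ∀ f, (choice f).support.Finite
  valid : ∀ f α, some α ∈ (choice f).support → CTrans f.tail α (target f α)

namespace Adversary

/-- The probability, starting from `head f`, of performing the sequence `f`. It is positive exactly
if `f` is an execution fragment that coincides with the adversary. -/
def prob (A : Adversary CV QV CC QC) : Frag CV QV CC QC → ℝ≥0∞
  | .start _ => 1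
  | .snoc f α D => A.prob f * (A.choice f (some α) * A.target f α D)

/-- The probability of performing exactly `f` and then halting. -/
def haltProb (A : Adversary CV QV CC QC) (f : Frag CV QV CC QC) : ℝ≥0∞ :=
  A.prob f * A.choice f none

end Adversary

/-- `WeakString s t`: the string `t` has the form `τ* α₁ τ* … τ* α_n τ*` where `s = α₁ … α_n`. -/
inductive WeakString : List (Act QV CC QC) → List (Act QV CC QC) → Prop
  | nil : WeakString [] []
  | tau (s t) (h : WeakString s t) : WeakString s (.tau :: t)
  | act (α s t) (h : WeakString s t) : WeakString (α :: s) (α :: t)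

/-- The weak `s`-transition from `C` to `μ`. -/
def WTrans (C : Con CV QV CC QC) (s : List (Act QV CC QC)) (μ : PMF (Con CV QV CC QC)) : Prop :=
  μ.support.Finite ∧ ∃ A : Adversary CV QV CC QC,
    (∀ D, ∑' f : {f : Frag CV QV CC QC // f.head = C ∧ f.tail = D}, A.haltProb f.1 = μ D) ∧
    ∀ f : Frag CV QV CC QC, f.head = C → A.haltProb f ≠ 0 → WeakString s f.trace

/-! ### Weak bisimilarity and equality -/

/-- `μ` and `ν` give the same mass to every class of the equivalence relation `r`. -/
def EquivUnder (r : Con CV QV CC QC → Con CV QV CC QC → Prop) (μ ν : PMF (Con CV QV CC QC)) :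
    Prop :=
  ∀ C, μ.toOuterMeasure {D | r C D} = ν.toOuterMeasure {D | r C D}

/-- Weak probabilistic bisimulations. -/
def IsWeakBisim (R : Con CV QV CC QC → Con CV QV CC QC → Prop) : Prop :=
  Equivalence R ∧ ∀ C D, R C D →
    (∀ α μ, PTrans C α μ → ∃ ν, WTrans D α.hat ν ∧ EquivUnder R μ ν) ∧
    (Stuck C → Stuck D → C.1.ctx = D.1.ctx)

/-- Weak bisimilarity `≈` of configurations. -/
def WeakBisimilar (C D : Con CV QV CC QC) : Prop := ∃ R, IsWeakBisim R ∧ R C D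

/-- Equality `≃` of configurations. -/
def ConEq (C D : Con CV QV CC QC) : Prop :=
  (∀ α μ, PTrans C α μ → ∃ ν, WTrans D [α] ν ∧ EquivUnder WeakBisimilar μ ν) ∧
  (∀ α ν, PTrans D α ν → ∃ μ, WTrans C [α] μ ∧ EquivUnder WeakBisimilar μ ν) ∧
  (Stuck C → Stuck D → C.1.ctx = D.1.ctx)

/-- Equality of quantum processes: `⟨P; C⟩ ≃ ⟨Q; C⟩` for every context `C` for which both are
configurations. -/
def ProcEq (P Q : Proc CV QV CC QC) : Prop :=
  ∀ (C : Context QV) (hP : RawConf.IsConf ⟨P, C⟩) (hQ : RawConf.IsConf ⟨Q, C⟩),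
    ConEq ⟨⟨P, C⟩, hP⟩ ⟨⟨Q, C⟩, hQ⟩

/-- Equality `≃` of process expressions: equality of all instances by real values. (Only the values
at the free classical variables matter.) -/
def ExprEq (E F : Proc CV QV CC QC) : Prop := ∀ V : CV → ℝ, ProcEq (E.inst V) (F.inst V)

end

end QCCS

/-! Equality requires each transition to be answered by a weak transition with the same action, `τ`
included, while the residuals need only be weakly bisimilar. The theorem thus rests on facts about
`≈`: it is an equivalence and itself a weak bisimulation (`weakBisimilar_isWeakBisim`), equality
implies it (`ConEq.weakBisimilar`), and it is preserved by renaming of qubits, by relabeling and by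
parallel composition with a classical expression. For expressions clause (b) is free, as both sides
run in the same context.

Under a prefix both sides make the same move, and the residuals are instances of `E` and `F`,
perhaps with a qubit renamed and in a new context; equality of expressions covers all instances and
contexts, and `Step.perm` covers the renaming. In a sum, the answer to a transition is nonempty, so
its first step is available from the sum. In a parallel composition, a classical `G` neither
inspects nor changes the context, so a move of the composition is answered by the other component
beside an idle `G`, by the same move of `G`, or by a synchronization inserted at the visible step of
the answer.

Two reformulations make this workable. Equal mass on classes becomes existence of a coupling
(`PMF.coupled_iff_of_equivalence`), which passes through binding. Adversaries are replaced by the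
inductive relation `Weak` (`wTrans_iff`), which composes; this is possible because expressions
shrink with every transition, so every adversary halts with probability one.

The delicate point is clause (b). For transitivity of `≈`, an intermediate configuration need not be
stuck, but one bisimilar to a stuck configuration reaches a stuck one of the same class by invisible
transitions. For parallel composition, a stuck composite must have a stuck left component; an input
of a qubit owned by `G` is blocked, but an input of a fresh qubit is then possible, names being
infinite in number. -/

set_option linter.unusedSectionVars false

/-! ### Conditional distributions and couplings -/

namespace PMF

variable {α β γ δ : Type*}

open Classical in
/-- The distribution `p` conditioned on `f = b`; it is `p` if that event has probability zero. -/
noncomputable def fiber (p : PMF α) (f : α → β) (b : β) : PMF α :=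
  if h : ∃ a ∈ f ⁻¹' {b}, a ∈ p.support then p.filter (f ⁻¹' {b}) h else p

theorem support_fiber_subset (p : PMF α) (f : α → β) (b : β) :
    (p.fiber f b).support ⊆ p.support := by
  unfold fiber
  split_ifs with h
  · rw [support_filter]
    exact Set.inter_subset_right
  · exact subset_rfl

theorem eq_of_mem_support_fiber {p : PMF α} {f : α → β} {b : β} (hb : b ∈ (p.map f).support)
    {a : α} (ha : a ∈ (p.fiber f b).support) : f a = b := by
  unfold fiber at ha
  have h : ∃ a ∈ f ⁻¹' {b}, a ∈ p.support := by
    obtain ⟨a, h1, h2⟩ := (mem_support_map_iff _ _ _).1 hb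
    exact ⟨a, h2, h1⟩
  rw [dif_pos h, support_filter] at ha
  exact ha.1

/-- Total probability: only points in the same fibre as `a` contribute, each with the factor `p a`
divided by the mass of the fibre, and their weights sum to that mass. Applied to a coupling, it
yields continuations that depend on one coordinate only. -/
theorem map_bind_fiber (p : PMF α) (f : α → β) : (p.map f).bind (p.fiber f) = p := by
  classical
  rw [bind_map]
  ext a
  rw [bind_apply]
  by_cases ha : p a = 0
  · rw [ha, ENNReal.tsum_eq_zero]
    intro b
    have : (p.fiber f (f b)) a = 0 := by
      rw [apply_eq_zero_iff]
      intro h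
      exact (p.mem_support_iff a).1 (p.support_fiber_subset f _ h) ha
    simp [this]
  · have key : ∀ b, p b * (p.fiber f ∘ f) b a =
        (f ⁻¹' {f a}).indicator p b * (p a * (∑' x, (f ⁻¹' {f a}).indicator p x)⁻¹) := by
      intro b
      by_cases hb : p b = 0
      · simp [Set.indicator_apply, hb]
      have hex : ∃ x ∈ f ⁻¹' {f b}, x ∈ p.support := ⟨b, rfl, hb⟩
      rw [Function.comp_apply, fiber, dif_pos hex, filter_apply]
      by_cases hab : f b = f a
      · simp [Set.indicator_apply, hab]
      · simp [Set.indicator_apply, hab, Ne.symm hab]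
    rw [tsum_congr key, ENNReal.tsum_mul_right, mul_left_comm, ENNReal.mul_inv_cancel, mul_one]
    · intro h
      have := (ENNReal.tsum_eq_zero.1 h) a
      simp [ha] at this
    · exact p.tsum_coe_indicator_ne_top _

theorem map_bind_fiber_bind (p : PMF α) (f : α → β) (g : α → PMF γ) :
    (p.map f).bind (fun b => (p.fiber f b).bind g) = p.bind g := by
  rw [← bind_bind, map_bind_fiber]

theorem bind_congr_support {p : PMF α} {f g : α → PMF β} (h : ∀ a ∈ p.support, f a = g a) :
    p.bind f = p.bind g := by
  ext b
  rw [bind_apply, bind_apply]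
  refine tsum_congr fun a => ?_
  by_cases ha : p a = 0
  · simp [ha]
  · rw [h a ha]

theorem map_congr_support {p : PMF α} {f g : α → β} (h : ∀ a ∈ p.support, f a = g a) :
    p.map f = p.map g :=
  bind_congr_support fun a ha => by simp [h a ha]

theorem eq_pure_of_support_subset {p : PMF α} {a : α} (h : ∀ b ∈ p.support, b = a) :
    p = pure a := by
  have := map_congr_support (p := p) (f := id) (g := fun _ => a) h
  rw [map_id] at this
  rw [this]
  exact p.map_const a

/-- Points outside `P` carry no mass, so they may be sent to any fixed point of the subtype. -/
theorem exists_eq_map_val {P : α → Prop} (p : PMF α) (h : ∀ a ∈ p.support, P a) :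
    ∃ q : PMF {a // P a}, p = q.map Subtype.val := by
  classical
  obtain ⟨a₀, h₀⟩ := p.support_nonempty
  refine ⟨p.map fun a => if ha : P a then ⟨a, ha⟩ else ⟨a₀, h a₀ h₀⟩, ?_⟩
  rw [map_comp]
  conv_lhs => rw [← p.map_id]
  refine map_congr_support fun a ha => ?_
  simp [h a ha]

theorem map_injective {f : α → β} (hf : Function.Injective f) :
    Function.Injective (PMF.map f) := by
  intro p q h
  have hp : ∀ (p : PMF α) (a : α), p.map f (f a) = p a := by
    classical
    intro p a
    rw [map_apply, tsum_eq_single a]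
    · simp
    · intro b hb
      rw [if_neg]
      exact fun hab => hb (hf hab.symm)
  ext a
  rw [← hp p, ← hp q, h]

/-- There is a coupling of `μ` and `ν` that is concentrated on `R`. -/
def Coupled (R : α → β → Prop) (μ : PMF α) (ν : PMF β) : Prop :=
  ∃ w : PMF (α × β), w.map Prod.fst = μ ∧ w.map Prod.snd = ν ∧ ∀ p ∈ w.support, R p.1 p.2

namespace Coupled

variable {R : α → β → Prop} {μ : PMF α} {ν : PMF β}

theorem mono {R' : α → β → Prop} (h : Coupled R μ ν)
    (hR : ∀ a ∈ μ.support, ∀ b ∈ ν.support, R a b → R' a b) : Coupled R' μ ν := by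
  obtain ⟨w, h1, h2, h3⟩ := h
  refine ⟨w, h1, h2, fun p hp => hR _ ?_ _ ?_ (h3 p hp)⟩
  · rw [← h1]
    exact (mem_support_map_iff _ _ _).2 ⟨p, hp, rfl⟩
  · rw [← h2]
    exact (mem_support_map_iff _ _ _).2 ⟨p, hp, rfl⟩

theorem exists_right (h : Coupled R μ ν) {a : α} (ha : a ∈ μ.support) :
    ∃ b ∈ ν.support, R a b := by
  obtain ⟨w, rfl, rfl, h3⟩ := h
  obtain ⟨p, hp, rfl⟩ := (mem_support_map_iff _ _ _).1 ha
  exact ⟨p.2, (mem_support_map_iff _ _ _).2 ⟨p, hp, rfl⟩, h3 p hp⟩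

theorem pure {a : α} {b : β} (h : R a b) : Coupled R (PMF.pure a) (PMF.pure b) :=
  ⟨PMF.pure (a, b), pure_map _ _, pure_map _ _, by simpa using h⟩

theorem of_bind {w : PMF γ} {k : γ → PMF α} {l : γ → PMF β}
    (h : ∀ c ∈ w.support, Coupled R (k c) (l c)) : Coupled R (w.bind k) (w.bind l) := by
  obtain ⟨c₀, hc₀⟩ := w.support_nonempty
  have : Nonempty (PMF (α × β)) := ⟨(h c₀ hc₀).choose⟩
  choose! m h1 h2 h3 using h
  refine ⟨w.bind m, ?_, ?_, ?_⟩
  · rw [map_bind]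
    exact bind_congr_support h1
  · rw [map_bind]
    exact bind_congr_support h2
  · intro p hp
    obtain ⟨c, hc, hp⟩ := (mem_support_bind_iff _ _ _).1 hp
    exact h3 c hc p hp

theorem of_map_same {w : PMF γ} {f : γ → α} {g : γ → β} (h : ∀ c ∈ w.support, R (f c) (g c)) :
    Coupled R (w.map f) (w.map g) :=
  of_bind fun c hc => pure (h c hc)

theorem refl {R : α → α → Prop} (hR : ∀ a, R a a) (μ : PMF α) : Coupled R μ μ := by
  have := of_map_same (R := R) (w := μ) (f := id) (g := id) fun a _ => hR a
  rwa [map_id] at this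

theorem bind {R' : γ → δ → Prop} {k : α → PMF γ} {l : β → PMF δ} (h : Coupled R μ ν)
    (hk : ∀ a b, R a b → Coupled R' (k a) (l b)) : Coupled R' (μ.bind k) (ν.bind l) := by
  obtain ⟨w, rfl, rfl, h3⟩ := h
  rw [bind_map, bind_map]
  exact of_bind fun p hp => hk _ _ (h3 p hp)

theorem map {R' : γ → δ → Prop} {f : α → γ} {g : β → δ} (h : Coupled R μ ν)
    (hR : ∀ a b, R a b → R' (f a) (g b)) : Coupled R' (μ.map f) (ν.map g) :=
  h.bind fun a b hab => pure (hR a b hab)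

theorem of_map {R' : γ → δ → Prop} {f : α → γ} {g : β → δ}
    (h : Coupled R' (μ.map f) (ν.map g)) : Coupled (fun a b => R' (f a) (g b)) μ ν := by
  -- The independent product, kept inside the product of the supports; it couples the conditional
  -- distributions over each pair of fibres.
  have hprod : ∀ (p : PMF α) (q : PMF β), ∃ w : PMF (α × β), w.map Prod.fst = p ∧
      w.map Prod.snd = q ∧ ∀ x ∈ w.support, x.1 ∈ p.support ∧ x.2 ∈ q.support := by
    intro p q
    refine ⟨p.bind fun a => q.map fun b => (a, b), ?_, ?_, ?_⟩
    · simp only [map_bind, map_comp]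
      exact (bind_congr_support fun a _ => q.map_const a).trans p.bind_pure
    · simp only [map_bind, map_comp]
      exact (bind_congr_support fun a _ => q.map_id).trans (p.bind_const q)
    · simp only [mem_support_bind_iff, mem_support_map_iff]
      rintro x ⟨a, ha, b, hb, rfl⟩
      exact ⟨ha, hb⟩
  rw [← map_bind_fiber μ f, ← map_bind_fiber ν g]
  obtain ⟨w, h1, h2, h3⟩ := h
  rw [← h1, ← h2, bind_map, bind_map]
  refine of_bind fun c hc => ?_
  obtain ⟨m, m1, m2, m3⟩ := hprod (μ.fiber f c.1) (ν.fiber g c.2)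
  refine ⟨m, m1, m2, fun p hp => ?_⟩
  have hc1 : c.1 ∈ (μ.map f).support := by
    rw [← h1]; exact (mem_support_map_iff _ _ _).2 ⟨c, hc, rfl⟩
  have hc2 : c.2 ∈ (ν.map g).support := by
    rw [← h2]; exact (mem_support_map_iff _ _ _).2 ⟨c, hc, rfl⟩
  beta_reduce
  rw [eq_of_mem_support_fiber hc1 (m3 p hp).1, eq_of_mem_support_fiber hc2 (m3 p hp).2]
  exact h3 c hc

end Coupled

/-- In a coupling both coordinates always lie in one class, so class masses agree. Conversely, equal
class masses mean equal images in the quotient, where the diagonal coupling lifts by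
`Coupled.of_map`. -/
theorem coupled_iff_of_equivalence {R : α → α → Prop} (hR : Equivalence R) (μ ν : PMF α) :
    Coupled R μ ν ↔ ∀ a, μ.toOuterMeasure {b | R a b} = ν.toOuterMeasure {b | R a b} := by
  constructor
  · rintro ⟨w, rfl, rfl, h⟩ a
    rw [toOuterMeasure_map_apply, toOuterMeasure_map_apply]
    refine toOuterMeasure_apply_eq_of_inter_support_eq _ ?_
    ext p
    simp only [Set.mem_inter_iff, Set.mem_preimage, Set.mem_ofPred_eq, and_congr_left_iff]
    exact fun hp => ⟨fun h1 => hR.trans h1 (h p hp), fun h1 => hR.trans h1 (hR.symm (h p hp))⟩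
  · intro h
    let s : Setoid α := ⟨R, hR⟩
    have hq : μ.map (Quotient.mk s) = ν.map (Quotient.mk s) := by
      ext x
      induction x using Quotient.inductionOn with | h a =>
      rw [← toOuterMeasure_apply_singleton, ← toOuterMeasure_apply_singleton,
        toOuterMeasure_map_apply, toOuterMeasure_map_apply]
      have : Quotient.mk s ⁻¹' {Quotient.mk s a} = {b | R a b} := by
        ext b
        simp only [Set.mem_preimage, Set.mem_singleton_iff, Set.mem_ofPred_eq]
        exact Quotient.eq.trans ⟨hR.symm, hR.symm⟩
      rw [this, h a]
    have : Coupled (fun x y => x = y) (μ.map (Quotient.mk s)) (ν.map (Quotient.mk s)) := by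
      rw [hq]; exact Coupled.refl (fun _ => rfl) _
    exact this.of_map.mono fun a _ b _ hab => Quotient.eq.1 hab

end PMF

/-! ### Weak transitions as an inductive relation -/

namespace QCCS

/-- Weak transitions of a probabilistic transition system: `Weak T τ X s μ` says that from `X`, by
finitely many transitions with finitely supported random choices between them, the distribution `μ`
can be reached with action strings of the form `τ* α₁ τ* … τ* α_n τ*`, where `s = α₁ … α_n`. -/
inductive Weak {S A : Type*} (T : S → A → PMF S → Prop) (τ : A) : S → List A → PMF S → Prop
  | halt (X) : Weak T τ X [] (PMF.pure X)
  | tau (X μ s) (k : S → PMF S) (h : T X τ μ) (hk : ∀ Y ∈ μ.support, Weak T τ Y s (k Y)) :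
      Weak T τ X s (μ.bind k)
  | act (X α μ s) (k : S → PMF S) (h : T X α μ) (hk : ∀ Y ∈ μ.support, Weak T τ Y s (k Y)) :
      Weak T τ X (α :: s) (μ.bind k)
  | mix (X s) (p : PMF (PMF S)) (hp : p.support.Finite) (hk : ∀ ν ∈ p.support, Weak T τ X s ν) :
      Weak T τ X s (p.bind id)

namespace Weak

variable {S A : Type*} {T : S → A → PMF S → Prop} {τ : A} {X : S} {s : List A} {μ : PMF S}

theorem mix_map {ι : Type*} (p : PMF ι) (hp : p.support.Finite) (k : ι → PMF S)
    (hk : ∀ i ∈ p.support, Weak T τ X s (k i)) : Weak T τ X s (p.bind k) := by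
  have : p.bind k = (p.map k).bind id := by rw [PMF.bind_map]; rfl
  rw [this]
  refine mix X s _ ?_ ?_
  · rw [PMF.support_map]; exact hp.image k
  · intro ν hν
    obtain ⟨i, hi, rfl⟩ := (PMF.mem_support_map_iff _ _ _).1 hν
    exact hk i hi

theorem single {α : A} (h : T X α μ) : Weak T τ X [α] μ := by
  have := act X α μ [] PMF.pure h fun Y _ => halt (T := T) (τ := τ) Y
  rwa [PMF.bind_pure] at this

theorem single_tau (h : T X τ μ) : Weak T τ X [] μ := by
  have := tau X μ [] PMF.pure h fun Y _ => halt (T := T) (τ := τ) Y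
  rwa [PMF.bind_pure] at this

/-- A `τ` in the prescribed string demands one invisible transition; rereading that use of `act` as
`tau` removes the demand. This turns answers for equality into answers for bisimilarity. -/
theorem drop_tau (h : Weak T τ X (τ :: s) μ) : Weak T τ X s μ := by
  generalize hs : τ :: s = s' at h
  induction h with
  | halt X => simp at hs
  | tau X μ s' k h hk ih => exact tau X μ s k h fun Y hY => ih Y hY hs
  | act X α μ s' k h hk ih =>
    obtain ⟨rfl, rfl⟩ := List.cons.inj hs
    exact tau X μ s k h hk
  | mix X s' p hp hk ih => exact mix X s p hp fun ν hν => ih ν hν hs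

theorem append {s' : List A} {k : S → PMF S} (h : Weak T τ X s μ)
    (hk : ∀ Y ∈ μ.support, Weak T τ Y s' (k Y)) : Weak T τ X (s ++ s') (μ.bind k) := by
  induction h with
  | halt X =>
    rw [PMF.pure_bind]
    exact hk X (by simp)
  | tau X μ s l h hl ih =>
    rw [PMF.bind_bind]
    exact tau X μ _ _ h fun Y hY => ih Y hY fun Z hZ =>
      hk Z ((PMF.mem_support_bind_iff _ _ _).2 ⟨Y, hY, hZ⟩)
  | act X α μ s l h hl ih =>
    rw [PMF.bind_bind]
    exact act X α μ _ _ h fun Y hY => ih Y hY fun Z hZ =>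
      hk Z ((PMF.mem_support_bind_iff _ _ _).2 ⟨Y, hY, hZ⟩)
  | mix X s p hp hl ih =>
    rw [PMF.bind_bind]
    exact mix_map p hp _ fun ν hν => ih ν hν fun Z hZ =>
      hk Z ((PMF.mem_support_bind_iff _ _ _).2 ⟨ν, hν, hZ⟩)

theorem finite_support (hT : ∀ X α μ, T X α μ → μ.support.Finite) (h : Weak T τ X s μ) :
    μ.support.Finite := by
  induction h with
  | halt X => simp
  | tau X μ s k h hk ih | act X α μ s k h hk ih =>
    rw [PMF.support_bind]
    exact (hT _ _ _ h).biUnion ih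
  | mix X s p hp hk ih =>
    rw [PMF.support_bind]
    exact hp.biUnion ih

/-- The continuations are indexed by source states; `Function.extend` moves them to the target
system, and its values off the range of `g` are never used. -/
theorem tau_map {S' : Type*} {T' : S' → A → PMF S' → Prop} {g : S → S'}
    (hg : Function.Injective g) {X' : S'} {k : S → PMF S'} (h : T' X' τ (μ.map g))
    (hk : ∀ Y ∈ μ.support, Weak T' τ (g Y) s (k Y)) : Weak T' τ X' s (μ.bind k) := by
  have : μ.bind k = (μ.map g).bind (Function.extend g k PMF.pure) := by
    rw [PMF.bind_map]
    exact PMF.bind_congr_support fun Y _ => (hg.extend_apply _ _ _).symm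
  rw [this]
  refine tau _ _ _ _ h fun Z hZ => ?_
  obtain ⟨Y, hY, rfl⟩ := (PMF.mem_support_map_iff _ _ _).1 hZ
  rw [hg.extend_apply]
  exact hk Y hY

theorem act_map {S' : Type*} {T' : S' → A → PMF S' → Prop} {g : S → S'}
    (hg : Function.Injective g) {X' : S'} {α : A} {k : S → PMF S'} (h : T' X' α (μ.map g))
    (hk : ∀ Y ∈ μ.support, Weak T' τ (g Y) s (k Y)) : Weak T' τ X' (α :: s) (μ.bind k) := by
  have : μ.bind k = (μ.map g).bind (Function.extend g k PMF.pure) := by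
    rw [PMF.bind_map]
    exact PMF.bind_congr_support fun Y _ => (hg.extend_apply _ _ _).symm
  rw [this]
  refine act _ _ _ _ _ h fun Z hZ => ?_
  obtain ⟨Y, hY, rfl⟩ := (PMF.mem_support_map_iff _ _ _).1 hZ
  rw [hg.extend_apply]
  exact hk Y hY

/-- Transport along an injective map of transition systems which relabels the actions by `h` and
respects the transitions with actions satisfying `J`. -/
theorem map {S' : Type*} {T' : S' → A → PMF S' → Prop} {g : S → S'} (hg : Function.Injective g)
    {h : A → A} (hτ : h τ = τ) {J : A → Prop} (hJ : J τ)
    (hT : ∀ X α μ, J α → T X α μ → T' (g X) (h α) (μ.map g))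
    (hW : Weak T τ X s μ) (hs : ∀ α ∈ s, J α) :
    Weak T' τ (g X) (s.map h) (μ.map g) := by
  induction hW with
  | halt X => rw [PMF.pure_map]; exact halt _
  | tau X μ s k hX hk ih =>
    rw [PMF.map_bind]
    have := hT X τ μ hJ hX
    rw [hτ] at this
    exact tau_map hg this fun Y hY => ih Y hY hs
  | act X α μ s k hX hk ih =>
    rw [PMF.map_bind]
    exact act_map hg (hT X α μ (hs α (by simp)) hX)
      fun Y hY => ih Y hY fun β hβ => hs β (by simp [hβ])
  | mix X s p hp hk ih =>
    rw [PMF.map_bind]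
    exact mix_map p hp _ fun ν hν => ih ν hν hs

/-- The first transition of a nonempty weak transition can be taken from another state. -/
theorem of_transitions {Y : S} (hXY : ∀ α μ, T X α μ → T Y α μ) (hs : s ≠ [])
    (h : Weak T τ X s μ) : Weak T τ Y s μ := by
  induction h with
  | halt X => exact absurd rfl hs
  | tau X μ s k h hk ih => exact tau _ _ _ _ (hXY _ _ h) hk
  | act X α μ s k h hk ih => exact act _ _ _ _ _ (hXY _ _ h) hk
  | mix X s p hp hk ih => exact mix _ _ _ hp fun ν hν => ih ν hν hXY hs

theorem eq_pure_of_stuck (hX : ∀ α μ, ¬ T X α μ) (h : Weak T τ X s μ) :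
    s = [] ∧ μ = PMF.pure X := by
  induction h with
  | halt X => exact ⟨rfl, rfl⟩
  | tau X μ s k h hk ih | act X α μ s k h hk ih => exact absurd h (hX _ _)
  | mix X s p hp hk ih =>
    obtain ⟨ν, hν⟩ := p.support_nonempty
    refine ⟨(ih ν hν hX).1, PMF.eq_pure_of_support_subset fun Y hY => ?_⟩
    obtain ⟨ν', hν', hY⟩ := (PMF.mem_support_bind_iff _ _ _).1 hY
    rw [id, (ih ν' hν' hX).2] at hY
    simpa using hY

/-- Continuing coupled distributions `μ` and `ν`, where `ν` is reached weakly. -/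
theorem bind_coupled {R R' : S → S → Prop} {Y : S} {s' : List A} {ν : PMF S} {k : S → PMF S}
    (hT : ∀ X α μ, T X α μ → μ.support.Finite) (hμ : μ.support.Finite)
    (hY : Weak T τ Y s ν) (hR : PMF.Coupled R μ ν)
    (hk : ∀ x ∈ μ.support, ∀ y, R x y →
      ∃ κ, Weak T τ y s' κ ∧ PMF.Coupled R' (k x) κ) :
    ∃ κ, Weak T τ Y (s ++ s') κ ∧ PMF.Coupled R' (μ.bind k) κ := by
  obtain ⟨w, rfl, rfl, hw⟩ := hR
  have hν := hY.finite_support hT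
  have hfin : w.support.Finite := by
    refine (hμ.prod hν).subset fun p hp => ?_
    exact ⟨(PMF.mem_support_map_iff _ _ _).2 ⟨p, hp, rfl⟩,
      (PMF.mem_support_map_iff _ _ _).2 ⟨p, hp, rfl⟩⟩
  have hk' : ∀ p ∈ w.support, ∃ κ, Weak T τ p.2 s' κ ∧ PMF.Coupled R' (k p.1) κ := fun p hp =>
    hk p.1 ((PMF.mem_support_map_iff _ _ _).2 ⟨p, hp, rfl⟩) p.2 (hw p hp)
  have : Nonempty (PMF S) := ⟨PMF.pure Y⟩
  choose! κ h1 h2 using hk'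
  -- Several pairs of the coupling may share the second coordinate `y`; from `y` their answers are
  -- mixed according to the coupling conditioned on it. The rule `mix` needs its support finite.
  refine ⟨(w.map Prod.snd).bind fun y => (w.fiber Prod.snd y).bind κ, hY.append ?_, ?_⟩
  · intro y hy
    refine mix_map _ (hfin.subset (w.support_fiber_subset _ _)) _ fun p hp => ?_
    rw [← PMF.eq_of_mem_support_fiber hy hp]
    exact h1 p (w.support_fiber_subset _ _ hp)
  · rw [PMF.map_bind_fiber_bind, PMF.bind_map]
    exact PMF.Coupled.of_bind h2

/-- If the transitions of related states are matched by weak transitions, so are weak transitions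
whose strings contain no `τ`. -/
theorem simulate {R : S → S → Prop} {hat : A → List A} (h_tau : hat τ = [])
    (h_hat : ∀ α, α ≠ τ → hat α = [α]) (hT : ∀ X α μ, T X α μ → μ.support.Finite)
    (hR : ∀ X Y, R X Y → ∀ α μ, T X α μ → ∃ ν, Weak T τ Y (hat α) ν ∧ PMF.Coupled R μ ν)
    (h : Weak T τ X s μ) (hs : τ ∉ s) {Y : S} (hXY : R X Y) :
    ∃ ν, Weak T τ Y s ν ∧ PMF.Coupled R μ ν := by
  induction h generalizing Y with
  | halt X => exact ⟨_, halt Y, PMF.Coupled.pure hXY⟩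
  | tau X μ s k h hk ih =>
    obtain ⟨ν, h1, h2⟩ := hR X Y hXY _ _ h
    rw [h_tau] at h1
    exact bind_coupled hT (hT _ _ _ h) h1 h2 fun x hx y hxy => ih x hx hs hxy
  | act X α μ s k h hk ih =>
    obtain ⟨ν, h1, h2⟩ := hR X Y hXY _ _ h
    -- Since `τ ∉ s` the action is visible and survives hatting; a prescribed `τ` might be answered
    -- by no transition at all.
    rw [h_hat α fun hα => hs (by simp [hα])] at h1
    exact bind_coupled hT (hT _ _ _ h) h1 h2 fun x hx y hxy =>
      ih x hx (fun h' => hs (by simp [h'])) hxy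
  | mix X s p hp hk ih =>
    have hk' : ∀ ν ∈ p.support, ∃ κ, Weak T τ Y s κ ∧ PMF.Coupled R ν κ :=
      fun ν hν => ih ν hν hs hXY
    have : Nonempty (PMF S) := ⟨PMF.pure Y⟩
    choose! κ h1 h2 using hk'
    exact ⟨_, mix_map p hp κ h1, PMF.Coupled.of_bind h2⟩

/-- Weak transitions of a system can be restricted to a set of states closed under transitions. -/
theorem restrict {P : S → Prop} (hP : ∀ X α μ, P X → T X α μ → ∀ Y ∈ μ.support, P Y)
    (h : Weak T τ X s μ) (hX : P X) :
    ∃ ν : PMF {X // P X}, μ = ν.map Subtype.val ∧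
      Weak (fun X α ν => T X.1 α (ν.map Subtype.val)) τ ⟨X, hX⟩ s ν := by
  -- One transition together with its continuations lifts to the subtype; both transition rules use
  -- this.
  have key : ∀ (μ : PMF S) (k : S → PMF S) s α X, P X → T X α μ →
      (∀ Y ∈ μ.support, ∀ hY : P Y, ∃ ν : PMF {X // P X}, k Y = ν.map Subtype.val ∧
        Weak (fun X α ν => T X.1 α (ν.map Subtype.val)) τ ⟨Y, hY⟩ s ν) →
      ∃ (ν : PMF {X // P X}) (l : {X // P X} → PMF {X // P X}), μ = ν.map Subtype.val ∧
        μ.bind k = (ν.bind l).map Subtype.val ∧ ∀ Y ∈ ν.support,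
          Weak (fun X α ν => T X.1 α (ν.map Subtype.val)) τ Y s (l Y) := by
    intro μ k s α X hX h hk
    obtain ⟨ν, rfl⟩ := μ.exists_eq_map_val (hP X α μ hX h)
    have hk' : ∀ Y ∈ ν.support, ∃ κ : PMF {X // P X}, k Y.1 = κ.map Subtype.val ∧
        Weak (fun X α ν => T X.1 α (ν.map Subtype.val)) τ Y s κ := fun Y hY =>
      hk Y.1 ((PMF.mem_support_map_iff _ _ _).2 ⟨Y, hY, rfl⟩) Y.2
    have : Nonempty (PMF {X // P X}) := ⟨ν⟩
    choose! l h1 h2 using hk'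
    refine ⟨ν, l, rfl, ?_, h2⟩
    rw [PMF.bind_map, PMF.map_bind]
    exact PMF.bind_congr_support h1
  induction h with
  | halt X => exact ⟨PMF.pure ⟨X, hX⟩, by rw [PMF.pure_map], halt _⟩
  | tau X μ s k h hk ih =>
    obtain ⟨ν, l, rfl, h1, h2⟩ := key μ k s τ X hX h fun Y hY hY' => ih Y hY hY'
    exact ⟨_, h1, tau _ _ _ _ h h2⟩
  | act X α μ s k h hk ih =>
    obtain ⟨ν, l, rfl, h1, h2⟩ := key μ k s α X hX h fun Y hY hY' => ih Y hY hY'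
    exact ⟨_, h1, act _ _ _ _ _ h h2⟩
  | mix X s p hp hk ih =>
    have hk' : ∀ ν ∈ p.support, ∃ κ : PMF {X // P X}, ν = κ.map Subtype.val ∧
        Weak (fun X α ν => T X.1 α (ν.map Subtype.val)) τ ⟨X, hX⟩ s κ :=
      fun ν hν => ih ν hν hX
    have : Nonempty (PMF {X // P X}) := ⟨PMF.pure ⟨X, hX⟩⟩
    choose! κ h1 h2 using hk'
    refine ⟨_, ?_, mix_map p hp κ h2⟩
    rw [PMF.map_bind]
    exact PMF.bind_congr_support h1

end Weak

end QCCS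

/-! ### Substitution, termination and preservation of configurations -/

namespace QCCS

variable {CV : Type u} {QV : Type v} {CC : Type w} {QC : Type z} [DecidableEq CV] [DecidableEq QV]

theorem Exp.subst_subst (s t : CV → Option ℝ) (e : Exp CV) :
    (e.subst s).subst t = e.subst fun x => (s x).or (t x) := by
  induction e with
  | var x => cases h : s x <;> simp [subst, h]
  | const a => rfl
  | app g args ih => simp [subst, ih]

namespace Proc

theorem subst_subst (s t : CV → Option ℝ) (E : Proc CV QV CC QC) :
    (E.subst s).subst t = E.subst fun x => (s x).or (t x) := by
  -- Under a binder of `x` both substitutions are blocked at `x`, and so is their composite.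
  have h : ∀ (s t : CV → Option ℝ) (x : CV),
      (fun y => (Function.update s x none y).or (Function.update t x none y)) =
        Function.update (fun y => (s y).or (t y)) x none := by
    intro s t x
    funext y
    by_cases hy : y = x
    · subst hy; simp
    · simp [hy]
  induction E generalizing s t with
  | nil => rfl
  | inC c x E ih => simp [subst, ih, h]
  | meas M hM q x E ih => simp [subst, ih, h]
  | outC c e E ih => simp [subst, ih, Exp.subst_subst]
  | cond b E ih => simp [subst, ih, BExp.subst, Exp.subst_subst]
  | new _ _ ih | inQ _ _ _ ih | outQ _ _ _ ih | unit _ _ _ ih | rel _ _ ih | res _ _ ih =>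
    simp [subst, ih]
  | sum _ _ ih₁ ih₂ | par _ _ ih₁ ih₂ => simp [subst, ih₁, ih₂]

/-- Instantiation below a binder leaves `x` open, and the value supplied later completes the
assignment. So the residuals of `c?x` and `M[q;x]` are again instances, at a modified assignment. -/
theorem subst_update_none_subst₁ (E : Proc CV QV CC QC) (V : CV → ℝ) (x : CV) (a : ℝ) :
    (E.subst (Function.update (fun y => some (V y)) x none)).subst₁ x a =
      E.inst (Function.update V x a) := by
  rw [subst₁, subst_subst, inst]
  congr 1
  funext y
  by_cases hy : y = x
  · subst hy; simp
  · simp [hy]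

@[simp] theorem qv_subst (s : CV → Option ℝ) (E : Proc CV QV CC QC) : (E.subst s).qv = E.qv := by
  induction E generalizing s <;> simp_all [subst, qv]

@[simp] theorem wf_subst (s : CV → Option ℝ) (E : Proc CV QV CC QC) :
    (E.subst s).WF ↔ E.WF := by
  induction E generalizing s <;> simp_all [subst, WF]

@[simp] theorem classical_subst (s : CV → Option ℝ) (E : Proc CV QV CC QC) :
    (E.subst s).Classical ↔ E.Classical := by
  induction E generalizing s <;> simp_all [subst, Classical]

theorem qv_perm (π : Equiv.Perm QV) (E : Proc CV QV CC QC) :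
    (E.perm π).qv = E.qv.map π.toEmbedding := by
  induction E <;>
    simp_all [perm, qv, Finset.map_union, Finset.map_erase, Finset.map_insert, Finset.map_map]

theorem wf_perm (π : Equiv.Perm QV) (E : Proc CV QV CC QC) : (E.perm π).WF ↔ E.WF := by
  induction E <;> simp_all [perm, WF, qv_perm, Finset.disjoint_map]

/-- The number of operators. -/
def size : Proc CV QV CC QC → ℕ
  | nil => 0
  | inC _ _ E => E.size + 1
  | outC _ _ E => E.size + 1
  | new _ E => E.size + 1
  | inQ _ _ E => E.size + 1
  | outQ _ _ E => E.size + 1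
  | unit _ _ E => E.size + 1
  | meas _ _ _ _ E => E.size + 1
  | sum E F => E.size + F.size + 1
  | par E F => E.size + F.size + 1
  | rel E _ => E.size + 1
  | res E _ => E.size + 1
  | cond _ E => E.size + 1

@[simp] theorem size_subst (s : CV → Option ℝ) (E : Proc CV QV CC QC) :
    (E.subst s).size = E.size := by
  induction E generalizing s <;> simp_all [subst, size]

@[simp] theorem size_perm (π : Equiv.Perm QV) (E : Proc CV QV CC QC) :
    (E.perm π).size = E.size := by
  induction E <;> simp_all [perm, size]

/-- By the side condition the swap moves no free variable except `q`. -/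
theorem qv_qsubst_subset (E : Proc CV QV CC QC) (q r : QV) (hr : r ∉ E.qv.erase q) :
    (E.qsubst q r).qv ⊆ insert r (E.qv.erase q) := by
  intro x hx
  rw [qsubst, qv_perm, Finset.mem_map] at hx
  obtain ⟨y, hy, rfl⟩ := hx
  simp only [Equiv.coe_toEmbedding]
  by_cases h1 : y = q
  · subst h1; simp
  · have h2 : y ≠ r := fun h => hr (by simp [← h, h1, hy])
    rw [Equiv.swap_apply_of_ne_of_ne h1 h2]
    simp [h1, hy]

end Proc

namespace Step

variable {X : RawConf CV QV CC QC} {α : Act QV CC QC} {μ : PMF (RawConf CV QV CC QC)}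

theorem finite_support (h : Step X α μ) : μ.support.Finite := by
  induction h with
  | meas M hM r x E C h => rw [PMF.support_map]; exact (Set.toFinite _).image _
  | oth_int_left _ _ _ _ _ _ _ ih | oth_int_right _ _ _ _ _ _ _ ih | rel _ _ _ _ _ _ ih
  | res _ _ _ _ _ _ _ ih => rw [PMF.support_map]; exact ih.image _
  | sum_left _ _ _ _ _ _ ih | sum_right _ _ _ _ _ _ ih | cho _ _ _ _ _ _ _ ih => exact ih
  | _ => simp

/-- There is no recursion, and substitution and renaming keep the size, so every transition consumes
an operator. This is the measure for the inductions over adversaries and over invisible runs. -/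
theorem size_lt (h : Step X α μ) : ∀ Y ∈ μ.support, Y.proc.size < X.proc.size := by
  induction h with
  | oth_int_left _ _ _ _ _ _ _ ih | oth_int_right _ _ _ _ _ _ _ ih | rel _ _ _ _ _ _ ih
  | res _ _ _ _ _ _ _ ih =>
    intro Y hY
    obtain ⟨D, hD, rfl⟩ := (PMF.mem_support_map_iff _ _ _).1 hY
    have := ih D hD
    simp only [Proc.size] at this ⊢
    omega
  | sum_left _ _ _ _ _ _ ih | sum_right _ _ _ _ _ _ ih | cho _ _ _ _ _ _ _ ih =>
    intro Y hY
    have := ih Y hY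
    simp only [Proc.size] at this ⊢
    omega
  | c_com_left _ _ _ _ _ _ _ _ _ ih₁ ih₂ | c_com_right _ _ _ _ _ _ _ _ _ ih₁ ih₂
  | q_com_left _ _ _ _ _ _ _ _ _ ih₁ ih₂ | q_com_right _ _ _ _ _ _ _ _ _ ih₁ ih₂ =>
    simp only [PMF.support_pure, Set.mem_singleton_iff, forall_eq, Proc.size] at ih₁ ih₂ ⊢
    omega
  | inp_int_left _ _ _ _ _ _ _ _ _ ih | inp_int_right _ _ _ _ _ _ _ _ _ ih =>
    simp only [PMF.support_pure, Set.mem_singleton_iff, forall_eq, Proc.size] at ih ⊢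
    omega
  | meas M hM r x E C h =>
    intro Y hY
    obtain ⟨D, hD, rfl⟩ := (PMF.mem_support_map_iff _ _ _).1 hY
    simp [Proc.size, Proc.subst₁]
  | _ => simp [Proc.size, Proc.subst₁, Proc.qsubst]

theorem vars_subset (h : Step X α μ) : ∀ Y ∈ μ.support, X.ctx.vars ⊆ Y.ctx.vars := by
  induction h with
  | oth_int_left _ _ _ _ _ _ _ ih | oth_int_right _ _ _ _ _ _ _ ih | rel _ _ _ _ _ _ ih
  | res _ _ _ _ _ _ _ ih =>
    intro Y hY
    obtain ⟨D, hD, rfl⟩ := (PMF.mem_support_map_iff _ _ _).1 hY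
    exact ih D hD
  | sum_left _ _ _ _ _ _ ih | sum_right _ _ _ _ _ _ ih | cho _ _ _ _ _ _ _ ih => exact ih
  | inp_int_left _ _ _ _ _ _ _ _ _ ih | inp_int_right _ _ _ _ _ _ _ _ _ ih => simpa using ih
  | meas M hM r x E C h =>
    intro Y hY
    obtain ⟨D, hD, rfl⟩ := (PMF.mem_support_map_iff _ _ _).1 hY
    exact subset_rfl
  | q_new | q_inp_fresh => simp [Context.addZero]
  | _ => simp [Context.applyUnitary]

/-- Visible transitions lead to a single configuration, with the same context unless a fresh qubit
is received. -/
theorem exists_eq_pure (h : Step X α μ) (hα : α ≠ .tau) :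
    ∃ Y, μ = PMF.pure Y ∧ ((∀ c r, α = .inQ c r → r ∈ X.ctx.vars) → Y.ctx = X.ctx) := by
  induction h with
  | oth_int_left _ _ _ _ _ _ _ ih | oth_int_right _ _ _ _ _ _ _ ih
  | res _ _ _ _ _ _ _ ih =>
    obtain ⟨Y, rfl, hY⟩ := ih hα
    exact ⟨_, PMF.pure_map _ _, hY⟩
  | rel E f C α μ h ih =>
    obtain ⟨Y, rfl, hY⟩ := ih (by rintro rfl; exact hα rfl)
    refine ⟨_, PMF.pure_map _ _, fun h => hY ?_⟩
    rintro c r rfl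
    exact h _ r rfl
  | sum_left _ _ _ _ _ _ ih | sum_right _ _ _ _ _ _ ih | cho _ _ _ _ _ _ _ ih => exact ih hα
  | inp_int_left _ _ _ _ _ _ _ _ _ ih | inp_int_right _ _ _ _ _ _ _ _ _ ih =>
    obtain ⟨Y, h1, hY⟩ := ih hα
    exact ⟨_, rfl, fun h => by
      have h2 := congrArg PMF.support h1
      simp only [PMF.support_pure, Set.singleton_eq_singleton_iff] at h2
      rw [← h2] at hY
      exact hY h⟩
  | q_inp_fresh c q E C r hr => exact ⟨_, rfl, fun h => absurd (h c r rfl) hr⟩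
  | c_inp | c_outp | q_inp_known | q_outp => exact ⟨_, rfl, fun _ => rfl⟩
  | _ => exact absurd rfl hα

/-- In a synchronization the qubit passed is therefore already in the context, so the receiver does
not enlarge the context. -/
theorem outQ_mem_qv (h : Step X α μ) {c : QC} {r : QV} (hα : α = .outQ c r) : r ∈ X.proc.qv := by
  induction h generalizing c with
  | q_outp => simp_all [Proc.qv]
  | oth_int_left _ _ _ _ _ _ _ ih | sum_left _ _ _ _ _ _ ih =>
    exact Finset.mem_union_left _ (ih hα)
  | oth_int_right _ _ _ _ _ _ _ ih | sum_right _ _ _ _ _ _ ih =>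
    exact Finset.mem_union_right _ (ih hα)
  | rel E f C α μ h ih =>
    cases α <;> simp [Act.relabel] at hα
    exact ih (by rw [hα.2])
  | res _ _ _ _ _ _ _ ih | cho _ _ _ _ _ _ _ ih => exact ih hα
  | _ => simp at hα

/-- Where the free quantum variables of a target come from. -/
theorem isConf_and_qv (h : Step X α μ) (hX : X.IsConf) : ∀ Y ∈ μ.support, Y.IsConf ∧
    (∀ q ∈ Y.proc.qv, q ∈ X.proc.qv ∨ q ∉ X.ctx.vars ∨ ∃ c, α = .inQ c q) ∧
    ∀ c r, α = .outQ c r → r ∉ Y.proc.qv := by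
  -- Preservation of `IsConf` alone is not inductive: under `par`, disjointness survives only
  -- because a new free variable of one component lies outside the old context or was received, and
  -- because a sent qubit is given up.
  have hvars := h.vars_subset
  induction h with
  | c_inp | c_outp | unit =>
    simp_all [RawConf.IsConf, Proc.WF, Proc.qv, Proc.subst₁, Finset.union_subset_iff,
      Context.applyUnitary]
  | meas M hM r x E C h =>
    intro Y hY
    obtain ⟨D, hD, rfl⟩ := (PMF.mem_support_map_iff _ _ _).1 hY
    simp_all [RawConf.IsConf, Proc.WF, Proc.qv, Proc.subst₁, Finset.union_subset_iff,
      Context.afterOutcome]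
  | q_outp c q E C =>
    simp_all [RawConf.IsConf, Proc.WF, Proc.qv, Finset.insert_subset_iff]
  | q_new q E C r hr =>
    have h1 : r ∉ E.qv.erase q := fun h => hr (hX.2 h)
    have h2 := E.qv_qsubst_subset q r h1
    simp only [PMF.support_pure, Set.mem_singleton_iff, forall_eq]
    refine ⟨⟨(Proc.wf_perm _ _).2 hX.1, h2.trans (Finset.insert_subset_insert _ hX.2)⟩, ?_, by simp⟩
    intro x hx
    rcases Finset.mem_insert.1 (h2 hx) with rfl | hx
    · exact .inr (.inl hr)
    · exact .inl hx
  | q_inp_fresh c q E C r hr σ hσ =>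
    have h1 : r ∉ E.qv.erase q := fun h => hr (hX.2 h)
    have h2 := E.qv_qsubst_subset q r h1
    simp only [PMF.support_pure, Set.mem_singleton_iff, forall_eq]
    refine ⟨⟨(Proc.wf_perm _ _).2 hX.1, h2.trans (Finset.insert_subset_insert _ hX.2)⟩, ?_, by simp⟩
    intro x hx
    rcases Finset.mem_insert.1 (h2 hx) with rfl | hx
    · exact .inr (.inl hr)
    · exact .inl hx
  | q_inp_known c q E C r hr hr' =>
    have h2 := E.qv_qsubst_subset q r hr'
    simp only [PMF.support_pure, Set.mem_singleton_iff, forall_eq]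
    refine ⟨⟨(Proc.wf_perm _ _).2 hX.1, h2.trans (Finset.insert_subset hr hX.2)⟩, ?_, by simp⟩
    intro x hx
    rcases Finset.mem_insert.1 (h2 hx) with rfl | hx
    · exact .inr (.inr ⟨c, rfl⟩)
    · exact .inl hx
  | c_com_left E₁ E₁' E₂ E₂' C c a h₁ h₂ ih₁ ih₂ | c_com_right E₁ E₁' E₂ E₂' C c a h₁ h₂ ih₁ ih₂ =>
    obtain ⟨⟨hd, hw₁, hw₂⟩, hv⟩ := hX
    obtain ⟨hv₁, hv₂⟩ := Finset.union_subset_iff.1 hv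
    obtain ⟨⟨a1, a2⟩, a3, a4⟩ :=
      ih₁ ⟨hw₁, hv₁⟩ h₁.vars_subset _ ((PMF.mem_support_pure_iff _ _).2 rfl)
    obtain ⟨⟨b1, b2⟩, b3, b4⟩ :=
      ih₂ ⟨hw₂, hv₂⟩ h₂.vars_subset _ ((PMF.mem_support_pure_iff _ _).2 rfl)
    simp only [PMF.support_pure, Set.mem_singleton_iff, forall_eq]
    rw [Finset.disjoint_left] at hd
    refine ⟨⟨⟨Finset.disjoint_left.2 fun x hx hx' => ?_, a1, b1⟩, Finset.union_subset a2 b2⟩,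
      fun x hx => ?_, fun c r hα => by simp at hα⟩
    · have := a2 hx
      have := b2 hx'
      have := a3 x hx
      have := b3 x hx'
      simp only [reduceCtorEq] at *
      grind
    · rcases Finset.mem_union.1 hx with hx | hx
      · have := a2 hx
        have := a3 x hx
        simp only [Proc.qv, reduceCtorEq, Finset.mem_union] at *
        grind
      · have := b2 hx
        have := b3 x hx
        simp only [Proc.qv, reduceCtorEq, Finset.mem_union] at *
        grind
  | q_com_left E₁ E₁' E₂ E₂' C c r h₁ h₂ ih₁ ih₂ =>
    obtain ⟨⟨hd, hw₁, hw₂⟩, hv⟩ := hX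
    obtain ⟨hv₁, hv₂⟩ := Finset.union_subset_iff.1 hv
    obtain ⟨⟨a1, a2⟩, a3, a4⟩ :=
      ih₁ ⟨hw₁, hv₁⟩ h₁.vars_subset _ ((PMF.mem_support_pure_iff _ _).2 rfl)
    obtain ⟨⟨b1, b2⟩, b3, b4⟩ :=
      ih₂ ⟨hw₂, hv₂⟩ h₂.vars_subset _ ((PMF.mem_support_pure_iff _ _).2 rfl)
    simp only [PMF.support_pure, Set.mem_singleton_iff, forall_eq]
    rw [Finset.disjoint_left] at hd
    refine ⟨⟨⟨Finset.disjoint_left.2 fun x hx hx' => ?_, a1, b1⟩, Finset.union_subset a2 b2⟩,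
      fun x hx => ?_, fun c r hα => by simp at hα⟩
    -- The only variable that can pass to the left component is `r`, and the sender no longer has
    -- it.
    · have := b4 c r rfl
      have := a2 hx
      have := b2 hx'
      have := a3 x hx
      have := b3 x hx'
      simp only [reduceCtorEq, Act.inQ.injEq, Act.outQ.injEq] at *
      grind
    · have := h₂.outQ_mem_qv rfl
      rcases Finset.mem_union.1 hx with hx | hx
      · have := a2 hx
        have := a3 x hx
        simp only [Proc.qv, reduceCtorEq, Act.inQ.injEq, Finset.mem_union] at *
        grind
      · have := b2 hx
        have := b3 x hx
        simp only [Proc.qv, reduceCtorEq, Act.inQ.injEq, Finset.mem_union] at *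
        grind
  | q_com_right E₁ E₁' E₂ E₂' C c r h₁ h₂ ih₁ ih₂ =>
    obtain ⟨⟨hd, hw₁, hw₂⟩, hv⟩ := hX
    obtain ⟨hv₁, hv₂⟩ := Finset.union_subset_iff.1 hv
    obtain ⟨⟨a1, a2⟩, a3, a4⟩ :=
      ih₁ ⟨hw₁, hv₁⟩ h₁.vars_subset _ ((PMF.mem_support_pure_iff _ _).2 rfl)
    obtain ⟨⟨b1, b2⟩, b3, b4⟩ :=
      ih₂ ⟨hw₂, hv₂⟩ h₂.vars_subset _ ((PMF.mem_support_pure_iff _ _).2 rfl)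
    simp only [PMF.support_pure, Set.mem_singleton_iff, forall_eq]
    rw [Finset.disjoint_left] at hd
    refine ⟨⟨⟨Finset.disjoint_left.2 fun x hx hx' => ?_, a1, b1⟩, Finset.union_subset a2 b2⟩,
      fun x hx => ?_, fun c r hα => by simp at hα⟩
    · have := a4 c r rfl
      have := a2 hx
      have := b2 hx'
      have := a3 x hx
      have := b3 x hx'
      simp only [reduceCtorEq, Act.inQ.injEq, Act.outQ.injEq] at *
      grind
    · have := h₁.outQ_mem_qv rfl
      rcases Finset.mem_union.1 hx with hx | hx
      · have := a2 hx
        have := a3 x hx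
        simp only [Proc.qv, reduceCtorEq, Act.inQ.injEq, Finset.mem_union] at *
        grind
      · have := b2 hx
        have := b3 x hx
        simp only [Proc.qv, reduceCtorEq, Act.inQ.injEq, Finset.mem_union] at *
        grind
  | inp_int_left E₁ E₁' E₂ C C' c r hr h ih =>
    obtain ⟨⟨hd, hw₁, hw₂⟩, hv⟩ := hX
    obtain ⟨hv₁, hv₂⟩ := Finset.union_subset_iff.1 hv
    have hC := h.vars_subset _ ((PMF.mem_support_pure_iff _ _).2 rfl)
    obtain ⟨⟨a1, a2⟩, a3, a4⟩ :=
      ih ⟨hw₁, hv₁⟩ h.vars_subset _ ((PMF.mem_support_pure_iff _ _).2 rfl)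
    simp only [PMF.support_pure, Set.mem_singleton_iff, forall_eq]
    rw [Finset.disjoint_left] at hd
    refine ⟨⟨⟨Finset.disjoint_left.2 fun x hx hx' => ?_, a1, hw₂⟩,
      Finset.union_subset a2 (hv₂.trans hC)⟩,
      fun x hx => ?_, fun c r hα => by simp at hα⟩
    · have := hv₂ hx'
      have := a3 x hx
      simp only [Act.inQ.injEq] at *
      grind
    · simp only [Proc.qv, Finset.mem_union] at hx ⊢
      grind
  | inp_int_right E₁ E₂ E₂' C C' c r hr h ih =>
    obtain ⟨⟨hd, hw₁, hw₂⟩, hv⟩ := hX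
    obtain ⟨hv₁, hv₂⟩ := Finset.union_subset_iff.1 hv
    have hC := h.vars_subset _ ((PMF.mem_support_pure_iff _ _).2 rfl)
    obtain ⟨⟨a1, a2⟩, a3, a4⟩ :=
      ih ⟨hw₂, hv₂⟩ h.vars_subset _ ((PMF.mem_support_pure_iff _ _).2 rfl)
    simp only [PMF.support_pure, Set.mem_singleton_iff, forall_eq]
    rw [Finset.disjoint_left] at hd
    refine ⟨⟨⟨Finset.disjoint_left.2 fun x hx hx' => ?_, hw₁, a1⟩,
      Finset.union_subset (hv₁.trans hC) a2⟩,
      fun x hx => ?_, fun c r hα => by simp at hα⟩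
    · have := hv₁ hx
      have := a3 x hx'
      simp only [Act.inQ.injEq] at *
      grind
    · simp only [Proc.qv, Finset.mem_union] at hx ⊢
      grind
  | oth_int_left E₁ E₂ C α μ hα h ih =>
    intro Y hY
    obtain ⟨D, hD, rfl⟩ := (PMF.mem_support_map_iff _ _ _).1 hY
    obtain ⟨⟨hd, hw₁, hw₂⟩, hv⟩ := hX
    obtain ⟨hv₁, hv₂⟩ := Finset.union_subset_iff.1 hv
    have hC := h.vars_subset _ hD
    obtain ⟨⟨a1, a2⟩, a3, a4⟩ := ih ⟨hw₁, hv₁⟩ h.vars_subset _ hD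
    have hα' : ∀ q c, α ≠ .inQ c q := by
      rintro q c rfl
      exact hα trivial
    rw [Finset.disjoint_left] at hd
    refine ⟨⟨⟨Finset.disjoint_left.2 fun x hx hx' => ?_, a1, hw₂⟩,
      Finset.union_subset a2 (hv₂.trans hC)⟩,
      fun x hx => ?_, fun c r hα => ?_⟩
    · have := hv₂ hx'
      have := a3 x hx
      grind
    · simp only [Proc.qv, Finset.mem_union] at hx ⊢
      grind
    · have := a4 c r hα
      have := h.outQ_mem_qv hα
      simp only [Proc.qv, Finset.mem_union] at *
      grind
  | oth_int_right E₁ E₂ C α μ hα h ih =>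
    intro Y hY
    obtain ⟨D, hD, rfl⟩ := (PMF.mem_support_map_iff _ _ _).1 hY
    obtain ⟨⟨hd, hw₁, hw₂⟩, hv⟩ := hX
    obtain ⟨hv₁, hv₂⟩ := Finset.union_subset_iff.1 hv
    have hC := h.vars_subset _ hD
    obtain ⟨⟨a1, a2⟩, a3, a4⟩ := ih ⟨hw₂, hv₂⟩ h.vars_subset _ hD
    have hα' : ∀ q c, α ≠ .inQ c q := by
      rintro q c rfl
      exact hα trivial
    rw [Finset.disjoint_left] at hd
    refine ⟨⟨⟨Finset.disjoint_left.2 fun x hx hx' => ?_, hw₁, a1⟩,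
      Finset.union_subset (hv₁.trans hC) a2⟩,
      fun x hx => ?_, fun c r hα => ?_⟩
    · have := hv₁ hx
      have := a3 x hx'
      grind
    · simp only [Proc.qv, Finset.mem_union] at hx ⊢
      grind
    · have := a4 c r hα
      have := h.outQ_mem_qv hα
      simp only [Proc.qv, Finset.mem_union] at *
      grind
  | sum_left E F C α μ h ih =>
    intro Y hY
    obtain ⟨a1, a2, a3⟩ := ih ⟨hX.1.1, (Finset.union_subset_iff.1 hX.2).1⟩ h.vars_subset Y hY
    exact ⟨a1, fun q hq => (a2 q hq).imp_left (Finset.mem_union_left _), a3⟩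
  | sum_right E F C α μ h ih =>
    intro Y hY
    obtain ⟨a1, a2, a3⟩ := ih ⟨hX.1.2, (Finset.union_subset_iff.1 hX.2).2⟩ h.vars_subset Y hY
    exact ⟨a1, fun q hq => (a2 q hq).imp_left (Finset.mem_union_right _), a3⟩
  | rel E f C α μ h ih =>
    intro Y hY
    obtain ⟨D, hD, rfl⟩ := (PMF.mem_support_map_iff _ _ _).1 hY
    obtain ⟨a1, a2, a3⟩ := ih hX h.vars_subset D hD
    refine ⟨a1, fun q hq => (a2 q hq).imp_right (Or.imp_right ?_), ?_⟩
    · rintro ⟨c, rfl⟩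
      exact ⟨_, rfl⟩
    · intro c r hα
      cases α <;> simp [Act.relabel] at hα
      exact a3 _ r (by rw [hα.2])
  | res E L C α μ hα h ih =>
    intro Y hY
    obtain ⟨D, hD, rfl⟩ := (PMF.mem_support_map_iff _ _ _).1 hY
    exact ih hX h.vars_subset D hD
  | cho b E C α μ hb h ih => exact ih hX h.vars_subset

end Step

end QCCS

/-! ### Classical expressions, fresh inputs and stuck compositions -/

namespace QCCS

variable {CV : Type u} {QV : Type v} {CC : Type w} {QC : Type z} [DecidableEq CV] [DecidableEq QV]

/-- Adjoining `|0⟩⟨0|` is one admissible extension, so an input prefix can always receive a fresh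
qubit. -/
theorem Context.ptrace_addZero (C : Context QV) (r : QV) (hr : r ∉ C.vars) :
    ptrace hr (C.addZero r hr).state.mat = C.state.mat := by
  ext x y
  simp [ptrace, Context.addZero]

namespace Step

variable {X : RawConf CV QV CC QC} {α : Act QV CC QC} {μ : PMF (RawConf CV QV CC QC)}

/-- The transitions of a classical expression neither depend on the context nor change it. -/
theorem classical (h : Step X α μ) (hX : X.proc.Classical) :
    ∃ G' : Proc CV QV CC QC, μ = PMF.pure ⟨G', X.ctx⟩ ∧ G'.Classical ∧ ¬ α.IsQInput ∧
      ∀ D, Step ⟨X.proc, D⟩ α (PMF.pure ⟨G', D⟩) := by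
  have hpure : ∀ {A B : Proc CV QV CC QC} {C C' : Context QV},
      PMF.pure (⟨A, C⟩ : RawConf CV QV CC QC) = PMF.pure ⟨B, C'⟩ → A = B ∧ C = C' := by
    intro A B C C' h
    have h2 := congrArg PMF.support h
    simpa using h2
  induction h with
  | c_inp c x E C a =>
    exact ⟨_, rfl, by simpa [Proc.subst₁, Proc.Classical] using hX, id, fun D => c_inp c x E D a⟩
  | c_outp c e E C a h => exact ⟨_, rfl, hX, id, fun D => c_outp c e E D a h⟩
  | q_outp c q E C => exact ⟨_, rfl, hX, id, fun D => q_outp c q E D⟩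
  | c_com_left E₁ E₁' E₂ E₂' C c a h₁ h₂ ih₁ ih₂ =>
    obtain ⟨G₁, a1, a2, -, a3⟩ := ih₁ hX.1
    obtain ⟨G₂, b1, b2, -, b3⟩ := ih₂ hX.2
    obtain ⟨rfl, -⟩ := hpure a1
    obtain ⟨rfl, -⟩ := hpure b1
    exact ⟨_, rfl, ⟨a2, b2⟩, id, fun D => c_com_left _ _ _ _ D c a (a3 D) (b3 D)⟩
  | c_com_right E₁ E₁' E₂ E₂' C c a h₁ h₂ ih₁ ih₂ =>
    obtain ⟨G₁, a1, a2, -, a3⟩ := ih₁ hX.1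
    obtain ⟨G₂, b1, b2, -, b3⟩ := ih₂ hX.2
    obtain ⟨rfl, -⟩ := hpure a1
    obtain ⟨rfl, -⟩ := hpure b1
    exact ⟨_, rfl, ⟨a2, b2⟩, id, fun D => c_com_right _ _ _ _ D c a (a3 D) (b3 D)⟩
  | q_com_left E₁ E₁' E₂ E₂' C c r h₁ h₂ ih₁ ih₂ =>
    obtain ⟨-, -, -, h, -⟩ := ih₁ hX.1
    exact absurd trivial h
  | q_com_right E₁ E₁' E₂ E₂' C c r h₁ h₂ ih₁ ih₂ =>
    obtain ⟨-, -, -, h, -⟩ := ih₂ hX.2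
    exact absurd trivial h
  | inp_int_left E₁ E₁' E₂ C C' c r hr h ih =>
    obtain ⟨-, -, -, h, -⟩ := ih hX.1
    exact absurd trivial h
  | inp_int_right E₁ E₂ E₂' C C' c r hr h ih =>
    obtain ⟨-, -, -, h, -⟩ := ih hX.2
    exact absurd trivial h
  | oth_int_left E₁ E₂ C α μ hα h ih =>
    obtain ⟨G, rfl, a2, a3, a4⟩ := ih hX.1
    refine ⟨_, PMF.pure_map _ _, ⟨a2, hX.2⟩, a3, fun D => ?_⟩
    have := oth_int_left E₁ E₂ D α _ hα (a4 D)
    rwa [PMF.pure_map] at this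
  | oth_int_right E₁ E₂ C α μ hα h ih =>
    obtain ⟨G, rfl, a2, a3, a4⟩ := ih hX.2
    refine ⟨_, PMF.pure_map _ _, ⟨hX.1, a2⟩, a3, fun D => ?_⟩
    have := oth_int_right E₁ E₂ D α _ hα (a4 D)
    rwa [PMF.pure_map] at this
  | sum_left E F C α μ h ih =>
    obtain ⟨G, rfl, a2, a3, a4⟩ := ih hX.1
    exact ⟨G, rfl, a2, a3, fun D => sum_left _ _ _ _ _ (a4 D)⟩
  | sum_right E F C α μ h ih =>
    obtain ⟨G, rfl, a2, a3, a4⟩ := ih hX.2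
    exact ⟨G, rfl, a2, a3, fun D => sum_right _ _ _ _ _ (a4 D)⟩
  | rel E f C α μ h ih =>
    obtain ⟨G, rfl, a2, a3, a4⟩ := ih hX
    refine ⟨_, PMF.pure_map _ _, a2, ?_, fun D => ?_⟩
    · cases α <;> exact a3
    · have := rel E f D α _ (a4 D)
      rwa [PMF.pure_map] at this
  | res E L C α μ hα h ih =>
    obtain ⟨G, rfl, a2, a3, a4⟩ := ih hX
    refine ⟨_, PMF.pure_map _ _, a2, a3, fun D => ?_⟩
    have := res E L D α _ hα (a4 D)
    rwa [PMF.pure_map] at this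
  | cho b E C α μ hb h ih =>
    obtain ⟨G, rfl, a2, a3, a4⟩ := ih hX
    exact ⟨G, rfl, a2, a3, fun D => cho _ _ _ _ _ hb (a4 D)⟩
  | _ => exact absurd hX id

/-- A name outside the context and the free variables passes every side condition of interleaving,
and the prefix accepts it with `|0⟩⟨0|` adjoined. -/
theorem exists_inQ_fresh (h : Step X α μ) {c : QC} {r r' : QV} (hα : α = .inQ c r)
    (h₁ : r' ∉ X.ctx.vars) (h₂ : r' ∉ X.proc.qv) : ∃ Y, Step X (.inQ c r') (PMF.pure Y) := by
  induction h generalizing c r with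
  | q_inp_fresh c₁ q E C r₁ hr =>
    obtain ⟨rfl, rfl⟩ := Act.inQ.inj hα
    exact ⟨_, q_inp_fresh _ _ _ _ _ h₁ _ (C.ptrace_addZero r' h₁)⟩
  | q_inp_known c₁ q E C r₁ hr hr' =>
    obtain ⟨rfl, rfl⟩ := Act.inQ.inj hα
    exact ⟨_, q_inp_fresh _ _ _ _ _ h₁ _ (C.ptrace_addZero r' h₁)⟩
  | inp_int_left E₁ E₁' E₂ C C' c₁ r₁ hr h ih =>
    obtain ⟨rfl, rfl⟩ := Act.inQ.inj hα
    simp only [Proc.qv, Finset.mem_union, not_or] at h₂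
    obtain ⟨Y, hY⟩ := ih rfl h₁ h₂.1
    exact ⟨_, inp_int_left _ _ _ _ _ _ _ h₂.2 hY⟩
  | inp_int_right E₁ E₂ E₂' C C' c₁ r₁ hr h ih =>
    obtain ⟨rfl, rfl⟩ := Act.inQ.inj hα
    simp only [Proc.qv, Finset.mem_union, not_or] at h₂
    obtain ⟨Y, hY⟩ := ih rfl h₁ h₂.2
    exact ⟨_, inp_int_right _ _ _ _ _ _ _ h₂.1 hY⟩
  | oth_int_left _ _ _ _ _ h' | oth_int_right _ _ _ _ _ h' =>
    subst hα
    exact absurd trivial h'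
  | sum_left E F C α μ h ih =>
    simp only [Proc.qv, Finset.mem_union, not_or] at h₂
    obtain ⟨Y, hY⟩ := ih hα h₁ h₂.1
    exact ⟨_, sum_left _ _ _ _ _ hY⟩
  | sum_right E F C α μ h ih =>
    simp only [Proc.qv, Finset.mem_union, not_or] at h₂
    obtain ⟨Y, hY⟩ := ih hα h₁ h₂.2
    exact ⟨_, sum_right _ _ _ _ _ hY⟩
  | rel E f C α μ h ih =>
    cases α <;> simp only [Act.relabel, reduceCtorEq, Act.inQ.injEq] at hα
    obtain ⟨Y, hY⟩ := ih rfl h₁ h₂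
    have := rel E f _ _ _ hY
    rw [PMF.pure_map] at this
    obtain ⟨rfl, -⟩ := hα
    exact ⟨_, this⟩
  | res E L C α μ hL h ih =>
    subst hα
    obtain ⟨Y, hY⟩ := ih rfl h₁ h₂
    have := res E L _ (.inQ c r') _ hL hY
    rw [PMF.pure_map] at this
    exact ⟨_, this⟩
  | cho b E C α μ hb h ih =>
    obtain ⟨Y, hY⟩ := ih hα h₁ h₂
    exact ⟨_, cho _ _ _ _ _ hb hY⟩
  | _ => simp at hα

/-- If a parallel composition has no transition, then neither has its left component. -/
theorem of_par_left [Infinite QV] {E G : Proc CV QV CC QC} {C : Context QV}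
    (hE : E.qv ⊆ C.vars) (hG : G.qv ⊆ C.vars) (h : Step ⟨E, C⟩ α μ) :
    ∃ β ν, Step (⟨.par E G, C⟩ : RawConf CV QV CC QC) β ν := by
  by_cases hα : α.IsQInput
  · obtain ⟨c, r, rfl⟩ : ∃ c r, α = .inQ c r := by
      cases α <;> first | exact ⟨_, _, rfl⟩ | exact absurd hα id
    -- The received `r` may belong to `G`, which blocks interleaving; a name outside the context
    -- belongs to neither component.
    obtain ⟨r', hr'⟩ := Infinite.exists_notMem_finset C.vars
    obtain ⟨Y, hY⟩ := h.exists_inQ_fresh rfl hr' fun h => hr' (hE h)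
    exact ⟨_, _, inp_int_left _ _ _ _ _ _ _ (fun h => hr' (hG h)) hY⟩
  · exact ⟨_, _, oth_int_left _ _ _ _ _ hα h⟩

end Step

/-- A raw transition of a configuration is a transition between configurations. -/
theorem exists_pTrans_of_step {X : Con CV QV CC QC} {α : Act QV CC QC}
    {m : PMF (RawConf CV QV CC QC)} (h : Step X.1 α m) :
    ∃ μ : PMF (Con CV QV CC QC), m = μ.map Subtype.val ∧ PTrans X α μ := by
  obtain ⟨μ, rfl⟩ := m.exists_eq_map_val (P := RawConf.IsConf)
    fun Y hY => (h.isConf_and_qv X.2 Y hY).1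
  exact ⟨μ, rfl, h⟩

theorem stuck_iff {X : Con CV QV CC QC} : Stuck X ↔ ∀ α m, ¬ Step X.1 α m := by
  constructor
  · intro h α m hm
    obtain ⟨μ, -, hμ⟩ := exists_pTrans_of_step hm
    exact h α μ hμ
  · exact fun h α μ => h α _

theorem PTrans.finite_support {X : Con CV QV CC QC} {α : Act QV CC QC}
    {μ : PMF (Con CV QV CC QC)} (h : PTrans X α μ) : μ.support.Finite := by
  have := Step.finite_support h
  rw [PMF.support_map] at this
  exact this.of_finite_image Subtype.val_injective.injOn

theorem PTrans.size_lt {X : Con CV QV CC QC} {α : Act QV CC QC}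
    {μ : PMF (Con CV QV CC QC)} (h : PTrans X α μ) :
    ∀ Y ∈ μ.support, Y.1.proc.size < X.1.proc.size := fun Y hY =>
  Step.size_lt h Y.1 ((PMF.mem_support_map_iff _ _ _).2 ⟨Y, hY, rfl⟩)

end QCCS

/-! ### Weighted mixtures, combined transitions and histories -/

open scoped ENNReal

theorem ENNReal.tsum_sum_type {α β : Type*} (f : α ⊕ β → ℝ≥0∞) :
    ∑' x, f x = ∑' a, f (.inl a) + ∑' b, f (.inr b) := by
  refine (HasSum.add_isCompl Set.isCompl_range_inl_range_inr ?_ ?_).tsum_eq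
  · exact Sum.inl_injective.hasSum_range_iff.2 ENNReal.summable.hasSum
  · exact Sum.inr_injective.hasSum_range_iff.2 ENNReal.summable.hasSum

theorem ENNReal.tsum_option {α : Type*} (f : Option α → ℝ≥0∞) :
    ∑' x, f x = f none + ∑' a, f (some a) := by
  rw [← (Equiv.optionEquivSumPUnit.{0} α).symm.tsum_eq, ENNReal.tsum_sum_type, add_comm]
  simp

namespace PMF

variable {ι β : Type*}

/-- Mixture with not necessarily normalized weights; `d` if all weights are zero. -/
noncomputable def weighted (w : ι → ℝ≥0∞) (k : ι → PMF β) (d : PMF β) : PMF β :=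
  open Classical in
  if h : ∑' i, w i ≠ 0 ∧ ∑' i, w i ≠ ∞ then (PMF.normalize w h.1 h.2).bind k else d

/-- The normalizing factor cancels, and if the total weight is zero both sides vanish whatever `d`
is. -/
theorem tsum_mul_weighted {w : ι → ℝ≥0∞} (hw : ∑' i, w i ≠ ∞) (k : ι → PMF β) (d : PMF β)
    (b : β) : (∑' i, w i) * weighted w k d b = ∑' i, w i * k i b := by
  unfold weighted
  split_ifs with h
  · rw [bind_apply, ← ENNReal.tsum_mul_left]
    refine tsum_congr fun i => ?_
    rw [normalize_apply, ← mul_assoc, mul_left_comm, ENNReal.mul_inv_cancel h.1 h.2, mul_one]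
  · have h0 : ∑' i, w i = 0 := by
      by_contra h0
      exact h ⟨h0, hw⟩
    rw [h0, zero_mul]
    rw [ENNReal.tsum_eq_zero] at h0
    simp [h0]

theorem support_weighted_subset (w : ι → ℝ≥0∞) (k : ι → PMF β) (d : PMF β) :
    (weighted w k d).support ⊆ (⋃ i ∈ Function.support w, (k i).support) ∪ d.support := by
  unfold weighted
  split_ifs with h
  · rw [support_bind, support_normalize]
    exact Set.subset_union_left
  · exact Set.subset_union_right

end PMF

namespace QCCS

variable {CV : Type u} {QV : Type v} {CC : Type w} {QC : Type z} [DecidableEq CV] [DecidableEq QV]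

namespace CTrans

variable {X : Con CV QV CC QC} {α : Act QV CC QC} {μ : PMF (Con CV QV CC QC)}

theorem of_pTrans (h : PTrans X α μ) : CTrans X α μ :=
  ⟨1, PMF.pure 0, fun _ => μ, fun i => by simp [Subsingleton.elim i 0], fun _ => h,
    by rw [PMF.pure_bind]⟩

/-- This form has no index set and no condition on weights, so closure under further mixing is
associativity of binding. -/
theorem iff_exists : CTrans X α μ ↔ ∃ p : PMF (PMF (Con CV QV CC QC)), p.support.Finite ∧
    (∀ ν ∈ p.support, PTrans X α ν) ∧ μ = p.bind id := by
  constructor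
  · rintro ⟨n, p, ν, -, h2, rfl⟩
    refine ⟨p.map ν, ?_, ?_, by rw [PMF.bind_map]; rfl⟩
    · rw [PMF.support_map]
      exact (Set.toFinite _).image _
    · intro κ hκ
      obtain ⟨i, -, rfl⟩ := (PMF.mem_support_map_iff _ _ _).1 hκ
      exact h2 i
  · rintro ⟨p, h1, h2, rfl⟩
    -- Indexing by the support alone keeps all weights nonzero.
    obtain ⟨q, hq⟩ := p.exists_eq_map_val (P := fun ν => ν ∈ p.support) fun _ h => h
    have : Finite {ν // ν ∈ p.support} := h1
    obtain ⟨n, ⟨e⟩⟩ := Finite.exists_equiv_fin {ν // ν ∈ p.support}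
    refine ⟨n, q.map e, fun i => (e.symm i).1, fun i => ?_, fun i => h2 _ (e.symm i).2, ?_⟩
    · change i ∈ (q.map e).support
      have h3 : ∀ ν ∈ p.support, ν ∈ (q.map Subtype.val).support := fun ν hν => by rwa [hq] at hν
      obtain ⟨x, hx, hxi⟩ := (PMF.mem_support_map_iff _ _ _).1 (h3 _ (e.symm i).2)
      refine (PMF.mem_support_map_iff _ _ _).2 ⟨x, hx, ?_⟩
      rw [Subtype.ext hxi, e.apply_symm_apply]
    · rw [PMF.bind_map]
      conv_lhs => rw [hq, PMF.bind_map]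
      congr 1
      funext x
      simp

theorem bind {ι : Type*} {p : PMF ι} (hp : p.support.Finite) {k : ι → PMF (Con CV QV CC QC)}
    (hk : ∀ i ∈ p.support, CTrans X α (k i)) : CTrans X α (p.bind k) := by
  have h : ∀ i ∈ p.support, _ := fun i hi => iff_exists.1 (hk i hi)
  have : Nonempty (PMF (PMF (Con CV QV CC QC))) := ⟨PMF.pure (PMF.pure X)⟩
  choose! m h1 h2 h3 using h
  refine iff_exists.2 ⟨p.bind m, ?_, ?_, ?_⟩
  · rw [PMF.support_bind]
    exact hp.biUnion h1
  · intro ν hν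
    obtain ⟨i, hi, hν⟩ := (PMF.mem_support_bind_iff _ _ _).1 hν
    exact h2 i hi ν hν
  · rw [PMF.bind_bind]
    exact PMF.bind_congr_support h3

theorem weighted {ι : Type*} {w : ι → ℝ≥0∞} (hw : (Function.support w).Finite)
    (hw' : ∑' i, w i ≠ ∞) {k : ι → PMF (Con CV QV CC QC)} {d : PMF (Con CV QV CC QC)}
    (hk : ∀ i, w i ≠ 0 → CTrans X α (k i)) {i : ι} (hi : w i ≠ 0) :
    CTrans X α (PMF.weighted w k d) := by
  have h0 : ∑' i, w i ≠ 0 := fun h => hi (ENNReal.tsum_eq_zero.1 h i)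
  rw [PMF.weighted, dif_pos ⟨h0, hw'⟩]
  refine bind ?_ fun i hi => hk i ?_
  · rwa [PMF.support_normalize]
  · rwa [PMF.support_normalize] at hi

theorem size_lt (h : CTrans X α μ) : ∀ Y ∈ μ.support, Y.1.proc.size < X.1.proc.size := by
  obtain ⟨n, p, ν, -, h2, rfl⟩ := h
  intro Y hY
  obtain ⟨i, -, hY⟩ := (PMF.mem_support_bind_iff _ _ _).1 hY
  exact (h2 i).size_lt Y hY

theorem weak {s s' : List (Act QV CC QC)} {k : Con CV QV CC QC → PMF (Con CV QV CC QC)}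
    (h : CTrans X α μ) (hs : s = α :: s' ∨ α = .tau ∧ s = s')
    (hk : ∀ Y ∈ μ.support, Weak PTrans .tau Y s' (k Y)) : Weak PTrans .tau X s (μ.bind k) := by
  obtain ⟨n, p, ν, h1, h2, rfl⟩ := h
  rw [PMF.bind_bind]
  refine Weak.mix_map _ (Set.toFinite _) _ fun i hi => ?_
  have hk' : ∀ Y ∈ (ν i).support, Weak PTrans .tau Y s' (k Y) := fun Y hY =>
    hk Y ((PMF.mem_support_bind_iff _ _ _).2 ⟨i, hi, hY⟩)
  rcases hs with rfl | ⟨rfl, rfl⟩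
  · exact Weak.act _ _ _ _ _ (h2 i) hk'
  · exact Weak.tau _ _ _ _ (h2 i) hk'

end CTrans

namespace Frag

/-- The sequence `C α f`. -/
def cons (C : Con CV QV CC QC) (α : Act QV CC QC) : Frag CV QV CC QC → Frag CV QV CC QC
  | start D => snoc (start C) α D
  | snoc f β D => snoc (f.cons C α) β D

@[simp] theorem head_cons (C : Con CV QV CC QC) (α : Act QV CC QC) (f : Frag CV QV CC QC) :
    (f.cons C α).head = C := by
  induction f with
  | start D => rfl
  | snoc f β D ih => exact ih

@[simp] theorem tail_cons (C : Con CV QV CC QC) (α : Act QV CC QC) (f : Frag CV QV CC QC) :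
    (f.cons C α).tail = f.tail := by
  cases f <;> rfl

@[simp] theorem trace_cons (C : Con CV QV CC QC) (α : Act QV CC QC) (f : Frag CV QV CC QC) :
    (f.cons C α).trace = α :: f.trace := by
  induction f with
  | start D => rfl
  | snoc f β D ih => simp [cons, trace, ih]

/-- Decomposition of a sequence at its front. -/
def uncons : Frag CV QV CC QC → Con CV QV CC QC ⊕ Con CV QV CC QC × Act QV CC QC × Frag CV QV CC QC
  | start C => .inl C
  | snoc f β D => .inr <| f.uncons.elim (fun C => (C, β, start D))
      fun p => (p.1, p.2.1, p.2.2.snoc β D)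

@[simp] theorem uncons_cons (C : Con CV QV CC QC) (α : Act QV CC QC) (f : Frag CV QV CC QC) :
    (f.cons C α).uncons = .inr (C, α, f) := by
  induction f with
  | start D => rfl
  | snoc f β D ih => simp [cons, uncons, ih]

/-- A nonempty sequence of configurations and actions is a single configuration or has a first
action. -/
def unconsEquiv :
    Frag CV QV CC QC ≃ Con CV QV CC QC ⊕ Con CV QV CC QC × Act QV CC QC × Frag CV QV CC QC where
  toFun := uncons
  invFun x := x.elim start fun p => p.2.2.cons p.1 p.2.1
  left_inv f := by
    induction f with
    | start C => rfl
    | snoc f β D ih =>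
      cases h : f.uncons with
      | inl C =>
        rw [h] at ih
        simp only [uncons, h, Sum.elim_inl, Sum.elim_inr, cons] at ih ⊢
        rw [ih]
      | inr p =>
        rw [h] at ih
        simp only [uncons, h, Sum.elim_inr, cons] at ih ⊢
        rw [ih]
  right_inv x := by
    rcases x with C | ⟨C, α, f⟩
    · rfl
    · simp

theorem eq_start_or_cons (f : Frag CV QV CC QC) :
    f = start f.head ∨ ∃ α g, f = cons f.head α g := by
  obtain ⟨x, rfl⟩ := unconsEquiv.symm.surjective f
  rcases x with C | ⟨C, α, g⟩
  · exact .inl rfl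
  · refine .inr ⟨α, g, ?_⟩
    change g.cons C α = g.cons (g.cons C α).head α
    rw [head_cons]

-- A history from `C` is `C` alone or a first action followed by a shorter history. Histories grow
-- at their end, so reading them from the front goes through `unconsEquiv`.
open Classical in
theorem tsum_head_tail (C E : Con CV QV CC QC) (H : Frag CV QV CC QC → ℝ≥0∞) :
    ∑' f : {f : Frag CV QV CC QC // f.head = C ∧ f.tail = E}, H f.1 =
      (if E = C then H (start C) else 0) + ∑' α, ∑' D,
        ∑' g : {g : Frag CV QV CC QC // g.head = D ∧ g.tail = E}, H (g.1.cons C α) := by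
  have h1 : ∀ (C : Con CV QV CC QC) (H : Frag CV QV CC QC → ℝ≥0∞),
      ∑' f : {f : Frag CV QV CC QC // f.head = C ∧ f.tail = E}, H f.1 =
      ∑' f : Frag CV QV CC QC, if f.head = C ∧ f.tail = E then H f else 0 := by
    intro C H
    rw [show ∑' f : {f : Frag CV QV CC QC // f.head = C ∧ f.tail = E}, H f.1 = _ from
      tsum_subtype {f : Frag CV QV CC QC | f.head = C ∧ f.tail = E} H]
    exact tsum_congr fun f => by simp [Set.indicator_apply]
  rw [h1, ← unconsEquiv.symm.tsum_eq, ENNReal.tsum_sum_type]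
  congr 1
  · rw [tsum_eq_single C]
    · simp [unconsEquiv, head, tail, eq_comm]
    · intro D hD
      simp [unconsEquiv, head, hD]
  · rw [ENNReal.tsum_prod', tsum_eq_single C]
    · rw [ENNReal.tsum_prod']
      refine tsum_congr fun α => ?_
      rw [tsum_congr fun D => h1 D fun g => H (g.cons C α), ENNReal.tsum_comm]
      refine tsum_congr fun g => ?_
      rw [tsum_eq_single g.head]
      · simp [unconsEquiv]
      · intro D hD
        simp [Ne.symm hD]
    · intro D hD
      simp [unconsEquiv, hD]

end Frag

end QCCS

/-! ### Adversaries and the inductive relation agree -/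

open scoped ENNReal

namespace QCCS

variable {CV : Type u} {QV : Type v} {CC : Type w} {QC : Type z} [DecidableEq CV] [DecidableEq QV]

namespace WeakString

theorem cons_iff {α : Act QV CC QC} {s t : List (Act QV CC QC)} :
    WeakString s (α :: t) ↔ (∃ s', s = α :: s' ∧ WeakString s' t) ∨ (α = .tau ∧ WeakString s t) := by
  constructor
  · intro h
    cases h with
    | tau s t h => exact .inr ⟨rfl, h⟩
    | act α s t h => exact .inl ⟨_, rfl, h⟩
  · rintro (⟨s', rfl, h⟩ | ⟨rfl, h⟩)
    · exact act _ _ _ h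
    · exact tau _ _ h

theorem eq_nil {s : List (Act QV CC QC)} (h : WeakString s []) : s = [] := by
  cases h; rfl

theorem drop_tau {s t : List (Act QV CC QC)} (h : WeakString (.tau :: s) t) : WeakString s t := by
  generalize hs : Act.tau :: s = s' at h
  induction h with
  | nil => simp at hs
  | tau s' t h ih => exact tau _ _ (ih hs)
  | act α s' t h ih =>
    obtain ⟨rfl, rfl⟩ := List.cons.inj hs
    exact tau _ _ h

/-- Only `α = τ` is ambiguous: if the first `τ` of the trace was read as padding, the demanded one
occurs later and can be dropped. -/
theorem tail_of_cons {α : Act QV CC QC} {s t : List (Act QV CC QC)}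
    (h : WeakString (α :: s) (α :: t)) : WeakString s t := by
  rcases cons_iff.1 h with ⟨s', hs, h⟩ | ⟨rfl, h⟩
  · obtain ⟨-, rfl⟩ := List.cons.inj hs
    exact h
  · exact h.drop_tau

end WeakString

namespace Adversary

/-- The probability of halting in `E` when started at `C`. -/
noncomputable def haltMass (A : Adversary CV QV CC QC) (C E : Con CV QV CC QC) : ℝ≥0∞ :=
  ∑' f : {f : Frag CV QV CC QC // f.head = C ∧ f.tail = E}, A.haltProb f.1

/-- The adversary `A` after the first transition `α` from `C`. -/
def shift (A : Adversary CV QV CC QC) (C : Con CV QV CC QC) (α : Act QV CC QC) :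
    Adversary CV QV CC QC where
  choice f := A.choice (f.cons C α)
  target f := A.target (f.cons C α)
  finite f := A.finite _
  valid f β hβ := by
    have := A.valid (f.cons C α) β hβ
    rwa [Frag.tail_cons] at this

theorem prob_cons (A : Adversary CV QV CC QC) (C : Con CV QV CC QC) (α : Act QV CC QC)
    (f : Frag CV QV CC QC) : A.prob (f.cons C α) =
      A.choice (.start C) (some α) * A.target (.start C) α f.head * (A.shift C α).prob f := by
  induction f with
  | start D => simp [Frag.cons, prob, Frag.head]
  | snoc f β D ih =>
    simp only [Frag.cons, prob, Frag.head, ih, shift]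
    ring

theorem haltProb_cons (A : Adversary CV QV CC QC) (C : Con CV QV CC QC) (α : Act QV CC QC)
    (f : Frag CV QV CC QC) : A.haltProb (f.cons C α) =
      A.choice (.start C) (some α) * A.target (.start C) α f.head *
        (A.shift C α).haltProb f := by
  rw [haltProb, prob_cons, haltProb, mul_assoc]
  rfl

-- First-step analysis: halting at once contributes only at `C`, and otherwise the shifted adversary
-- takes over.
open Classical in
theorem haltMass_eq (A : Adversary CV QV CC QC) (C E : Con CV QV CC QC) :
    A.haltMass C E = (if E = C then A.choice (.start C) none else 0) +
      ∑' α, A.choice (.start C) (some α) *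
        ∑' D, A.target (.start C) α D * (A.shift C α).haltMass D E := by
  rw [haltMass, Frag.tsum_head_tail]
  congr 1
  · simp [haltProb, prob]
  · refine tsum_congr fun α => ?_
    rw [← ENNReal.tsum_mul_left]
    refine tsum_congr fun D => ?_
    rw [← mul_assoc, haltMass, ← ENNReal.tsum_mul_left]
    refine tsum_congr fun g => ?_
    rw [haltProb_cons, g.2.1]

/-- Expressions shrink, so first-step analysis is a well-founded recursion. That the halting masses
form a distribution is part of the conclusion: no probability escapes into infinite runs. -/
theorem exists_weak (A : Adversary CV QV CC QC) (C : Con CV QV CC QC)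
    (s : List (Act QV CC QC))
    (hA : ∀ f : Frag CV QV CC QC, f.head = C → A.haltProb f ≠ 0 → WeakString s f.trace) :
    ∃ μ, Weak PTrans .tau C s μ ∧ ∀ E, A.haltMass C E = μ E := by
  classical
  induction hn : C.1.proc.size using Nat.strong_induction_on generalizing A C s with
  | _ n ih =>
  have ih' : ∀ α, some α ∈ (A.choice (.start C)).support →
      ∀ D ∈ (A.target (.start C) α).support, ∀ s',
      (∀ g : Frag CV QV CC QC, g.head = D → (A.shift C α).haltProb g ≠ 0 → WeakString s' g.trace) →
      ∃ μ, Weak PTrans .tau D s' μ ∧ ∀ E, (A.shift C α).haltMass D E = μ E := fun α hα D hD s' h =>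
    ih _ (hn ▸ (A.valid _ α hα).size_lt D hD) (A.shift C α) D s' h rfl
  have hcons : ∀ α, some α ∈ (A.choice (.start C)).support →
      ∀ D ∈ (A.target (.start C) α).support, ∀ g : Frag CV QV CC QC, g.head = D →
      (A.shift C α).haltProb g ≠ 0 → WeakString s (α :: g.trace) := by
    intro α hα D hD g hg h
    have := hA (g.cons C α) (by simp) ?_
    · rwa [Frag.trace_cons] at this
    · rw [haltProb_cons, hg]
      exact mul_ne_zero (mul_ne_zero hα hD) h
  -- The part of `s` left after a first action `α`: the tail if `α` heads `s`, and `s` itself if `α`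
  -- is padding. When both readings are possible, `α` counts as the demanded `τ`.
  have hs' : ∀ α, some α ∈ (A.choice (.start C)).support →
      ∃ s', (s = α :: s' ∨ α = .tau ∧ s = s') ∧
        ∀ t, WeakString s (α :: t) → WeakString s' t := by
    intro α hα
    by_cases h1 : ∃ s', s = α :: s'
    · obtain ⟨s', rfl⟩ := h1
      exact ⟨s', .inl rfl, fun t ht => ht.tail_of_cons⟩
    by_cases h2 : α = .tau
    · refine ⟨s, .inr ⟨h2, rfl⟩, fun t ht => ?_⟩
      rcases WeakString.cons_iff.1 ht with ⟨s', hs, -⟩ | ⟨-, h⟩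
      · exact absurd ⟨s', hs⟩ h1
      · exact h
    -- An action fitting neither way would forbid halting ever after, yet by induction, with the
    -- string condition vacuous, the halting masses add up to one.
    exfalso
    have hno : ∀ t, ¬ WeakString s (α :: t) := by
      intro t ht
      rcases WeakString.cons_iff.1 ht with ⟨s', hs, -⟩ | ⟨h, -⟩
      · exact h1 ⟨s', hs⟩
      · exact h2 h
    obtain ⟨D, hD⟩ := (A.target (.start C) α).support_nonempty
    obtain ⟨μ, -, hμ⟩ := ih' α hα D hD [] fun g hg h => absurd (hcons α hα D hD g hg h) (hno _)
    obtain ⟨E, hE⟩ := μ.support_nonempty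
    refine hE ?_
    rw [← hμ, haltMass, ENNReal.tsum_eq_zero]
    intro g
    by_contra h
    exact hno _ (hcons α hα D hD g.1 g.2.1 h)
  choose! s' hs' hs'' using hs'
  have hk : ∀ α D, ∃ μ, some α ∈ (A.choice (.start C)).support →
      D ∈ (A.target (.start C) α).support →
      Weak PTrans .tau D (s' α) μ ∧ ∀ E, (A.shift C α).haltMass D E = μ E := by
    intro α D
    by_cases hα : some α ∈ (A.choice (.start C)).support
    · by_cases hD : D ∈ (A.target (.start C) α).support
      · obtain ⟨μ, h⟩ := ih' α hα D hD (s' α) fun g hg h =>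
          hs'' α hα _ (hcons α hα D hD g hg h)
        exact ⟨μ, fun _ _ => h⟩
      · exact ⟨PMF.pure C, fun _ h => absurd h hD⟩
    · exact ⟨PMF.pure C, fun h => absurd h hα⟩
  choose k hk using hk
  refine ⟨(A.choice (.start C)).bind fun o => o.elim (PMF.pure C)
    fun α => (A.target (.start C) α).bind (k α), Weak.mix_map _ (A.finite _) _ ?_, fun E => ?_⟩
  · intro o ho
    cases o with
    | none =>
      have : s = [] := (hA (.start C) rfl (by
        rw [haltProb, prob, one_mul]
        exact ho)).eq_nil
      rw [this]
      exact Weak.halt C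
    | some α => exact (A.valid _ α ho).weak (hs' α ho) fun Y hY => (hk α Y ho hY).1
  · rw [haltMass_eq, PMF.bind_apply, ENNReal.tsum_option]
    congr 1
    · simp [PMF.pure_apply]
    · refine tsum_congr fun α => ?_
      by_cases hα : some α ∈ (A.choice (.start C)).support
      · rw [Option.elim_some, PMF.bind_apply]
        congr 1
        refine tsum_congr fun D => ?_
        by_cases hD : D ∈ (A.target (.start C) α).support
        · rw [(hk α D hα hD).2]
        · rw [(PMF.apply_eq_zero_iff _ _).2 hD, zero_mul, zero_mul]
      · rw [(PMF.apply_eq_zero_iff _ _).2 hα, zero_mul, zero_mul]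

/-- `A` realizes the weak transition from `C` with string `s` to `μ`. -/
def Realizes (A : Adversary CV QV CC QC) (C : Con CV QV CC QC) (s : List (Act QV CC QC))
    (μ : PMF (Con CV QV CC QC)) : Prop :=
  (∀ E, A.haltMass C E = μ E) ∧
    ∀ f : Frag CV QV CC QC, f.head = C → A.haltProb f ≠ 0 → WeakString s f.trace

/-- After its first transition, `prefixed` agrees with `A D` only on histories starting at `D`; no
others affect the probabilities of such histories. -/
theorem prob_congr {A B : Adversary CV QV CC QC} {D : Con CV QV CC QC}
    (hc : ∀ f : Frag CV QV CC QC, f.head = D → A.choice f = B.choice f)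
    (ht : ∀ f : Frag CV QV CC QC, f.head = D → A.target f = B.target f)
    (f : Frag CV QV CC QC) (hf : f.head = D) : A.prob f = B.prob f := by
  induction f with
  | start D => rfl
  | snoc f β E ih => rw [prob, prob, ih hf, hc f hf, ht f hf]

theorem haltProb_congr {A B : Adversary CV QV CC QC} {D : Con CV QV CC QC}
    (hc : ∀ f : Frag CV QV CC QC, f.head = D → A.choice f = B.choice f)
    (ht : ∀ f : Frag CV QV CC QC, f.head = D → A.target f = B.target f)
    (f : Frag CV QV CC QC) (hf : f.head = D) : A.haltProb f = B.haltProb f := by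
  rw [haltProb, haltProb, prob_congr hc ht f hf, hc f hf]

/-- The adversary that halts immediately. -/
noncomputable def halting : Adversary CV QV CC QC where
  choice _ := PMF.pure none
  target f _ := PMF.pure f.head
  finite _ := by simp
  valid _ _ h := by simp at h

theorem halting_realizes (C : Con CV QV CC QC) : halting.Realizes C [] (PMF.pure C) := by
  classical
  refine ⟨fun E => ?_, fun f hf h => ?_⟩
  · rw [haltMass_eq]
    simp [halting, PMF.pure_apply]
  · cases f with
    | start D => exact WeakString.nil
    | snoc f β D => simp [haltProb, prob, halting] at h

open Classical in
/-- The adversary that starts at `C` with the transition `α` to `μ` and continues from `D`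
with `A D`. -/
noncomputable def prefixed (C : Con CV QV CC QC) (α : Act QV CC QC) (μ : PMF (Con CV QV CC QC))
    (h : CTrans C α μ) (A : Con CV QV CC QC → Adversary CV QV CC QC) : Adversary CV QV CC QC where
  -- From other starting points it halts at once, since the transition need not be available there.
  choice f := f.uncons.elim (fun D => PMF.pure (if D = C then some α else none))
    fun p => (A p.2.2.head).choice p.2.2
  target f β := f.uncons.elim (fun _ => μ) fun p => (A p.2.2.head).target p.2.2 β
  finite f := by
    cases h : f.uncons with
    | inl D => simp
    | inr p => exact (A p.2.2.head).finite _
  valid f β hβ := by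
    rcases f.eq_start_or_cons with hf | ⟨γ, g, hf⟩
    · rw [hf] at hβ ⊢
      simp only [Frag.uncons, Sum.elim_inl] at hβ ⊢
      split_ifs at hβ with hC
      · simp only [PMF.support_pure, Set.mem_singleton_iff, Option.some.injEq] at hβ
        rw [hβ, Frag.tail, hC]
        exact h
      · simp at hβ
    · rw [hf] at hβ ⊢
      simp only [Frag.uncons_cons, Sum.elim_inr, Frag.tail_cons] at hβ ⊢
      exact (A g.head).valid g β hβ

theorem prefixed_realizes {C : Con CV QV CC QC} {α : Act QV CC QC} {μ : PMF (Con CV QV CC QC)}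
    (h : CTrans C α μ) {A : Con CV QV CC QC → Adversary CV QV CC QC} {s s' : List (Act QV CC QC)}
    {k : Con CV QV CC QC → PMF (Con CV QV CC QC)}
    (hs : s = α :: s' ∨ α = .tau ∧ s = s') (hA : ∀ D ∈ μ.support, (A D).Realizes D s' (k D)) :
    (prefixed C α μ h A).Realizes C s (μ.bind k) := by
  classical
  have h1 : (prefixed C α μ h A).choice (.start C) = PMF.pure (some α) := by
    simp [prefixed, Frag.uncons]
  have h2 : (prefixed C α μ h A).target (.start C) α = μ := by
    simp [prefixed, Frag.uncons]
  have h3 : ∀ D, ∀ f : Frag CV QV CC QC, f.head = D →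
      ((prefixed C α μ h A).shift C α).haltProb f = (A D).haltProb f := fun D f hf =>
    haltProb_congr (fun f hf => by simp [shift, prefixed, hf])
      (fun f hf => by simp [shift, prefixed, hf]) f hf
  refine ⟨fun E => ?_, fun f hf hne => ?_⟩
  · rw [haltMass_eq, h1, tsum_eq_single α, h2, PMF.bind_apply]
    · simp only [PMF.pure_apply, reduceCtorEq, if_false, ite_self, zero_add, if_true, one_mul]
      refine tsum_congr fun D => ?_
      by_cases hD : D ∈ μ.support
      · rw [← (hA D hD).1 E]
        congr 1
        exact tsum_congr fun f => h3 D f.1 f.2.1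
      · rw [(PMF.apply_eq_zero_iff _ _).2 hD, zero_mul, zero_mul]
    · intro β hβ
      simp [PMF.pure_apply, hβ]
  · rcases f.eq_start_or_cons with hf' | ⟨β, g, hf'⟩
    · rw [hf', hf, haltProb, h1] at hne
      simp at hne
    · rw [hf', hf, haltProb_cons, h1] at hne
      have hβ : β = α := by
        by_contra hβ
        simp [PMF.pure_apply, hβ] at hne
      subst hβ
      rw [h2, h3 _ g rfl] at hne
      have hg : g.head ∈ μ.support := fun h0 => hne (by simp [h0])
      rw [hf', Frag.trace_cons]
      have := (hA _ hg).2 g rfl (right_ne_zero_of_mul hne)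
      rcases hs with rfl | ⟨rfl, rfl⟩
      · exact WeakString.act _ _ _ this
      · exact WeakString.tau _ _ this

end Adversary

end QCCS

open scoped ENNReal

namespace QCCS

variable {CV : Type u} {QV : Type v} {CC : Type w} {QC : Type z} [DecidableEq CV] [DecidableEq QV]

namespace Adversary

theorem prob_le_one (A : Adversary CV QV CC QC) (f : Frag CV QV CC QC) : A.prob f ≤ 1 := by
  induction f with
  | start D => exact le_rfl
  | snoc f β D ih => exact mul_le_one' ih (mul_le_one' (PMF.coe_le_one _ _) (PMF.coe_le_one _ _))

section Mixed

variable {ι : Type*} (p : PMF ι) (A : ι → Adversary CV QV CC QC)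

theorem tsum_mul_ne_top {c : ι → ℝ≥0∞} (hc : ∀ i, c i ≤ 1) : ∑' i, p i * c i ≠ ∞ := by
  refine ne_top_of_le_ne_top ENNReal.one_ne_top ?_
  rw [← p.tsum_coe]
  exact ENNReal.tsum_le_tsum fun i => mul_le_of_le_one_right' (hc i)

theorem tsum_prob_ne_top (f : Frag CV QV CC QC) : ∑' i, p i * (A i).prob f ≠ ∞ :=
  tsum_mul_ne_top p fun i => (A i).prob_le_one f

theorem tsum_prob_mul_choice_ne_top (f : Frag CV QV CC QC) (o : Option (Act QV CC QC)) :
    ∑' i, p i * (A i).prob f * (A i).choice f o ≠ ∞ := by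
  simp only [mul_assoc]
  exact tsum_mul_ne_top p fun i => mul_le_one' ((A i).prob_le_one f) (PMF.coe_le_one _ _)

/-- The adversary that behaves as `A i` with probability `p i`. -/
noncomputable def mixed (hp : p.support.Finite) : Adversary CV QV CC QC where
  -- Bayes: after `f`, the component `A i` has weight `p i` times its own probability of producing
  -- `f`; for the target of `α` this is multiplied by the chance that `A i` picks `α`.
  choice f := PMF.weighted (fun i => p i * (A i).prob f) (fun i => (A i).choice f) (PMF.pure none)
  target f α := PMF.weighted (fun i => p i * (A i).prob f * (A i).choice f (some α))
    (fun i => (A i).target f α) (PMF.pure f.head)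
  finite f := by
    refine Set.Finite.subset ?_ (PMF.support_weighted_subset _ _ _)
    refine Set.Finite.union (Set.Finite.biUnion (hp.subset fun i hi => ?_) fun i _ =>
      (A i).finite f) (by simp)
    exact left_ne_zero_of_mul hi
  valid f α hα := by
    rcases PMF.support_weighted_subset _ _ _ hα with h | h
    · simp only [Set.mem_iUnion] at h
      obtain ⟨i, hi, hiα⟩ := h
      refine CTrans.weighted (hp.subset fun j hj => ?_) (tsum_prob_mul_choice_ne_top p A f _)
        (fun j hj => (A j).valid f α (right_ne_zero_of_mul hj)) (mul_ne_zero hi hiα)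
      exact left_ne_zero_of_mul (left_ne_zero_of_mul hj)
    · simp at h

/-- The normalizations telescope: the choice is divided by the total weight of `f`, which is the
probability accumulated so far, and the target by the weight of `f` with the choice of `α`. -/
theorem prob_mixed (hp : p.support.Finite) (f : Frag CV QV CC QC) :
    (mixed p A hp).prob f = ∑' i, p i * (A i).prob f := by
  induction f with
  | start D => simp [prob, p.tsum_coe]
  | snoc f α D ih =>
    rw [prob, ih, ← mul_assoc]
    simp only [mixed]
    rw [PMF.tsum_mul_weighted (tsum_prob_ne_top p A f),
      PMF.tsum_mul_weighted (tsum_prob_mul_choice_ne_top p A f _)]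
    simp only [prob, mul_assoc]

theorem haltProb_mixed (hp : p.support.Finite) (f : Frag CV QV CC QC) :
    (mixed p A hp).haltProb f = ∑' i, p i * (A i).haltProb f := by
  rw [haltProb, prob_mixed]
  simp only [mixed, haltProb]
  rw [PMF.tsum_mul_weighted (tsum_prob_ne_top p A f)]
  simp only [mul_assoc]

theorem mixed_realizes (hp : p.support.Finite) {C : Con CV QV CC QC} {s : List (Act QV CC QC)}
    {k : ι → PMF (Con CV QV CC QC)} (hA : ∀ i ∈ p.support, (A i).Realizes C s (k i)) :
    (mixed p A hp).Realizes C s (p.bind k) := by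
  refine ⟨fun E => ?_, fun f hf hne => ?_⟩
  · simp only [haltMass, haltProb_mixed]
    rw [ENNReal.tsum_comm, PMF.bind_apply]
    refine tsum_congr fun i => ?_
    by_cases hi : i ∈ p.support
    · rw [ENNReal.tsum_mul_left, ← (hA i hi).1 E, haltMass]
    · simp [(PMF.apply_eq_zero_iff _ _).2 hi]
  · rw [haltProb_mixed] at hne
    obtain ⟨i, hi⟩ : ∃ i, p i * (A i).haltProb f ≠ 0 := by
      by_contra! h
      exact hne (ENNReal.tsum_eq_zero.2 h)
    exact (hA i (left_ne_zero_of_mul hi)).2 f hf (right_ne_zero_of_mul hi)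

end Mixed

end Adversary

theorem Weak.exists_realizes {C : Con CV QV CC QC} {s : List (Act QV CC QC)}
    {μ : PMF (Con CV QV CC QC)} (h : Weak PTrans .tau C s μ) :
    ∃ A : Adversary CV QV CC QC, A.Realizes C s μ := by
  have : Nonempty (Adversary CV QV CC QC) := ⟨Adversary.halting⟩
  induction h with
  | halt X => exact ⟨_, Adversary.halting_realizes X⟩
  | tau X μ s k h hk ih =>
    choose! A hA using ih
    exact ⟨_, Adversary.prefixed_realizes (CTrans.of_pTrans h) (.inr ⟨rfl, rfl⟩) hA⟩
  | act X α μ s k h hk ih =>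
    choose! A hA using ih
    exact ⟨_, Adversary.prefixed_realizes (CTrans.of_pTrans h) (.inl rfl) hA⟩
  | mix X s p hp hk ih =>
    choose! A hA using ih
    exact ⟨_, Adversary.mixed_realizes p A hp hA⟩

/-- This removes adversaries from the rest of the argument. Finite support is automatic, as every
rule of `Weak` preserves it. -/
theorem wTrans_iff {C : Con CV QV CC QC} {s : List (Act QV CC QC)}
    {μ : PMF (Con CV QV CC QC)} : WTrans C s μ ↔ Weak PTrans .tau C s μ := by
  constructor
  · rintro ⟨-, A, h1, h2⟩
    obtain ⟨ν, h3, h4⟩ := A.exists_weak C s h2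
    rwa [show μ = ν from PMF.ext fun E => (h1 E).symm.trans (h4 E)]
  · intro h
    obtain ⟨A, hA⟩ := h.exists_realizes
    exact ⟨h.finite_support fun _ _ _ h => h.finite_support, A, hA⟩

end QCCS

/-! ### Bisimilarity is a bisimulation, and equality implies it -/

namespace PMF.Coupled

variable {α β : Type*}

/-- Passing to class masses avoids gluing two couplings along `ν`. -/
theorem trans {R : α → α → Prop} (hR : Equivalence R) {μ ν κ : PMF α} (h₁ : Coupled R μ ν)
    (h₂ : Coupled R ν κ) : Coupled R μ κ := by
  rw [coupled_iff_of_equivalence hR] at *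
  exact fun a => (h₁ a).trans (h₂ a)

theorem rel_of_pure {R : α → β → Prop} {μ : PMF α} {b : β} (h : Coupled R μ (PMF.pure b)) :
    ∀ a ∈ μ.support, R a b := by
  intro a ha
  obtain ⟨b', hb', hab⟩ := h.exists_right ha
  rwa [(PMF.mem_support_pure_iff _ _).1 hb'] at hab

end PMF.Coupled

namespace QCCS

variable {CV : Type u} {QV : Type v} {CC : Type w} {QC : Type z} [DecidableEq CV] [DecidableEq QV]

theorem Act.hat_of_ne_tau {α : Act QV CC QC} (h : α ≠ .tau) : α.hat = [α] := by
  cases α <;> first | rfl | exact absurd rfl h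

theorem Act.tau_notMem_hat (α : Act QV CC QC) : Act.tau ∉ α.hat := by
  cases α <;> simp [hat]

theorem Act.eq_tau_of_hat_eq_nil {α : Act QV CC QC} (h : α.hat = []) : α = .tau := by
  cases α <;> simp [hat] at h ⊢

theorem Weak.hat {S : Type*} {T : S → Act QV CC QC → PMF S → Prop} {X : S} {α : Act QV CC QC}
    {μ : PMF S} (h : Weak T .tau X [α] μ) : Weak T .tau X α.hat μ := by
  by_cases hα : α = .tau
  · subst hα
    exact h.drop_tau
  · rwa [Act.hat_of_ne_tau hα]

variable {R : Con CV QV CC QC → Con CV QV CC QC → Prop} {X Y Z : Con CV QV CC QC}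

theorem isWeakBisim_iff : IsWeakBisim R ↔ Equivalence R ∧ ∀ C D, R C D →
    (∀ α μ, PTrans C α μ → ∃ ν, Weak PTrans .tau D α.hat ν ∧ PMF.Coupled R μ ν) ∧
    (Stuck C → Stuck D → C.1.ctx = D.1.ctx) := by
  unfold IsWeakBisim
  refine and_congr_right fun hR => ?_
  simp only [wTrans_iff, PMF.coupled_iff_of_equivalence hR]
  rfl

theorem IsWeakBisim.simulate (hR : IsWeakBisim R) (hXY : R X Y) {s : List (Act QV CC QC)}
    {μ : PMF (Con CV QV CC QC)} (h : Weak PTrans .tau X s μ) (hs : .tau ∉ s) :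
    ∃ ν, Weak PTrans .tau Y s ν ∧ PMF.Coupled R μ ν :=
  Weak.simulate (hat := Act.hat) rfl (fun _ => Act.hat_of_ne_tau)
    (fun _ _ _ h => h.finite_support)
    (fun X Y hXY => ((isWeakBisim_iff.1 hR).2 X Y hXY).1) h hs hXY

theorem weakBisimilar_refl (X : Con CV QV CC QC) : WeakBisimilar X X := by
  refine ⟨Eq, isWeakBisim_iff.2 ⟨eq_equivalence, ?_⟩, rfl⟩
  rintro C _ rfl
  exact ⟨fun α μ h => ⟨μ, (Weak.single h).hat, PMF.Coupled.refl (fun _ => rfl) _⟩,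
    fun _ _ => rfl⟩

theorem WeakBisimilar.symm (h : WeakBisimilar X Y) : WeakBisimilar Y X := by
  obtain ⟨R, hR, hXY⟩ := h
  exact ⟨R, hR, hR.1.symm hXY⟩

/-- `Y` is a possible result of invisible transitions from `X`. -/
def Reaches (X Y : Con CV QV CC QC) : Prop :=
  ∃ ν, Weak PTrans .tau X [] ν ∧ Y ∈ ν.support

theorem Reaches.refl (X : Con CV QV CC QC) : Reaches X X :=
  ⟨_, Weak.halt X, by simp⟩

theorem Reaches.trans (h₁ : Reaches X Y) (h₂ : Reaches Y Z) : Reaches X Z := by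
  classical
  obtain ⟨μ, h₁, hY⟩ := h₁
  obtain ⟨ν, h₂, hZ⟩ := h₂
  -- Continue from `Y` only and halt at the other outcomes.
  refine ⟨μ.bind fun D => if D = Y then ν else PMF.pure D, h₁.append (s' := []) fun D _ => ?_,
    (PMF.mem_support_bind_iff _ _ _).2 ⟨Y, hY, by simpa using hZ⟩⟩
  split_ifs with h
  · rwa [h]
  · exact Weak.halt D

theorem Stuck.weak (hX : Stuck X) {s : List (Act QV CC QC)} {μ : PMF (Con CV QV CC QC)}
    (h : Weak PTrans .tau X s μ) : s = [] ∧ μ = PMF.pure X :=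
  h.eq_pure_of_stuck hX

theorem Stuck.eq_of_reaches (hX : Stuck X) (h : Reaches X Y) : Y = X := by
  obtain ⟨ν, h, hY⟩ := h
  rw [(hX.weak h).2] at hY
  simpa using hY

/-- A stuck configuration can answer only by staying put with the empty string, which confines `Y`
to invisible moves inside its class. -/
theorem IsWeakBisim.of_stuck (hR : IsWeakBisim R) (hX : Stuck X) (hXY : R X Y)
    {α : Act QV CC QC} {μ : PMF (Con CV QV CC QC)} (h : PTrans Y α μ) :
    α = .tau ∧ ∀ Z ∈ μ.support, R X Z := by
  obtain ⟨ν, h1, h2⟩ := ((isWeakBisim_iff.1 hR).2 Y X (hR.1.symm hXY)).1 α μ h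
  obtain ⟨h3, rfl⟩ := hX.weak h1
  exact ⟨Act.eq_tau_of_hat_eq_nil h3, fun Z hZ => hR.1.symm (h2.rel_of_pure Z hZ)⟩

/-- By `of_stuck` every run from `Y` is invisible and stays in the class, and it ends because sizes
decrease. -/
theorem IsWeakBisim.exists_reaches_stuck (hR : IsWeakBisim R) (hX : Stuck X) (hXY : R X Y) :
    ∃ Z, Reaches Y Z ∧ Stuck Z ∧ R X Z := by
  induction hn : Y.1.proc.size using Nat.strong_induction_on generalizing Y with
  | _ n ih =>
  by_cases hY : Stuck Y
  · exact ⟨Y, Reaches.refl Y, hY, hXY⟩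
  · unfold Stuck at hY
    push Not at hY
    obtain ⟨α, μ, h⟩ := hY
    obtain ⟨rfl, hμ⟩ := hR.of_stuck hX hXY h
    obtain ⟨Y', hY'⟩ := μ.support_nonempty
    obtain ⟨Z, h1, h2⟩ := ih _ (hn ▸ h.size_lt Y' hY') (hμ Y' hY') rfl
    exact ⟨Z, Reaches.trans ⟨μ, Weak.single_tau h, hY'⟩ h1, h2⟩

/-- Bisimilar configurations can get stuck with the same contexts. -/
theorem WeakBisimilar.exists_reaches_stuck (h : WeakBisimilar X Y) (hXZ : Reaches X Z)
    (hZ : Stuck Z) : ∃ Z', Reaches Y Z' ∧ Stuck Z' ∧ Z.1.ctx = Z'.1.ctx := by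
  obtain ⟨R, hR, hXY⟩ := h
  obtain ⟨μ, h1, h2⟩ := hXZ
  obtain ⟨ν, h3, h4⟩ := hR.simulate hXY h1 (by simp)
  obtain ⟨W, h5, h6⟩ := h4.exists_right h2
  obtain ⟨Z', h7, h8, h9⟩ := hR.exists_reaches_stuck hZ h6
  exact ⟨Z', Reaches.trans ⟨ν, h3, h5⟩ h7, h8, (hR.2 _ _ h9).2 hZ h8⟩

theorem transGen_weakBisimilar_equivalence :
    Equivalence (Relation.TransGen (WeakBisimilar (CV := CV) (QV := QV) (CC := CC) (QC := QC))) :=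
  ⟨fun X => .single (weakBisimilar_refl X),
    fun h => by
      induction h with
      | single h => exact .single h.symm
      | tail _ h ih => exact .head h.symm ih, .trans⟩

/-- Links of a chain may come from different bisimulations, so the transitive closure of `≈` is
shown to be a bisimulation; it is then contained in `≈`. -/
theorem transGen_weakBisimilar_isWeakBisim :
    IsWeakBisim (Relation.TransGen (WeakBisimilar (CV := CV) (QV := QV) (CC := CC) (QC := QC))) := by
  refine isWeakBisim_iff.2 ⟨transGen_weakBisimilar_equivalence, fun C D hCD => ⟨?_, ?_⟩⟩
  · have key : ∀ s μ, .tau ∉ s → Weak PTrans .tau C s μ → ∃ ν, Weak PTrans .tau D s ν ∧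
        PMF.Coupled (Relation.TransGen WeakBisimilar) μ ν := by
      have single : ∀ {X Y : Con CV QV CC QC}, WeakBisimilar X Y → ∀ s μ, .tau ∉ s →
          Weak PTrans .tau X s μ → ∃ ν, Weak PTrans .tau Y s ν ∧
            PMF.Coupled (Relation.TransGen WeakBisimilar) μ ν := by
        rintro X Y ⟨R, hR, hXY⟩ s μ hs h
        obtain ⟨ν, h1, h2⟩ := hR.simulate hXY h hs
        exact ⟨ν, h1, h2.mono fun a _ b _ hab => .single ⟨R, hR, hab⟩⟩
      induction hCD with
      | single h => exact single h
      | tail _ h ih =>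
        intro s μ hs hW
        obtain ⟨ν, h1, h2⟩ := ih s μ hs hW
        obtain ⟨κ, h3, h4⟩ := single h s ν hs h1
        exact ⟨κ, h3, h2.trans transGen_weakBisimilar_equivalence h4⟩
    exact fun α μ h => key _ _ α.tau_notMem_hat (Weak.single h).hat
  · intro hC hD
    -- Intermediate configurations need not be stuck, so clause (b) does not chain. The contexts of
    -- reachable stuck configurations do, and a stuck configuration reaches only itself.
    have key : ∀ Z, Reaches C Z → Stuck Z → ∃ Z', Reaches D Z' ∧ Stuck Z' ∧ Z.1.ctx = Z'.1.ctx := by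
      clear hD
      induction hCD with
      | single h => exact fun Z => h.exists_reaches_stuck
      | tail _ h ih =>
        intro Z h1 h2
        obtain ⟨Z', h3, h4, h5⟩ := ih Z h1 h2
        obtain ⟨Z'', h6, h7, h8⟩ := h.exists_reaches_stuck h3 h4
        exact ⟨Z'', h6, h7, h5.trans h8⟩
    obtain ⟨Z', h1, -, h2⟩ := key C (Reaches.refl C) hC
    rwa [hD.eq_of_reaches h1] at h2

/-- Weak bisimilarity is itself a weak probabilistic bisimulation. -/
theorem weakBisimilar_isWeakBisim :
    IsWeakBisim (WeakBisimilar (CV := CV) (QV := QV) (CC := CC) (QC := QC)) := by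
  have : Relation.TransGen (WeakBisimilar (CV := CV) (QV := QV) (CC := CC) (QC := QC)) =
      WeakBisimilar := by
    funext X Y
    exact propext ⟨fun h => ⟨_, transGen_weakBisimilar_isWeakBisim, h⟩, .single⟩
  rw [← this]
  exact transGen_weakBisimilar_isWeakBisim

theorem weakBisimilar_equivalence :
    Equivalence (WeakBisimilar (CV := CV) (QV := QV) (CC := CC) (QC := QC)) :=
  weakBisimilar_isWeakBisim.1

theorem WeakBisimilar.trans (h₁ : WeakBisimilar X Y) (h₂ : WeakBisimilar Y Z) :
    WeakBisimilar X Z :=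
  weakBisimilar_equivalence.trans h₁ h₂

/-- Every transition of `X` is matched by a weak transition of `Y` with the same action. -/
def StrictMatch (X Y : Con CV QV CC QC) : Prop :=
  ∀ α μ, PTrans X α μ → ∃ ν, Weak PTrans .tau Y [α] ν ∧ PMF.Coupled WeakBisimilar μ ν

theorem conEq_iff : ConEq X Y ↔ StrictMatch X Y ∧ StrictMatch Y X ∧
    (Stuck X → Stuck Y → X.1.ctx = Y.1.ctx) := by
  unfold ConEq StrictMatch
  simp only [wTrans_iff, PMF.coupled_iff_of_equivalence weakBisimilar_equivalence]
  refine and_congr_right fun _ => and_congr_left fun _ => ?_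
  constructor
  · intro h α μ hμ
    obtain ⟨ν, h1, h2⟩ := h α μ hμ
    exact ⟨ν, h1, fun C => (h2 C).symm⟩
  · intro h α μ hμ
    obtain ⟨ν, h1, h2⟩ := h α μ hμ
    exact ⟨ν, h1, fun C => (h2 C).symm⟩

/-- Only the first transition uses the strict match; afterwards bisimilarity takes over. The wider
`R` serves the run that halts at once, where `X` and `Y` themselves are compared. -/
theorem StrictMatch.simulate (hm : StrictMatch X Y) (hR : ∀ A B, WeakBisimilar A B → R A B)
    (hXY : R X Y) {s : List (Act QV CC QC)} {μ : PMF (Con CV QV CC QC)}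
    (h : Weak PTrans .tau X s μ) (hs : .tau ∉ s) :
    ∃ ν, Weak PTrans .tau Y s ν ∧ PMF.Coupled R μ ν := by
  have cont : ∀ {s : List (Act QV CC QC)} {k : Con CV QV CC QC → PMF (Con CV QV CC QC)} {x},
      .tau ∉ s → Weak PTrans .tau x s (k x) → ∀ y, WeakBisimilar x y →
      ∃ κ, Weak PTrans .tau y s κ ∧ PMF.Coupled R (k x) κ := by
    intro s k x hs h y hxy
    obtain ⟨κ, h1, h2⟩ := weakBisimilar_isWeakBisim.simulate hxy h hs
    exact ⟨κ, h1, h2.mono fun a _ b _ => hR a b⟩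
  have hfin : ∀ (X : Con CV QV CC QC) α μ, PTrans X α μ → μ.support.Finite :=
    fun _ _ _ h => h.finite_support
  induction h with
  | halt X => exact ⟨_, Weak.halt Y, PMF.Coupled.pure hXY⟩
  | tau X μ s k h hk ih =>
    obtain ⟨ν, h1, h2⟩ := hm _ _ h
    exact Weak.bind_coupled hfin h.finite_support h1.drop_tau h2
      fun x hx y hxy => cont hs (hk x hx) y hxy
  | act X α μ s k h hk ih =>
    obtain ⟨ν, h1, h2⟩ := hm _ _ h
    exact Weak.bind_coupled hfin h.finite_support h1 h2
      fun x hx y hxy => cont (fun h' => hs (by simp [h'])) (hk x hx) y hxy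
  | mix X s p hp hk ih =>
    have hk' : ∀ ν ∈ p.support, ∃ κ, Weak PTrans .tau Y s κ ∧ PMF.Coupled R ν κ :=
      fun ν hν => ih ν hν hm hXY hs
    have : Nonempty (PMF (Con CV QV CC QC)) := ⟨PMF.pure Y⟩
    choose! κ h1 h2 using hk'
    exact ⟨_, Weak.mix_map p hp κ h1, PMF.Coupled.of_bind h2⟩

/-- `C` moves invisibly to configurations bisimilar to `X`, `D` answers with configurations
bisimilar to those, and the stuck `Y` answers `D` by staying. No bisimilarity of `C` and `D` is
presupposed. -/
theorem StrictMatch.weakBisimilar_of_stuck {C D : Con CV QV CC QC} (hm : StrictMatch C D)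
    (hC : ¬ Stuck C) (hX : Stuck X) (hY : Stuck Y) (hXC : WeakBisimilar X C)
    (hDY : WeakBisimilar D Y) : WeakBisimilar X Y := by
  unfold Stuck at hC
  push Not at hC
  obtain ⟨α, μ, h⟩ := hC
  obtain ⟨rfl, hμ⟩ := weakBisimilar_isWeakBisim.of_stuck hX hXC h
  obtain ⟨ν, h1, h2⟩ := hm _ _ h
  obtain ⟨κ, h3, h4⟩ := weakBisimilar_isWeakBisim.simulate hDY h1.drop_tau (by simp)
  rw [(hY.weak h3).2] at h4
  obtain ⟨W, hW⟩ := μ.support_nonempty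
  obtain ⟨Z, hZ, hWZ⟩ := h2.exists_right hW
  exact (hμ W hW).trans (hWZ.trans (h4.rel_of_pure Z hZ))

/-- Equal configurations are weakly bisimilar. -/
theorem ConEq.weakBisimilar {C D : Con CV QV CC QC} (h : ConEq C D) : WeakBisimilar C D := by
  obtain ⟨hm, hm', hctx⟩ := conEq_iff.1 h
  -- The least equivalence that contains `≈` and joins the classes of `C` and `D`.
  let R : Con CV QV CC QC → Con CV QV CC QC → Prop := fun X Y =>
    WeakBisimilar X Y ∨ (WeakBisimilar X C ∧ WeakBisimilar D Y) ∨
      (WeakBisimilar X D ∧ WeakBisimilar C Y)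
  have hRe : Equivalence R := by
    refine ⟨fun X => .inl (weakBisimilar_refl X), ?_, ?_⟩
    · rintro X Y (h | ⟨h1, h2⟩ | ⟨h1, h2⟩)
      · exact .inl h.symm
      · exact .inr (.inr ⟨h2.symm, h1.symm⟩)
      · exact .inr (.inl ⟨h2.symm, h1.symm⟩)
    · rintro X Y Z (h | ⟨h1, h2⟩ | ⟨h1, h2⟩) (h' | ⟨h3, h4⟩ | ⟨h3, h4⟩)
      · exact .inl (h.trans h')
      · exact .inr (.inl ⟨h.trans h3, h4⟩)
      · exact .inr (.inr ⟨h.trans h3, h4⟩)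
      · exact .inr (.inl ⟨h1, h2.trans h'⟩)
      · exact .inr (.inl ⟨h1, h4⟩)
      · exact .inl (h1.trans h4)
      · exact .inr (.inr ⟨h1, h2.trans h'⟩)
      · exact .inl (h1.trans h4)
      · exact .inr (.inr ⟨h1, h4⟩)
  have hsub : ∀ X Y, WeakBisimilar X Y → R X Y := fun X Y => .inl
  have hCD : R C D := .inr (.inl ⟨weakBisimilar_refl C, weakBisimilar_refl D⟩)
  have match_of : ∀ {C D X Y : Con CV QV CC QC}, StrictMatch C D → R C D → WeakBisimilar X C →
      WeakBisimilar D Y → ∀ α μ, PTrans X α μ →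
      ∃ ν, Weak PTrans .tau Y α.hat ν ∧ PMF.Coupled R μ ν := by
    intro C D X Y hm hCD hXC hDY α μ h
    obtain ⟨μ₁, a1, a2⟩ := ((isWeakBisim_iff.1 weakBisimilar_isWeakBisim).2 _ _ hXC).1 α μ h
    obtain ⟨μ₂, b1, b2⟩ := hm.simulate hsub hCD a1 α.tau_notMem_hat
    obtain ⟨μ₃, c1, c2⟩ := weakBisimilar_isWeakBisim.simulate hDY b1 α.tau_notMem_hat
    exact ⟨μ₃, c1, ((a2.mono fun a _ b _ => hsub a b).trans hRe b2).trans hRe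
      (c2.mono fun a _ b _ => hsub a b)⟩
  have ctx_of : ∀ {C D X Y : Con CV QV CC QC}, StrictMatch C D → StrictMatch D C →
      (Stuck C → Stuck D → C.1.ctx = D.1.ctx) → WeakBisimilar X C → WeakBisimilar D Y →
      Stuck X → Stuck Y → X.1.ctx = Y.1.ctx := by
    intro C D X Y hm hm' hctx hXC hDY hX hY
    have key := fun {A B : Con CV QV CC QC} (h : WeakBisimilar A B) =>
      (weakBisimilar_isWeakBisim.2 A B h).2
    -- If `C` and `D` are both stuck, clause (b) of equality applies; if one can move, `X` and `Y`
    -- are already bisimilar.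
    by_cases hC : Stuck C
    · by_cases hD : Stuck D
      · exact (key hXC hX hC).trans ((hctx hC hD).trans (key hDY hD hY))
      · exact key (hm'.weakBisimilar_of_stuck hD hY hX hDY.symm hXC.symm).symm hX hY
    · exact key (hm.weakBisimilar_of_stuck hC hX hY hXC hDY) hX hY
  refine ⟨R, isWeakBisim_iff.2 ⟨hRe, ?_⟩, hCD⟩
  rintro X Y (h | ⟨h1, h2⟩ | ⟨h1, h2⟩)
  · refine ⟨fun α μ hμ => ?_, (weakBisimilar_isWeakBisim.2 X Y h).2⟩
    obtain ⟨ν, h1, h2⟩ := ((isWeakBisim_iff.1 weakBisimilar_isWeakBisim).2 _ _ h).1 α μ hμ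
    exact ⟨ν, h1, h2.mono fun a _ b _ => hsub a b⟩
  · exact ⟨match_of hm hCD h1 h2, ctx_of hm hm' hctx h1 h2⟩
  · exact ⟨match_of hm' (hRe.symm hCD) h1 h2,
      ctx_of hm' hm (fun h3 h4 => (hctx h4 h3).symm) h1 h2⟩

end QCCS

/-! ### Transitions commute with renaming of qubits -/

open scoped ComplexOrder

namespace QCCS

variable {CV : Type u} {QV : Type v} {CC : Type w} {QC : Type z} [DecidableEq CV] [DecidableEq QV]

namespace Proc

theorem perm_perm (σ π : Equiv.Perm QV) (E : Proc CV QV CC QC) :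
    (E.perm σ).perm π = E.perm (π * σ) := by
  induction E <;> simp_all [perm] <;> rfl

theorem perm_one (E : Proc CV QV CC QC) : E.perm (1 : Equiv.Perm QV) = E := by
  induction E <;> simp_all [perm] <;> rfl

theorem perm_subst (π : Equiv.Perm QV) (s : CV → Option ℝ) (E : Proc CV QV CC QC) :
    (E.subst s).perm π = (E.perm π).subst s := by
  induction E generalizing s <;> simp_all [perm, subst]

/-- Substitution of a qubit is renaming by a transposition, and conjugation by `π` gives the
transposition of the renamed qubits. -/
theorem perm_qsubst (π : Equiv.Perm QV) (q r : QV) (E : Proc CV QV CC QC) :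
    (E.qsubst q r).perm π = (E.perm π).qsubst (π q) (π r) := by
  rw [qsubst, qsubst, perm_perm, perm_perm, Equiv.mul_swap_eq_swap_mul]

end Proc

namespace Context

/-- The entries of the density matrix, indexed by assignments to all qubits. -/
def entry (C : Context QV) (x y : QV → Fin 2) : ℂ :=
  C.state.mat (fun s => x s.1) (fun s => y s.1)

theorem exists_extension {S : Finset QV} (x : S → Fin 2) :
    ∃ x' : QV → Fin 2, (fun s : S => x' s.1) = x :=
  ⟨fun q => if h : q ∈ S then x ⟨q, h⟩ else 0, by funext s; simp⟩

/-- The index types of the matrices depend on the set of variables; entries at assignments to all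
names are comparable without transport. -/
theorem eq_of_entry {C D : Context QV} (hv : C.vars = D.vars)
    (he : ∀ x y, C.entry x y = D.entry x y) : C = D := by
  obtain ⟨S, ρ, h1, h2⟩ := C
  obtain ⟨S', σ, h3, h4⟩ := D
  obtain rfl : S = S' := hv
  congr
  ext x y
  obtain ⟨x, rfl⟩ := exists_extension x
  obtain ⟨y, rfl⟩ := exists_extension y
  exact he x y

/-- Assignments to the renamed qubits, as assignments to the original ones. -/
def permEquiv (π : Equiv.Perm QV) (S : Finset QV) :
    (↥(S.map π.toEmbedding) → Fin 2) ≃ (S → Fin 2) :=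
  Equiv.arrowCongr ((π.subtypeEquiv fun q => by simp).symm) (Equiv.refl _)

/-- Renaming of the qubits. -/
def perm (π : Equiv.Perm QV) (C : Context QV) : Context QV where
  vars := C.vars.map π.toEmbedding
  state := ⟨C.state.mat.submatrix (permEquiv π C.vars) (permEquiv π C.vars),
    C.state.posSemidef.submatrix _, by
      rw [← C.state.trace_eq]
      exact (permEquiv π C.vars).sum_comp fun x => C.state.mat x x⟩

theorem entry_perm (π : Equiv.Perm QV) (C : Context QV) (x y : QV → Fin 2) :
    (C.perm π).entry x y = C.entry (x ∘ π) (y ∘ π) := rfl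

theorem entry_addZero (C : Context QV) (r : QV) (hr : r ∉ C.vars) (x y : QV → Fin 2) :
    (C.addZero r hr).entry x y = (if x r = 0 ∧ y r = 0 then 1 else 0) * C.entry x y := by
  simp only [entry, addZero, Matrix.submatrix_apply, Matrix.kroneckerMap_apply, consEquiv,
    Equiv.coe_fn_mk, Matrix.single_apply]
  congr 1
  simp only [eq_comm]

theorem perm_addZero (π : Equiv.Perm QV) (C : Context QV) (r : QV) (hr : r ∉ C.vars)
    (hr' : π r ∉ (C.perm π).vars) :
    (C.addZero r hr).perm π = (C.perm π).addZero (π r) hr' := by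
  refine eq_of_entry ?_ fun x y => ?_
  · simp [perm, addZero, Finset.map_insert]
  · rw [entry_perm, entry_addZero, entry_addZero, entry_perm]
    rfl

theorem ptrace_eq_sum_entry {S : Finset QV} {r : QV} (hr : r ∉ S) (σ : Density (insert r S))
    (x y : QV → Fin 2) : ptrace hr σ.mat (fun s => x s.1) (fun s => y s.1) =
      ∑ b : Fin 2, (⟨insert r S, σ⟩ : Context QV).entry (Function.update x r b)
        (Function.update y r b) := by
  have h : ∀ (b : Fin 2) (x : QV → Fin 2), (consEquiv hr).symm (b, fun s => x s.1) =
      fun s => Function.update x r b s.1 := by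
    intro b x
    funext s
    by_cases hs : s.1 = r
    · simp [consEquiv, hs, hr]
    · have : s.1 ∈ S := (Finset.mem_insert.1 s.2).resolve_left hs
      simp [consEquiv, hs, this]
  simp only [ptrace, Matrix.of_apply, h]
  rfl

theorem exists_perm_extension (π : Equiv.Perm QV) (C : Context QV) {r : QV} (hr : r ∉ C.vars)
    (hr' : π r ∉ (C.perm π).vars) (σ : Density (insert r C.vars))
    (hσ : ptrace hr σ.mat = C.state.mat) :
    ∃ σ' : Density (insert (π r) (C.perm π).vars),
      (⟨insert r C.vars, σ⟩ : Context QV).perm π = ⟨insert (π r) (C.perm π).vars, σ'⟩ ∧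
        ptrace hr' σ'.mat = (C.perm π).state.mat := by
  -- The renamed set of variables equals `insert (π r) _` only propositionally, so the state is
  -- transported along that equality.
  have key : ∀ (D : Context QV) (S : Finset QV), D.vars = S → ∃ σ' : Density S, D = ⟨S, σ'⟩ := by
    rintro D S rfl
    exact ⟨D.state, rfl⟩
  obtain ⟨σ', h⟩ := key ((⟨insert r C.vars, σ⟩ : Context QV).perm π)
    (insert (π r) (C.perm π).vars) (by simp [perm, Finset.map_insert])
  refine ⟨σ', h, ?_⟩
  ext x y
  obtain ⟨x, rfl⟩ := exists_extension x
  obtain ⟨y, rfl⟩ := exists_extension y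
  rw [ptrace_eq_sum_entry, ← h]
  change _ = (C.perm π).entry x y
  have hu : ∀ (x : QV → Fin 2) (b : Fin 2),
      Function.update x (π r) b ∘ π = Function.update (x ∘ π) r b := fun x b => by
    rw [Function.update_comp_equiv, Equiv.symm_apply_apply]
  simp only [entry_perm, hu]
  rw [← ptrace_eq_sum_entry hr, hσ]
  rfl

variable {k : ℕ}

/-- Assignments to the renamed qubits, as assignments to the original ones. -/
def varsEquiv (π : Equiv.Perm QV) (C : Context QV) :
    ((C.perm π).vars → Fin 2) ≃ (C.vars → Fin 2) :=
  permEquiv π C.vars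

theorem mat_perm (π : Equiv.Perm QV) (C : Context QV) :
    (C.perm π).state.mat = C.state.mat.submatrix (C.varsEquiv π) (C.varsEquiv π) := rfl

theorem embed_perm (π : Equiv.Perm QV) (C : Context QV) (r : Fin k ↪ QV) (h : ∀ i, r i ∈ C.vars)
    (h' : ∀ i, (r.trans π.toEmbedding) i ∈ (C.perm π).vars)
    (A : Matrix (Fin k → Fin 2) (Fin k → Fin 2) ℂ) :
    embed (r.trans π.toEmbedding) h' A =
      (embed r h A).submatrix (C.varsEquiv π) (C.varsEquiv π) := by
  ext x y
  simp only [embed, Matrix.of_apply, Matrix.submatrix_apply, varsEquiv]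
  refine if_congr ?_ rfl rfl
  constructor
  · intro H s hs
    exact H ⟨π s.1, _⟩ fun i => by simpa using hs i
  · rintro H ⟨s, hs⟩ hs'
    obtain ⟨t, ht, rfl⟩ := Finset.mem_map.1 hs
    exact H ⟨t, ht⟩ fun i => by simpa using hs' i

theorem eq_of_mat {S : Finset QV} {ρ σ : Density S} (h : ρ.mat = σ.mat) :
    (⟨S, ρ⟩ : Context QV) = ⟨S, σ⟩ := by
  cases ρ
  cases σ
  congr

theorem perm_applyUnitary (π : Equiv.Perm QV) (C : Context QV)
    (U : Matrix.unitaryGroup (Fin k → Fin 2) ℂ) (r : Fin k ↪ QV) (h : ∀ i, r i ∈ C.vars)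
    (h' : ∀ i, (r.trans π.toEmbedding) i ∈ (C.perm π).vars) :
    (C.applyUnitary U r h).perm π = (C.perm π).applyUnitary U (r.trans π.toEmbedding) h' := by
  refine eq_of_mat ?_
  change (embed r h U.1 * C.state.mat * (embed r h U.1).conjTranspose).submatrix
      (C.varsEquiv π) (C.varsEquiv π) =
    embed (r.trans π.toEmbedding) h' U.1 * (C.perm π).state.mat *
      (embed (r.trans π.toEmbedding) h' U.1).conjTranspose
  rw [embed_perm π C r h, mat_perm, Matrix.conjTranspose_submatrix, Matrix.submatrix_mul_equiv,
    Matrix.submatrix_mul_equiv]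

variable {M : Matrix (Fin k → Fin 2) (Fin k → Fin 2) ℂ} (hM : M.IsHermitian)

theorem outcomeProb_perm (π : Equiv.Perm QV) (C : Context QV) (r : Fin k ↪ QV)
    (h : ∀ i, r i ∈ C.vars) (h' : ∀ i, (r.trans π.toEmbedding) i ∈ (C.perm π).vars) (l : ℝ) :
    (C.perm π).outcomeProb hM (r.trans π.toEmbedding) h' l = C.outcomeProb hM r h l := by
  rw [outcomeProb, embed_perm π C r h, mat_perm, Matrix.submatrix_mul_equiv, outcomeProb]
  congr 1
  exact (C.varsEquiv π).sum_comp fun x => (embed r h (specProj hM l) * C.state.mat) x x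

theorem outcomeDist_perm (π : Equiv.Perm QV) (C : Context QV) (r : Fin k ↪ QV)
    (h : ∀ i, r i ∈ C.vars) (h' : ∀ i, (r.trans π.toEmbedding) i ∈ (C.perm π).vars) :
    (C.perm π).outcomeDist hM (r.trans π.toEmbedding) h' = C.outcomeDist hM r h := by
  ext l
  simp only [outcomeDist, PMF.ofFintype_apply]
  rw [outcomeProb_perm]

theorem collapse_perm (π : Equiv.Perm QV) (C : Context QV) (r : Fin k ↪ QV)
    (h : ∀ i, r i ∈ C.vars) (h' : ∀ i, (r.trans π.toEmbedding) i ∈ (C.perm π).vars) (l : ℝ) :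
    (C.perm π).collapse hM (r.trans π.toEmbedding) h' l =
      (C.collapse hM r h l).submatrix (C.varsEquiv π) (C.varsEquiv π) := by
  rw [collapse, collapse, embed_perm π C r h, mat_perm, Matrix.submatrix_mul_equiv,
    Matrix.submatrix_mul_equiv]

theorem perm_afterOutcome (π : Equiv.Perm QV) (C : Context QV) (r : Fin k ↪ QV)
    (h : ∀ i, r i ∈ C.vars) (h' : ∀ i, (r.trans π.toEmbedding) i ∈ (C.perm π).vars) (l : ℝ) :
    (C.afterOutcome hM r h l).perm π =
      (C.perm π).afterOutcome hM (r.trans π.toEmbedding) h' l := by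
  refine eq_of_mat ?_
  change (C.afterOutcome hM r h l).state.mat.submatrix (C.varsEquiv π) (C.varsEquiv π) =
    ((C.perm π).afterOutcome hM (r.trans π.toEmbedding) h' l).state.mat
  have hp := outcomeProb_perm hM π C r h h' l
  by_cases h0 : C.outcomeProb hM r h l = 0
  · have h0' : (C.perm π).outcomeProb hM (r.trans π.toEmbedding) h' l = 0 := by rw [hp, h0]
    simp only [afterOutcome, dif_pos h0, dif_pos h0', mat_perm]
  · simp only [afterOutcome, dif_neg h0, collapse_perm hM π C r h, hp,
      Matrix.submatrix_smul]
    rfl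

end Context

/-- Renaming of the qubits. -/
def Act.perm (π : Equiv.Perm QV) : Act QV CC QC → Act QV CC QC
  | inC c a => inC c a
  | outC c a => outC c a
  | inQ c r => inQ c (π r)
  | outQ c r => outQ c (π r)
  | tau => tau

/-- Renaming of the qubits. -/
def RawConf.perm (π : Equiv.Perm QV) (X : RawConf CV QV CC QC) : RawConf CV QV CC QC :=
  ⟨X.proc.perm π, X.ctx.perm π⟩

/-- No rule singles out a qubit name, and all operations on contexts commute with renaming. It is
needed because after a quantum input the residuals of equal expressions are renamed. -/
theorem Step.perm (π : Equiv.Perm QV) {X : RawConf CV QV CC QC} {α : Act QV CC QC}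
    {μ : PMF (RawConf CV QV CC QC)} (h : Step X α μ) :
    Step (X.perm π) (α.perm π) (μ.map (RawConf.perm π)) := by
  have hmem : ∀ {C : Context QV} {r : QV}, π r ∈ (C.perm π).vars ↔ r ∈ C.vars := fun {C r} =>
    Finset.mem_map' π.toEmbedding
  have hmem' : ∀ {E : Proc CV QV CC QC} {r : QV}, π r ∈ (E.perm π).qv ↔ r ∈ E.qv := fun {E r} => by
    rw [Proc.qv_perm]
    exact Finset.mem_map' π.toEmbedding
  have hin : ∀ α : Act QV CC QC, (α.perm π).IsQInput ↔ α.IsQInput := fun α => by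
    cases α <;> rfl
  induction h with
  | c_inp c x E C a =>
    rw [PMF.pure_map]
    simp only [RawConf.perm, Proc.subst₁, Proc.perm_subst]
    exact c_inp _ _ _ _ _
  | c_outp c e E C a h =>
    rw [PMF.pure_map]
    exact c_outp _ _ _ _ _ h
  | c_com_left E₁ E₁' E₂ E₂' C c a h₁ h₂ ih₁ ih₂ =>
    rw [PMF.pure_map] at *
    exact c_com_left _ _ _ _ _ _ _ ih₁ ih₂
  | c_com_right E₁ E₁' E₂ E₂' C c a h₁ h₂ ih₁ ih₂ =>
    rw [PMF.pure_map] at *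
    exact c_com_right _ _ _ _ _ _ _ ih₁ ih₂
  | q_new q E C r hr =>
    rw [PMF.pure_map]
    have hr' : π r ∉ (C.perm π).vars := by rwa [hmem]
    simp only [RawConf.perm, Proc.perm_qsubst, Context.perm_addZero π C r hr hr']
    exact q_new _ _ _ _ hr'
  | q_inp_fresh c q E C r hr σ hσ =>
    rw [PMF.pure_map]
    have hr' : π r ∉ (C.perm π).vars := by rwa [hmem]
    obtain ⟨σ', h1, h2⟩ := C.exists_perm_extension π hr hr' σ hσ
    simp only [RawConf.perm, Proc.perm_qsubst, h1]
    exact q_inp_fresh _ _ _ _ _ hr' _ h2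
  | q_inp_known c q E C r hr hr' =>
    rw [PMF.pure_map]
    simp only [RawConf.perm, Proc.perm_qsubst]
    refine q_inp_known _ _ _ _ _ (hmem.2 hr) ?_
    rw [Finset.mem_erase, hmem'] at *
    simpa using hr'
  | q_outp c q E C =>
    rw [PMF.pure_map]
    exact q_outp _ _ _ _
  | unit U r E C h =>
    rw [PMF.pure_map]
    have h' : ∀ i, (r.trans π.toEmbedding) i ∈ (C.perm π).vars := fun i => hmem.2 (h i)
    simp only [RawConf.perm, C.perm_applyUnitary π U r h h']
    exact unit _ _ _ _ _
  | meas M hM r x E C h =>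
    have h' : ∀ i, (r.trans π.toEmbedding) i ∈ (C.perm π).vars := fun i => hmem.2 (h i)
    have := meas M hM (r.trans π.toEmbedding) x (E.perm π) (C.perm π) h'
    rw [PMF.map_comp]
    rw [Context.outcomeDist_perm hM π C r h h'] at this
    have h2 : (RawConf.perm π ∘ fun l : Outcome hM =>
        (⟨E.subst₁ x l.1, C.afterOutcome hM r h l.1⟩ : RawConf CV QV CC QC)) =
        fun l => ⟨(E.perm π).subst₁ x l.1,
          (C.perm π).afterOutcome hM (r.trans π.toEmbedding) h' l.1⟩ := by
      funext l
      simp only [Function.comp_apply, RawConf.perm, Proc.subst₁, Proc.perm_subst,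
        C.perm_afterOutcome hM π r h h']
    rw [h2]
    exact this
  | q_com_left E₁ E₁' E₂ E₂' C c a h₁ h₂ ih₁ ih₂ =>
    rw [PMF.pure_map] at *
    exact q_com_left _ _ _ _ _ _ _ ih₁ ih₂
  | q_com_right E₁ E₁' E₂ E₂' C c a h₁ h₂ ih₁ ih₂ =>
    rw [PMF.pure_map] at *
    exact q_com_right _ _ _ _ _ _ _ ih₁ ih₂
  | inp_int_left E₁ E₁' E₂ C C' c r hr h ih =>
    rw [PMF.pure_map] at *
    exact inp_int_left _ _ _ _ _ _ _ (by rwa [hmem']) ih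
  | inp_int_right E₁ E₂ E₂' C C' c r hr h ih =>
    rw [PMF.pure_map] at *
    exact inp_int_right _ _ _ _ _ _ _ (by rwa [hmem']) ih
  | oth_int_left E₁ E₂ C α μ hα h ih =>
    have := oth_int_left _ (E₂.perm π) _ _ _ (by rwa [hin]) ih
    rw [PMF.map_comp] at *
    exact this
  | oth_int_right E₁ E₂ C α μ hα h ih =>
    have := oth_int_right (E₁.perm π) _ _ _ _ (by rwa [hin]) ih
    rw [PMF.map_comp] at *
    exact this
  | sum_left E F C α μ h ih => exact sum_left _ _ _ _ _ ih
  | sum_right E F C α μ h ih => exact sum_right _ _ _ _ _ ih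
  | rel E f C α μ h ih =>
    have := rel _ f _ _ _ ih
    rw [PMF.map_comp] at *
    have hα : (α.relabel f).perm π = (α.perm π).relabel f := by cases α <;> rfl
    rw [hα]
    exact this
  | res E L C α μ hα h ih =>
    have := res _ L _ _ _ (by cases α <;> exact hα) ih
    rw [PMF.map_comp] at *
    exact this
  | cho b E C α μ hb h ih => exact cho _ _ _ _ _ hb ih

end QCCS

/-! ### Bisimilarity is invariant under renaming -/

namespace QCCS

variable {CV : Type u} {QV : Type v} {CC : Type w} {QC : Type z} [DecidableEq CV] [DecidableEq QV]

section Renaming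

theorem Context.perm_perm (σ π : Equiv.Perm QV) (C : Context QV) :
    (C.perm σ).perm π = C.perm (π * σ) := by
  refine eq_of_entry ?_ fun x y => rfl
  simp only [perm, Finset.map_map]
  rfl

theorem Context.perm_one (C : Context QV) : C.perm 1 = C := by
  refine eq_of_entry ?_ fun x y => rfl
  exact Finset.map_refl

theorem Act.perm_perm (σ π : Equiv.Perm QV) (α : Act QV CC QC) :
    (α.perm σ).perm π = α.perm (π * σ) := by
  cases α <;> rfl

theorem Act.perm_one (α : Act QV CC QC) : α.perm 1 = α := by
  cases α <;> rfl

theorem Act.hat_perm (π : Equiv.Perm QV) (α : Act QV CC QC) :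
    (α.perm π).hat = α.hat.map (Act.perm π) := by
  cases α <;> rfl

theorem RawConf.IsConf.perm {X : RawConf CV QV CC QC} (h : X.IsConf) (π : Equiv.Perm QV) :
    (X.perm π).IsConf := by
  refine ⟨(Proc.wf_perm π _).2 h.1, ?_⟩
  change (X.proc.perm π).qv ⊆ X.ctx.vars.map π.toEmbedding
  rw [Proc.qv_perm]
  exact Finset.map_subset_map.2 h.2

/-- Renaming of the qubits. -/
def permCon (π : Equiv.Perm QV) (X : Con CV QV CC QC) : Con CV QV CC QC :=
  ⟨X.1.perm π, X.2.perm π⟩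

theorem permCon_permCon (σ π : Equiv.Perm QV) (X : Con CV QV CC QC) :
    permCon π (permCon σ X) = permCon (π * σ) X :=
  Subtype.ext <| by
    simp only [permCon, RawConf.perm, Proc.perm_perm, Context.perm_perm]

theorem permCon_one (X : Con CV QV CC QC) : permCon 1 X = X :=
  Subtype.ext <| by
    simp only [permCon, RawConf.perm, Proc.perm_one, Context.perm_one]

theorem permCon_injective (π : Equiv.Perm QV) :
    Function.Injective (permCon (CV := CV) (CC := CC) (QC := QC) π) := by
  refine Function.LeftInverse.injective (g := permCon π⁻¹) fun X => ?_
  rw [permCon_permCon, inv_mul_cancel, permCon_one]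

theorem PTrans.perm (π : Equiv.Perm QV) {X : Con CV QV CC QC} {α : Act QV CC QC}
    {μ : PMF (Con CV QV CC QC)} (h : PTrans X α μ) :
    PTrans (permCon π X) (α.perm π) (μ.map (permCon π)) := by
  have := Step.perm π h
  rw [PMF.map_comp] at this
  unfold PTrans
  rw [PMF.map_comp]
  exact this

theorem Stuck.perm (π : Equiv.Perm QV) {X : Con CV QV CC QC} (h : Stuck X) :
    Stuck (permCon π X) := by
  intro α μ hμ
  have := hμ.perm π⁻¹
  rw [permCon_permCon, inv_mul_cancel, permCon_one] at this
  exact h _ _ this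

/-- The inverse image of `≈` under renaming by `π⁻¹` is a weak bisimulation, since transitions can
be renamed in both directions. -/
theorem WeakBisimilar.perm (π : Equiv.Perm QV) {X Y : Con CV QV CC QC} (h : WeakBisimilar X Y) :
    WeakBisimilar (permCon π X) (permCon π Y) := by
  refine ⟨fun A B => WeakBisimilar (permCon π⁻¹ A) (permCon π⁻¹ B), isWeakBisim_iff.2
    ⟨weakBisimilar_equivalence.comap _, fun A B hAB => ⟨fun α μ hμ => ?_, fun hA hB => ?_⟩⟩, ?_⟩
  · obtain ⟨ν, h1, h2⟩ :=
      ((isWeakBisim_iff.1 weakBisimilar_isWeakBisim).2 _ _ hAB).1 _ _ (hμ.perm π⁻¹)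
    have h3 := h1.map (T' := PTrans) (permCon_injective π) (h := Act.perm π) rfl
      (J := fun _ => True) trivial (fun _ _ _ _ h => h.perm π) fun _ _ => trivial
    rw [← Act.hat_perm, Act.perm_perm, permCon_permCon, mul_inv_cancel, permCon_one,
      Act.perm_one] at h3
    refine ⟨_, h3, ?_⟩
    have h4 : ν = (ν.map (permCon π)).map (permCon π⁻¹) := by
      rw [PMF.map_comp]
      conv_lhs => rw [← ν.map_id]
      congr 1
      funext Z
      rw [Function.comp_apply, permCon_permCon, inv_mul_cancel, permCon_one]
      rfl
    rw [h4] at h2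
    exact h2.of_map
  · have h1 := (weakBisimilar_isWeakBisim.2 _ _ hAB).2 (hA.perm π⁻¹) (hB.perm π⁻¹)
    have h2 := congrArg (Context.perm π) h1
    simpa only [permCon, RawConf.perm, Context.perm_perm, mul_inv_cancel, Context.perm_one]
      using h2
  · simpa only [permCon_permCon, inv_mul_cancel, permCon_one] using h

end Renaming

/-! ### Prefixes and sums -/

section Prefixes

/-- Weak bisimilarity of raw configurations, where they are configurations. -/
def RawBisim (x y : RawConf CV QV CC QC) : Prop :=
  ∀ hx hy, WeakBisimilar (⟨x, hx⟩ : Con CV QV CC QC) ⟨y, hy⟩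

variable {P Q : Proc CV QV CC QC}

theorem ProcEq.symm (h : ProcEq P Q) : ProcEq Q P := by
  intro C hQ hP
  have := conEq_iff.1 (h C hP hQ)
  exact conEq_iff.2 ⟨this.2.1, this.1, fun _ _ => rfl⟩

theorem ProcEq.rawBisim (h : ProcEq P Q) (C : Context QV) : RawBisim ⟨P, C⟩ ⟨Q, C⟩ :=
  fun hP hQ => (h C hP hQ).weakBisimilar

/-- The renamed expression in `C` is the renaming of the original in `C.perm π⁻¹`, a context that
equality of processes covers too. -/
theorem ProcEq.rawBisim_perm (h : ProcEq P Q) (π : Equiv.Perm QV) (C : Context QV) :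
    RawBisim ⟨P.perm π, C⟩ ⟨Q.perm π, C⟩ := by
  intro hP hQ
  have hback : ∀ P : Proc CV QV CC QC,
      RawConf.perm π⁻¹ ⟨P.perm π, C⟩ = ⟨P, C.perm π⁻¹⟩ := fun P => by
    simp only [RawConf.perm, Proc.perm_perm, inv_mul_cancel, Proc.perm_one]
  have hP' := hP.perm π⁻¹
  have hQ' := hQ.perm π⁻¹
  rw [hback] at hP' hQ'
  have := (h.rawBisim _ hP' hQ').perm π
  simpa only [permCon, RawConf.perm, Context.perm_perm, mul_inv_cancel, Context.perm_one]
    using this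

/-- For prefixes a single transition answers a single transition, and only the residuals have to be
compared. -/
theorem strictMatch_of_step {X Y : Con CV QV CC QC}
    (h : ∀ α m, Step X.1 α m → ∃ n, Step Y.1 α n ∧ PMF.Coupled RawBisim m n) :
    StrictMatch X Y := by
  intro α μ hμ
  obtain ⟨n, h1, h2⟩ := h α _ hμ
  obtain ⟨ν, rfl, hν⟩ := exists_pTrans_of_step h1
  exact ⟨ν, Weak.single hν, h2.of_map.mono fun a _ b _ hab => hab a.2 b.2⟩

/-- An operator on expressions respects equality if, for a symmetric relation between its
arguments, the transitions of the resulting expressions match. -/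
theorem procEq_of_strictMatch {r : Proc CV QV CC QC → Proc CV QV CC QC → Prop}
    (hr : ∀ P Q, r P Q → r Q P) {f : Proc CV QV CC QC → Proc CV QV CC QC}
    (hf : ∀ P Q, r P Q → ∀ C (hP : RawConf.IsConf ⟨f P, C⟩) (hQ : RawConf.IsConf ⟨f Q, C⟩),
      StrictMatch ⟨⟨f P, C⟩, hP⟩ ⟨⟨f Q, C⟩, hQ⟩)
    (h : r P Q) : ProcEq (f P) (f Q) := fun C hP hQ =>
  conEq_iff.2 ⟨hf P Q h C hP hQ, hf Q P (hr _ _ h) C hQ hP, fun _ _ => rfl⟩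

theorem procEq_inC (c : CC) (x : CV) (h : ∀ a, ProcEq (P.subst₁ x a) (Q.subst₁ x a)) :
    ProcEq (.inC c x P) (.inC c x Q) := by
  refine procEq_of_strictMatch (f := .inC c x)
    (r := fun P Q => ∀ a, ProcEq (P.subst₁ x a) (Q.subst₁ x a))
    (fun P Q h a => (h a).symm) (fun P Q h C hP hQ => strictMatch_of_step fun α m hm => ?_) h
  cases hm with
  | c_inp _ _ _ _ a => exact ⟨_, Step.c_inp _ _ _ _ a, PMF.Coupled.pure ((h a).rawBisim C)⟩

theorem ProcEq.outC (c : CC) (e : Exp CV) (h : ProcEq P Q) :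
    ProcEq (.outC c e P) (.outC c e Q) := by
  refine procEq_of_strictMatch (f := .outC c e) (r := ProcEq) (fun P Q h => h.symm)
    (fun P Q h C hP hQ => strictMatch_of_step fun α m hm => ?_) h
  cases hm with
  | c_outp _ _ _ _ a ha =>
    exact ⟨_, Step.c_outp _ _ _ _ a ha, PMF.Coupled.pure (h.rawBisim C)⟩

theorem ProcEq.inQ (c : QC) (q : QV) (hq : P.qv.erase q = Q.qv.erase q) (h : ProcEq P Q) :
    ProcEq (.inQ c q P) (.inQ c q Q) := by
  refine procEq_of_strictMatch (f := .inQ c q)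
    (r := fun P Q => P.qv.erase q = Q.qv.erase q ∧ ProcEq P Q)
    (fun P Q h => ⟨h.1.symm, h.2.symm⟩)
    (fun P Q h C hP hQ => strictMatch_of_step fun α m hm => ?_) ⟨hq, h⟩
  cases hm with
  | q_inp_fresh _ _ _ _ r hr σ hσ =>
    exact ⟨_, Step.q_inp_fresh _ _ _ _ r hr σ hσ, PMF.Coupled.pure (h.2.rawBisim_perm _ _)⟩
  | q_inp_known _ _ _ _ r hr hr' =>
    -- Equal free variables apart from `q` let both sides receive the same known qubits.
    exact ⟨_, Step.q_inp_known _ _ _ _ r hr (h.1 ▸ hr'), PMF.Coupled.pure (h.2.rawBisim_perm _ _)⟩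

theorem ProcEq.outQ (c : QC) (q : QV) (h : ProcEq P Q) :
    ProcEq (.outQ c q P) (.outQ c q Q) := by
  refine procEq_of_strictMatch (f := .outQ c q) (r := ProcEq) (fun P Q h => h.symm)
    (fun P Q h C hP hQ => strictMatch_of_step fun α m hm => ?_) h
  cases hm with
  | q_outp => exact ⟨_, Step.q_outp _ _ _ _, PMF.Coupled.pure (h.rawBisim C)⟩

theorem ProcEq.unit {k : ℕ} (U : Matrix.unitaryGroup (Fin k → Fin 2) ℂ) (q : Fin k ↪ QV)
    (h : ProcEq P Q) : ProcEq (.unit U q P) (.unit U q Q) := by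
  refine procEq_of_strictMatch (f := .unit U q) (r := ProcEq) (fun P Q h => h.symm)
    (fun P Q h C hP hQ => strictMatch_of_step fun α m hm => ?_) h
  cases hm with
  | unit _ _ _ _ h' => exact ⟨_, Step.unit _ _ _ _ h', PMF.Coupled.pure (h.rawBisim _)⟩

theorem procEq_meas {k : ℕ} {M : Matrix (Fin k → Fin 2) (Fin k → Fin 2) ℂ} (hM : M.IsHermitian)
    (q : Fin k ↪ QV) (x : CV) (h : ∀ a, ProcEq (P.subst₁ x a) (Q.subst₁ x a)) :
    ProcEq (.meas M hM q x P) (.meas M hM q x Q) := by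
  refine procEq_of_strictMatch (f := .meas M hM q x)
    (r := fun P Q => ∀ a, ProcEq (P.subst₁ x a) (Q.subst₁ x a))
    (fun P Q h a => (h a).symm) (fun P Q h C hP hQ => strictMatch_of_step fun α m hm => ?_) h
  cases hm with
  | meas _ _ _ _ _ _ h' =>
    -- Both sides measure the same state, so the outcomes are coupled by equality.
    exact ⟨_, Step.meas _ _ _ _ _ _ h', PMF.Coupled.of_map_same fun l _ => (h l.1).rawBisim _⟩

/-- An answer with string `[α]` contains at least one transition, and the sum can make its first
one. A bisimilarity answer might be empty and would not resolve the choice. -/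
theorem ProcEq.sum (G : Proc CV QV CC QC) (h : ProcEq P Q) : ProcEq (.sum P G) (.sum Q G) := by
  refine procEq_of_strictMatch (f := fun P => .sum P G) (r := ProcEq) (fun P Q h => h.symm)
    (fun P Q h C hP hQ α μ hμ => ?_) h
  have hP' : RawConf.IsConf ⟨P, C⟩ := ⟨hP.1.1, (Finset.union_subset_iff.1 hP.2).1⟩
  have hQ' : RawConf.IsConf ⟨Q, C⟩ := ⟨hQ.1.1, (Finset.union_subset_iff.1 hQ.2).1⟩
  unfold PTrans at hμ
  generalize hm : μ.map Subtype.val = m at hμ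
  cases hμ with
  | sum_left _ _ _ _ _ h1 =>
    subst hm
    obtain ⟨ν, h2, h3⟩ := (conEq_iff.1 (h C hP' hQ')).1 α μ h1
    have hstep : ∀ β κ, PTrans (⟨⟨Q, C⟩, hQ'⟩ : Con CV QV CC QC) β κ →
        PTrans (⟨⟨.sum Q G, C⟩, hQ⟩ : Con CV QV CC QC) β κ :=
      fun β κ h4 => Step.sum_left _ _ _ _ _ h4
    exact ⟨ν, h2.of_transitions hstep (by simp), h3⟩
  | sum_right _ _ _ _ _ h1 =>
    subst hm
    exact ⟨μ, Weak.single (Step.sum_right _ _ _ _ _ h1), PMF.Coupled.refl weakBisimilar_refl μ⟩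

end Prefixes

/-! ### Relabeling -/

section Relabel

theorem Act.hat_relabel (f : Relabeling CC QC) (α : Act QV CC QC) :
    (α.relabel f).hat = α.hat.map (Act.relabel f) := by
  cases α <;> rfl

/-- The configuration with relabeled expression. -/
def relCon (f : Relabeling CC QC) (X : Con CV QV CC QC) : Con CV QV CC QC :=
  ⟨⟨.rel X.1.proc f, X.1.ctx⟩, X.2⟩

theorem relCon_injective (f : Relabeling CC QC) :
    Function.Injective (relCon (CV := CV) (QV := QV) f) := by
  rintro ⟨⟨E, C⟩, hE⟩ ⟨⟨F, D⟩, hF⟩ h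
  have h' := congrArg Subtype.val h
  simpa [relCon] using h'

theorem PTrans.relCon (f : Relabeling CC QC) {X : Con CV QV CC QC} {α : Act QV CC QC}
    {μ : PMF (Con CV QV CC QC)} (h : PTrans X α μ) :
    PTrans (relCon f X) (α.relabel f) (μ.map (relCon f)) := by
  have := Step.rel _ f _ _ _ h
  unfold PTrans
  rw [PMF.map_comp] at *
  exact this

theorem pTrans_relCon {f : Relabeling CC QC} {X : Con CV QV CC QC} {β : Act QV CC QC}
    {κ : PMF (Con CV QV CC QC)} (h : PTrans (relCon f X) β κ) :
    ∃ α μ, PTrans X α μ ∧ β = α.relabel f ∧ κ = μ.map (relCon f) := by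
  unfold PTrans at h
  generalize hm : κ.map Subtype.val = m at h
  cases h with
  | rel _ _ _ α m₀ h =>
    obtain ⟨μ, rfl, hμ⟩ := exists_pTrans_of_step (X := X) h
    refine ⟨α, μ, hμ, rfl, PMF.map_injective Subtype.val_injective ?_⟩
    rw [hm, PMF.map_comp, PMF.map_comp]
    rfl

theorem Weak.relCon (f : Relabeling CC QC) {X : Con CV QV CC QC} {s : List (Act QV CC QC)}
    {μ : PMF (Con CV QV CC QC)} (h : Weak PTrans .tau X s μ) :
    Weak PTrans .tau (relCon f X) (s.map (Act.relabel f)) (μ.map (relCon f)) :=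
  h.map (relCon_injective f) rfl (J := fun _ => True) trivial (fun _ _ _ _ h => h.relCon f)
    fun _ _ => trivial

/-- The witness is the set of relabeled bisimilar pairs, with the diagonal added for reflexivity; it
is transitive because relabeling is injective on configurations. -/
theorem WeakBisimilar.relCon (f : Relabeling CC QC) {X Y : Con CV QV CC QC}
    (h : WeakBisimilar X Y) : WeakBisimilar (relCon f X) (relCon f Y) := by
  refine ⟨fun A B => A = B ∨ ∃ X Y, WeakBisimilar X Y ∧ A = QCCS.relCon f X ∧ B = QCCS.relCon f Y,
    isWeakBisim_iff.2 ⟨⟨fun A => .inl rfl, ?_, ?_⟩, ?_⟩, .inr ⟨X, Y, h, rfl, rfl⟩⟩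
  · rintro A B (rfl | ⟨X, Y, h, rfl, rfl⟩)
    · exact .inl rfl
    · exact .inr ⟨Y, X, h.symm, rfl, rfl⟩
  · rintro A B C (rfl | ⟨X, Y, h, rfl, rfl⟩) (rfl | ⟨X', Y', h', h1, rfl⟩)
    · exact .inl rfl
    · exact .inr ⟨X', Y', h', h1, rfl⟩
    · exact .inr ⟨X, Y, h, rfl, rfl⟩
    · obtain rfl := relCon_injective f h1
      exact .inr ⟨X, Y', h.trans h', rfl, rfl⟩
  · rintro A B (rfl | ⟨X, Y, h, rfl, rfl⟩)
    · exact ⟨fun α μ hμ => ⟨μ, (Weak.single hμ).hat, PMF.Coupled.refl (fun _ => .inl rfl) μ⟩,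
        fun _ _ => rfl⟩
    · refine ⟨fun β κ hκ => ?_, fun hX hY => ?_⟩
      · obtain ⟨α, μ, hμ, rfl, rfl⟩ := pTrans_relCon hκ
        obtain ⟨ν, h1, h2⟩ := ((isWeakBisim_iff.1 weakBisimilar_isWeakBisim).2 _ _ h).1 _ _ hμ
        refine ⟨_, ?_, h2.map fun a b hab => .inr ⟨a, b, hab, rfl, rfl⟩⟩
        rw [Act.hat_relabel]
        exact h1.relCon f
      · exact (weakBisimilar_isWeakBisim.2 _ _ h).2 (fun α μ hμ => hX _ _ (hμ.relCon f))
          fun α μ hμ => hY _ _ (hμ.relCon f)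

theorem ProcEq.rel {P Q : Proc CV QV CC QC} (f : Relabeling CC QC) (h : ProcEq P Q) :
    ProcEq (.rel P f) (.rel Q f) := by
  refine procEq_of_strictMatch (f := fun P => .rel P f) (r := ProcEq) (fun P Q h => h.symm)
    (fun P Q h C hP hQ β κ hκ => ?_) h
  obtain ⟨α, μ, hμ, rfl, rfl⟩ := pTrans_relCon (f := f) (X := ⟨⟨P, C⟩, hP⟩) hκ
  obtain ⟨ν, h1, h2⟩ := (conEq_iff.1 (h C hP hQ)).1 _ _ hμ
  exact ⟨_, h1.relCon f, h2.map fun a b hab => hab.relCon f⟩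

end Relabel

end QCCS

/-! ### Parallel composition with a classical expression -/

namespace QCCS

variable {CV : Type u} {QV : Type v} {CC : Type w} {QC : Type z} [DecidableEq CV] [DecidableEq QV]

/-- Parallel composition with `G`. -/
def parRaw (G : Proc CV QV CC QC) (x : RawConf CV QV CC QC) : RawConf CV QV CC QC :=
  ⟨.par x.proc G, x.ctx⟩

theorem parRaw_injective (G : Proc CV QV CC QC) : Function.Injective (parRaw G) := by
  rintro ⟨E, C⟩ ⟨F, D⟩ h
  simpa [parRaw] using h

/-- Beside `G` an arbitrary configuration need not form a configuration, so weak transitions are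
composed with `G` on raw pairs and brought back by `Weak.ofRaw`. -/
theorem Weak.toRaw {X : Con CV QV CC QC} {s : List (Act QV CC QC)} {μ : PMF (Con CV QV CC QC)}
    (h : Weak PTrans .tau X s μ) : Weak Step .tau X.1 s (μ.map Subtype.val) := by
  have := h.map (T' := Step) Subtype.val_injective (h := id) rfl (J := fun _ => True) trivial
    (fun _ _ _ _ h => h) fun _ _ => trivial
  rwa [List.map_id] at this

theorem Weak.ofRaw {X : Con CV QV CC QC} {s : List (Act QV CC QC)}
    {m : PMF (RawConf CV QV CC QC)} (h : Weak Step .tau X.1 s m) :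
    ∃ μ : PMF (Con CV QV CC QC), m = μ.map Subtype.val ∧ Weak PTrans .tau X s μ :=
  h.restrict (P := RawConf.IsConf) (fun _ _ _ hX h Y hY => (h.isConf_and_qv hX Y hY).1) X.2

/-- Interleaving of a weak transition with an inactive right component. -/
theorem Weak.par {x : RawConf CV QV CC QC} {s : List (Act QV CC QC)}
    {m : PMF (RawConf CV QV CC QC)} (h : Weak Step .tau x s m) (G : Proc CV QV CC QC)
    (hs : ∀ c r, .inQ c r ∈ s → r ∉ G.qv) :
    Weak Step .tau (parRaw G x) s (m.map (parRaw G)) := by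
  have := h.map (T' := Step) (parRaw_injective G) (h := id) rfl
    (J := fun α => ∀ c r, α = .inQ c r → r ∉ G.qv) (by simp) ?_
    fun α hα c r h => hs c r (h ▸ hα)
  · rwa [List.map_id] at this
  · intro X α μ hα hX
    by_cases hin : α.IsQInput
    · obtain ⟨c, r, rfl⟩ : ∃ c r, α = .inQ c r := by
        cases α <;> first | exact ⟨_, _, rfl⟩ | exact absurd hin id
      obtain ⟨Y, rfl, -⟩ := hX.exists_eq_pure (by simp)
      rw [PMF.pure_map]
      exact Step.inp_int_left _ _ _ _ _ _ _ (hα c r rfl) hX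
    · exact Step.oth_int_left _ _ _ _ _ hin hX

/-- Synchronization of the visible action of a weak transition with a transition of the right
component from `G` to `G'`. -/
theorem Weak.synchronize {x : RawConf CV QV CC QC} {α : Act QV CC QC}
    {m : PMF (RawConf CV QV CC QC)} (h : Weak Step .tau x [α] m)
    {G G' : Proc CV QV CC QC} (hG : G.qv ⊆ x.ctx.vars)
    (hsync : ∀ y n, G.qv ⊆ y.ctx.vars → Step y α n →
      Step (parRaw G y) .tau (n.map (parRaw G'))) :
    Weak Step .tau (parRaw G x) [.tau] (m.map (parRaw G')) := by
  generalize hs : [α] = s at h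
  induction h with
  | halt X => simp at hs
  | tau X μ s k h hk ih =>
    rw [PMF.map_bind]
    -- Before the synchronization `G` waits; contexts only grow, so they still contain its qubits.
    exact Weak.tau_map (parRaw_injective G)
      (Step.oth_int_left _ _ _ _ _ (fun h => h) h)
      fun Y hY => ih Y hY (hG.trans (h.vars_subset Y hY)) hs
  | act X β μ s k h hk ih =>
    obtain ⟨rfl, rfl⟩ := List.cons.inj hs
    rw [PMF.map_bind]
    -- The synchronization is the demanded `τ`; after it only invisible moves beside `G'` remain.
    exact Weak.act_map (parRaw_injective G') (hsync X μ hG h)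
      fun Y hY => (hk Y hY).par G' (by simp)
  | mix X s p hp hk ih =>
    rw [PMF.map_bind]
    exact Weak.mix_map p hp _ fun ν hν => ih ν hν hG hs

/-- The relation between parallel compositions of weakly bisimilar configurations with the same
classical expression. -/
def ParRel (x y : RawConf CV QV CC QC) : Prop :=
  x = y ∨ ∃ (X Y : Con CV QV CC QC) (G : Proc CV QV CC QC), WeakBisimilar X Y ∧ G.Classical ∧
    x = parRaw G X.1 ∧ y = parRaw G Y.1

theorem parRel_equivalence : Equivalence (ParRel (CV := CV) (QV := QV) (CC := CC) (QC := QC)) := by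
  refine ⟨fun _ => .inl rfl, ?_, ?_⟩
  · rintro x y (rfl | ⟨X, Y, G, h, hG, rfl, rfl⟩)
    · exact .inl rfl
    · exact .inr ⟨Y, X, G, h.symm, hG, rfl, rfl⟩
  · rintro x y z (rfl | ⟨X, Y, G, h, hG, rfl, rfl⟩) (rfl | ⟨X', Y', G', h', hG', h1, rfl⟩)
    · exact .inl rfl
    · exact .inr ⟨X', Y', G', h', hG', h1, rfl⟩
    · exact .inr ⟨X, Y, G, h, hG, rfl, rfl⟩
    · have h2 : G = G' := by
        have h2 := congrArg RawConf.proc h1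
        simp only [parRaw, Proc.par.injEq] at h2
        exact h2.2
      subst h2
      obtain rfl := Subtype.ext (parRaw_injective G h1)
      exact .inr ⟨X, Y', G, h.trans h', hG, rfl, rfl⟩

/-- The parameter `str` treats bisimilarity (`Act.hat`) and equality (`[α]`) at once. Classicality
lets `G` repeat its part of a move in whatever context the answering side has reached. -/
theorem parRaw_match {X Y A B : Con CV QV CC QC} {G : Proc CV QV CC QC} (hG : G.Classical)
    (hA : A.1 = parRaw G X.1) (hB : B.1 = parRaw G Y.1) (hXY : WeakBisimilar X Y)
    {str : Act QV CC QC → List (Act QV CC QC)} (hstr : str = Act.hat ∨ str = fun α => [α])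
    (hm : ∀ α μ, PTrans X α μ →
      ∃ ν, Weak PTrans .tau Y (str α) ν ∧ PMF.Coupled WeakBisimilar μ ν) :
    ∀ α κ, PTrans A α κ → ∃ ν, Weak PTrans .tau B (str α) ν ∧
      PMF.Coupled (fun A B => ParRel A.1 B.1) κ ν := by
  have hs_vis : ∀ α, α ≠ .tau → str α = [α] := by
    rcases hstr with rfl | rfl
    · exact fun α => Act.hat_of_ne_tau
    · exact fun _ _ => rfl
  have hs_mem : ∀ α, ∀ β ∈ str α, β = α := by
    rcases hstr with rfl | rfl
    · intro α β hβ
      cases α <;> simp_all [Act.hat]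
    · simp
  have hs_weak : ∀ {x : RawConf CV QV CC QC} {α n}, Weak Step .tau x [α] n →
      Weak Step .tau x (str α) n := by
    rcases hstr with rfl | rfl
    · exact fun h => h.hat
    · exact fun h => h
  have hqv : G.qv ⊆ Y.1.ctx.vars := by
    have := B.2.2
    rw [hB] at this
    exact (Finset.union_subset_iff.1 this).2
  intro α κ hκ
  suffices H : ∃ n, Weak Step .tau B.1 (str α) n ∧
      PMF.Coupled ParRel (κ.map Subtype.val) n by
    obtain ⟨n, h1, h2⟩ := H
    obtain ⟨ν, rfl, hν⟩ := h1.ofRaw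
    exact ⟨ν, hν, h2.of_map⟩
  unfold PTrans at hκ
  generalize κ.map Subtype.val = m at hκ ⊢
  rw [hB]
  have hpar : ∀ {μ ν : PMF (Con CV QV CC QC)} {G' : Proc CV QV CC QC}, G'.Classical →
      PMF.Coupled WeakBisimilar μ ν → PMF.Coupled ParRel ((μ.map Subtype.val).map (parRaw G'))
        ((ν.map Subtype.val).map (parRaw G')) := by
    intro μ ν G' hG' h
    rw [PMF.map_comp, PMF.map_comp]
    exact h.map fun a b hab => .inr ⟨a, b, G', hab, hG', rfl, rfl⟩
  have hleft : ∀ {α m}, Step X.1 α m → (∀ c r, α = .inQ c r → r ∉ G.qv) →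
      ∃ n, Weak Step .tau (parRaw G Y.1) (str α) n ∧
        PMF.Coupled ParRel (m.map (parRaw G)) n := by
    intro α m h hα
    obtain ⟨μ, rfl, hμ⟩ := exists_pTrans_of_step h
    obtain ⟨ν, h1, h2⟩ := hm α μ hμ
    exact ⟨_, h1.toRaw.par G fun c r hr => hα c r (hs_mem _ _ hr).symm, hpar hG h2⟩
  have hcom : ∀ {α m} {G' : Proc CV QV CC QC}, α ≠ .tau → G'.Classical → Step X.1 α m →
      (∀ y n, G.qv ⊆ y.ctx.vars → Step y α n → Step (parRaw G y) .tau (n.map (parRaw G'))) →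
      ∃ n, Weak Step .tau (parRaw G Y.1) (str .tau) n ∧
        PMF.Coupled ParRel (m.map (parRaw G')) n := by
    intro α m G' hα hG' h hsync
    obtain ⟨μ, rfl, hμ⟩ := exists_pTrans_of_step h
    obtain ⟨ν, h1, h2⟩ := hm α μ hμ
    rw [hs_vis α hα] at h1
    exact ⟨_, hs_weak (h1.toRaw.synchronize hqv hsync), hpar hG' h2⟩
  have hpure : ∀ {A B : Proc CV QV CC QC} {C C' : Context QV},
      PMF.pure (⟨A, C⟩ : RawConf CV QV CC QC) = PMF.pure ⟨B, C'⟩ → A = B := by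
    intro A B C C' h
    have h2 := congrArg PMF.support h
    simp only [PMF.support_pure, Set.singleton_eq_singleton_iff, RawConf.mk.injEq] at h2
    exact h2.1
  obtain ⟨⟨E, C⟩, hE⟩ := X
  rw [hA] at hκ
  cases hκ with
  | c_com_left _ E' _ G' _ c a h₁ h₂ =>
    obtain ⟨G'', h3, h4, -, h5⟩ := h₂.classical hG
    obtain rfl := hpure h3
    have := hcom (α := .inC c a) (by simp) h4 h₁ fun y n hy h => by
      obtain ⟨⟨Z, D⟩, rfl, hZ⟩ := h.exists_eq_pure (by simp)
      obtain rfl : D = y.ctx := hZ (by simp)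
      rw [PMF.pure_map]
      exact Step.c_com_left _ _ _ _ _ c a h (h5 _)
    rwa [PMF.pure_map] at this
  | c_com_right _ E' _ G' _ c a h₁ h₂ =>
    obtain ⟨G'', h3, h4, -, h5⟩ := h₂.classical hG
    obtain rfl := hpure h3
    have := hcom (α := .outC c a) (by simp) h4 h₁ fun y n hy h => by
      obtain ⟨⟨Z, D⟩, rfl, hZ⟩ := h.exists_eq_pure (by simp)
      obtain rfl : D = y.ctx := hZ (by simp)
      rw [PMF.pure_map]
      exact Step.c_com_right _ _ _ _ _ c a h (h5 _)
    rwa [PMF.pure_map] at this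
  | q_com_left _ E' _ G' _ c r h₁ h₂ =>
    obtain ⟨G'', h3, h4, -, h5⟩ := h₂.classical hG
    obtain rfl := hpure h3
    -- The qubit that `G` sends is in every context of the answer, so receiving it leaves the
    -- context unchanged, as synchronization demands.
    have hr : r ∈ G.qv := h₂.outQ_mem_qv rfl
    have := hcom (α := .inQ c r) (by simp) h4 h₁ fun y n hy h => by
      obtain ⟨⟨Z, D⟩, rfl, hZ⟩ := h.exists_eq_pure (by simp)
      obtain rfl : D = y.ctx := hZ fun c' r' h' => by
        obtain ⟨-, rfl⟩ := Act.inQ.inj h'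
        exact hy hr
      rw [PMF.pure_map]
      exact Step.q_com_left _ _ _ _ _ c r h (h5 _)
    rwa [PMF.pure_map] at this
  | q_com_right _ E' _ G' _ c r h₁ h₂ =>
    obtain ⟨-, -, -, h, -⟩ := h₂.classical hG
    exact absurd trivial h
  | inp_int_left _ E' _ _ C' c r hr h =>
    have := hleft h fun c' r' h' => by
      obtain ⟨-, rfl⟩ := Act.inQ.inj h'
      exact hr
    rwa [PMF.pure_map] at this
  | inp_int_right _ _ G' _ C' c r hr h =>
    obtain ⟨-, -, -, h, -⟩ := h.classical hG
    exact absurd trivial h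
  | oth_int_left _ _ _ _ m hα h =>
    exact hleft h fun c r h' => absurd (h' ▸ trivial) hα
  | oth_int_right _ _ _ _ m hα h =>
    obtain ⟨G', rfl, h4, -, h5⟩ := h.classical hG
    -- `G` makes the same move in the context of `Y`, while `X` and `Y` stay as they are.
    have h6 := Step.oth_int_right Y.1.proc G Y.1.ctx α _ hα (h5 Y.1.ctx)
    rw [PMF.pure_map] at h6 ⊢
    exact ⟨_, hs_weak (Weak.single h6), PMF.Coupled.pure (.inr ⟨_, _, G', hXY, h4, rfl, rfl⟩)⟩

theorem stuck_of_stuck_par [Infinite QV] {X A : Con CV QV CC QC} {G : Proc CV QV CC QC}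
    (hA : A.1 = parRaw G X.1) (h : Stuck A) : Stuck X := by
  rw [stuck_iff] at *
  intro α m hm
  have hqv := A.2.2
  rw [hA] at hqv
  obtain ⟨β, n, hn⟩ := hm.of_par_left (G := G) X.2.2 (Finset.union_subset_iff.1 hqv).2
  exact h β n (hA ▸ hn)

theorem parRel_isWeakBisim [Infinite QV] :
    IsWeakBisim fun A B : Con CV QV CC QC => ParRel A.1 B.1 := by
  refine isWeakBisim_iff.2 ⟨parRel_equivalence.comap _, ?_⟩
  rintro A B (h | ⟨X, Y, G, h, hG, hA, hB⟩)
  · obtain rfl := Subtype.ext h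
    exact ⟨fun α μ hμ => ⟨μ, (Weak.single hμ).hat, PMF.Coupled.refl (fun _ => .inl rfl) μ⟩,
      fun _ _ => rfl⟩
  · refine ⟨parRaw_match hG hA hB h (.inl rfl)
      ((isWeakBisim_iff.1 weakBisimilar_isWeakBisim).2 _ _ h).1, fun hA' hB' => ?_⟩
    rw [hA, hB]
    exact (weakBisimilar_isWeakBisim.2 _ _ h).2 (stuck_of_stuck_par hA hA')
      (stuck_of_stuck_par hB hB')

theorem ProcEq.par [Infinite QV] {P Q G : Proc CV QV CC QC} (hG : G.Classical)
    (h : ProcEq P Q) : ProcEq (.par P G) (.par Q G) := by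
  refine procEq_of_strictMatch (f := fun P => .par P G) (r := ProcEq) (fun P Q h => h.symm)
    (fun P Q h C hP hQ α κ hκ => ?_) h
  have hP' : RawConf.IsConf ⟨P, C⟩ := ⟨hP.1.2.1, (Finset.union_subset_iff.1 hP.2).1⟩
  have hQ' : RawConf.IsConf ⟨Q, C⟩ := ⟨hQ.1.2.1, (Finset.union_subset_iff.1 hQ.2).1⟩
  obtain ⟨ν, h1, h2⟩ := parRaw_match (X := ⟨⟨P, C⟩, hP'⟩) (Y := ⟨⟨Q, C⟩, hQ'⟩)
    (A := ⟨⟨.par P G, C⟩, hP⟩) (B := ⟨⟨.par Q G, C⟩, hQ⟩) hG rfl rfl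
    (h C hP' hQ').weakBisimilar (.inr rfl) (conEq_iff.1 (h C hP' hQ')).1 α κ hκ
  exact ⟨ν, h1, h2.mono fun a _ b _ hab => ⟨_, parRel_isWeakBisim, hab⟩⟩

end QCCS

/-! ### The congruence theorem -/

theorem mainTheorem5 {CV : Type u} {QV : Type v} {CC : Type w} {QC : Type z}
    [DecidableEq CV] [DecidableEq QV] [Infinite QV]
    (E F : QCCS.Proc CV QV CC QC) (hE : E.WF) (hF : F.WF) (hEF : QCCS.ExprEq E F) :
    ((∀ (c : CC) (x : CV), QCCS.ExprEq (.inC c x E) (.inC c x F)) ∧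
      (∀ (c : CC) (e : QCCS.Exp CV), QCCS.ExprEq (.outC c e E) (.outC c e F)) ∧
      (∀ (c : QC) (q : QV), E.qv.erase q = F.qv.erase q →
        QCCS.ExprEq (.inQ c q E) (.inQ c q F)) ∧
      (∀ (c : QC) (q : QV), q ∉ E.qv → q ∉ F.qv →
        QCCS.ExprEq (.outQ c q E) (.outQ c q F)) ∧
      (∀ (k : ℕ) (U : Matrix.unitaryGroup (Fin k → Fin 2) ℂ) (q : Fin k ↪ QV),
        QCCS.ExprEq (.unit U q E) (.unit U q F)) ∧
      (∀ (k : ℕ) (M : Matrix (Fin k → Fin 2) (Fin k → Fin 2) ℂ) (hM : M.IsHermitian)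
        (q : Fin k ↪ QV) (x : CV), QCCS.ExprEq (.meas M hM q x E) (.meas M hM q x F))) ∧
    (∀ G : QCCS.Proc CV QV CC QC, G.WF → QCCS.ExprEq (.sum E G) (.sum F G)) ∧
    (∀ G : QCCS.Proc CV QV CC QC, G.WF → G.Classical → Disjoint E.qv G.qv → Disjoint F.qv G.qv →
      QCCS.ExprEq (.par E G) (.par F G)) ∧
    (∀ f : QCCS.Relabeling CC QC, QCCS.ExprEq (.rel E f) (.rel F f)) := by
  refine ⟨⟨fun c x V => ?_, fun c e V => (hEF V).outC c _, fun c q hq V => ?_,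
    fun c q _ _ V => (hEF V).outQ c q, fun k U q V => (hEF V).unit U q, fun k M hM q x V => ?_⟩,
    fun G _ V => (hEF V).sum _, fun G _ hG _ _ V => ?_, fun f V => (hEF V).rel f⟩
  · refine QCCS.procEq_inC c x fun a => ?_
    -- The value `a` of the bound variable is absorbed into the assignment, at which the hypothesis
    -- applies.
    rw [QCCS.Proc.subst_update_none_subst₁, QCCS.Proc.subst_update_none_subst₁]
    exact hEF _
  · refine (hEF V).inQ c q ?_
    rwa [QCCS.Proc.inst, QCCS.Proc.qv_subst, QCCS.Proc.inst, QCCS.Proc.qv_subst]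
  · refine QCCS.procEq_meas hM q x fun a => ?_
    rw [QCCS.Proc.subst_update_none_subst₁, QCCS.Proc.subst_update_none_subst₁]
    exact hEF _
  · exact (hEF V).par (G := G.inst V) ((QCCS.Proc.classical_subst _ _).2 hG)
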